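/- For complex $q$ with $|q|<1$ write $(z;q)_n=\prod_{j=0}^{n-1}(1-zq^j)$, $(z;q)_\infty=\prod_{j\ge 0}(1-zq^j)$, $(z_1,\dots,z_k;q)_n=(z_1;q)_n\cdots(z_k;q)_n$ for $n\in\mathbb{N}\cup\{\infty\}$, and define $$F(\rho_1,\rho_2,z;q)=\frac{(q;q)_\infty}{(z,z^{-1},\rho_1,\rho_2;q)_\infty}\sum_{n=1}^\infty\frac{(z,z^{-1},\rho_1,\rho_2;q)_n\left(\frac{q}{\rho_1\rho_2}\right)^n}{(q;q)_{2n}},$$ $$G(\rho_1,\rho_2,z;q)=\frac{(q;q)_\infty}{(z,z^{-1},\rho_1,\rho_2;q)_\infty}\sum_{n=1}^\infty\frac{(z,z^{-1},\rho_1,\rho_2;q)_n\left(\frac{q^2}{\rho_1\rho_2}\right)^n}{(q;q)_{2n}},$$ $RU(z,q)=F(z^2,z^{-2},z;q)$ and $RV(z,q)=G(z^2,z^{-2},z;q)$. For $q\ne 0$ put $E(a)=(q^a;q^a)_\infty$, $P_\ell(a)=(q^{\ell a},q^{\ell^2-\ell a};q^{\ell^2})_\infty$, and, for integers $A>0$,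 $B$, $C$ with $A+B$ even and $A\nmid C$, $$L(A,B,C)=\sum_{n=-\infty}^{\infty}\frac{(-1)^nq^{(An^2+Bn)/2}}{1-q^{An+C}}.$$ **Theorem 1.2.** Let $\zeta_\ell\in\mathbb{C}$ denote any primitive $\ell$-th root of unity. The series defining $RU(\zeta_\ell,q)$ and $RV(\zeta_\ell,q)$ for $\ell\in\{3,5,7\}$ and $|q|<1$, and the series $L(A,B,C)$ for $0<|q|<1$, converge absolutely. For $0<|q|<1$, $$RU(\zeta_3,q)=\frac{q^7}{E(3)}L(9,27,6)-\frac{q^5}{E(3)}L(9,21,6),$$ $$RV(\zeta_3,q)=-\frac{q^3}{E(3)}L(9,15,6)+\frac{q^5}{E(3)}L(9,21,6);$$ with $P=P_5$, $$RU(\zeta_5,q)=q\frac{E(25)}{P(1)^2}-\frac{q^7}{E(25)P(2)}L(25,45,10)-\frac{q^4}{E(25)P(1)}L(25,35,10),$$ $$RV(\zeta_5,q)=-\frac{q^5}{E(25)P(1)}L(25,35,15)+\frac{q^{12}}{E(25)P(2)}L(25,55,15)+q^2\frac{E(25)}{P(1)P(2)}-q^3\frac{E(25)}{P(2)^2};$$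 and, with $P=P_7$ and $\zeta=\zeta_7$, $$\begin{aligned}RU(\zeta,q)={}&q\frac{E(49)P(3)}{P(1)P(2)^2}-(\zeta^2+\zeta^5)\frac{q^{15}}{E(49)P(3)}L(49,91,21)-(\zeta^3+\zeta^4)q^2\frac{E(49)}{P(1)P(2)}+q^3\frac{E(49)}{P(1)P(3)}\\&+(\zeta+\zeta^6)q^4\frac{E(49)}{P(2)^2}+(\zeta+\zeta^6)\frac{q^{11}}{E(49)P(2)}L(49,77,21)+(1+\zeta^3+\zeta^4)q^6\frac{E(49)}{P(3)^2}\\&-(1+\zeta^3+\zeta^4)\frac{q^6}{E(49)P(1)}L(49,63,21).\end{aligned}$$ Moreover $RU(\zeta_3,q)$, $RV(\zeta_3,q)$, $RU(\zeta_5,q)$, $RV(\zeta_5,q)$ and $RU(\zeta_7,q)$ are each given by a power series in $q$ convergent for $|q|<1$, and for all $n\ge 0$ the following coefficients vanish: those of $q^{3n}$ in $RU(\zeta_3,q)$; of $q^{3n+1}$ in $RV(\zeta_3,q)$; of $q^{5n}$ and $q^{5n+3}$ in $RU(\zeta_5,q)$; of $q^{5n+1}$ and $q^{5n+4}$ in $RV(\zeta_5,q)$;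 and of $q^{7n}$ and $q^{7n+5}$ in $RU(\zeta_7,q)$. -/

import Mathlib

noncomputable section

namespace QuadRank

/-- The finite `q`-Pochhammer symbol `(z; q)_n = ∏_{j=0}^{n-1} (1 - z q^j)`. -/
def qPoch (z q : ℂ) (n : ℕ) : ℂ := ∏ j ∈ Finset.range n, (1 - z * q ^ j)

/-- The infinite `q`-Pochhammer symbol `(z; q)_∞ = ∏_{j=0}^∞ (1 - z q^j)`, for `‖q‖ < 1`. -/
def qPochInf (z q : ℂ) : ℂ := ∏' j : ℕ, (1 - z * q ^ j)

/-- The infinite product defining `(z; q)_∞` converges for `‖q‖ < 1`. -/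
theorem multipliable_qPochInf (z : ℂ) {q : ℂ} (hq : ‖q‖ < 1) :
    Multipliable (fun j : ℕ => 1 - z * q ^ j) := by
  have h : Summable (fun j : ℕ => ‖-(z * q ^ j)‖) := by
    simp only [norm_neg, norm_mul, norm_pow]
    exact (summable_geometric_of_lt_one (norm_nonneg q) hq).mul_left _
  simpa [sub_eq_add_neg] using multipliable_one_add_of_summable h

/-- The product `[z; q]_∞ = (z; q)_∞ (q/z; q)_∞`. -/
def jacProd (z q : ℂ) : ℂ := qPochInf z q * qPochInf (q / z) q

/-- The `n`-th term `(z, z⁻¹, ρ₁, ρ₂; q)_n (q^e / (ρ₁ρ₂))^n / (q; q)_{2n}`; the exponent `e` is `1`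
for `F` and `2` for `G`. -/
def rankTerm (e : ℕ) (ρ₁ ρ₂ z q : ℂ) (n : ℕ) : ℂ :=
  qPoch z q n * qPoch z⁻¹ q n * qPoch ρ₁ q n * qPoch ρ₂ q n * (q ^ e / (ρ₁ * ρ₂)) ^ n
    / qPoch q q (2 * n)

/-- The factor `(q; q)_∞ / (z, z⁻¹, ρ₁, ρ₂; q)_∞`. -/
def rankFactor (ρ₁ ρ₂ z q : ℂ) : ℂ :=
  qPochInf q q / (qPochInf z q * qPochInf z⁻¹ q * qPochInf ρ₁ q * qPochInf ρ₂ q)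

/-- The function `F(ρ₁, ρ₂, z; q)`; the sum runs over `n ≥ 1`. -/
def F (ρ₁ ρ₂ z q : ℂ) : ℂ :=
  rankFactor ρ₁ ρ₂ z q * ∑' n : ℕ, rankTerm 1 ρ₁ ρ₂ z q (n + 1)

/-- The function `G(ρ₁, ρ₂, z; q)`; the sum runs over `n ≥ 1`. -/
def G (ρ₁ ρ₂ z q : ℂ) : ℂ :=
  rankFactor ρ₁ ρ₂ z q * ∑' n : ℕ, rankTerm 2 ρ₁ ρ₂ z q (n + 1)

/-- `RU(z, q) = F(z², z⁻², z; q)`. -/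
def RU (z q : ℂ) : ℂ := F (z ^ 2) (z ^ (-2 : ℤ)) z q

/-- `RV(z, q) = G(z², z⁻², z; q)`. -/
def RV (z q : ℂ) : ℂ := G (z ^ 2) (z ^ (-2 : ℤ)) z q

/-- The `n`-th term `(-1)^n q^{(A n² + B n)/2} / (1 - q^{A n + C})` of a generalized Lambert series.
It is used for `A + B` even only, where the division by `2` in `ℤ` is exact. -/
def lambertTerm (A B C : ℤ) (q : ℂ) (n : ℤ) : ℂ :=
  (-1) ^ n * q ^ ((A * n ^ 2 + B * n) / 2) / (1 - q ^ (A * n + C))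

/-- The bilateral generalized Lambert series
`∑_{n ∈ ℤ} (-1)^n q^{(A n² + B n)/2} / (1 - q^{A n + C})`. -/
def lambert (A B C : ℤ) (q : ℂ) : ℂ := ∑' n : ℤ, lambertTerm A B C q n

/-- `E(a) = (q^a; q^a)_∞`. -/
def E (a : ℕ) (q : ℂ) : ℂ := qPochInf (q ^ a) (q ^ a)

/-- `P(a) = [q^{ℓa}; q^{ℓ²}]_∞ = (q^{ℓa}, q^{ℓ² - ℓa}; q^{ℓ²})_∞`. -/
def P (ℓ a : ℕ) (q : ℂ) : ℂ := jacProd (q ^ (ℓ * a)) (q ^ (ℓ ^ 2))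

/-- `f` has the power series expansion `∑ a n q^n` on the open unit disc; the coefficients `a` are
determined by `f`. -/
def HasQExpansion (f : ℂ → ℂ) (a : ℕ → ℂ) : Prop :=
  ∀ q : ℂ, ‖q‖ < 1 → HasSum (fun n : ℕ => a n * q ^ n) (f q)

end QuadRank

end

noncomputable section

namespace QuadRank

open Filter Topology Finset

/-! ### Basic facts on `q`-Pochhammer symbols -/

/-! Since ρ₁ = z² and ρ₂ = z⁻² have product 1, the sums in question are of the form ∑ (ρ)_N (ρ⁻¹)_N
q^N β_N, the left side of Bailey's lemma for the parameters ρ, ρ⁻¹. For these parameters the partial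
sums of the Bailey kernel have a closed form (`sum_range_kernel`), and `hasSum_bailey` turns the sum
into a bilateral series with denominators (1 - ρ q^r)(1 - ρ⁻¹ q^r). The required β_N comes from a
combination of three finite Jacobi triple products (`finite_triple_product`, `pair_of_jacobi`). The
outcome is `rank_series`: up to a simple factor, θ(z; q) times F or G is a bilateral series.

Now let z = ζ be a primitive ℓ-th root of unity, ℓ = 2h + 1. The polynomial (1 - ρx)(1 - ρ⁻¹x)
divides 1 - x^ℓ, and the remaining coefficients depend only on r modulo ℓ. Splitting r = mℓ + s
therefore writes Θ · RU and Θ · RV, where θ(ζ; q) = (1 - ζ) Θ, as finite combinations of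
Appell–Lerch series in base q^(ℓ²) (`lambert_dissection`, `rank_eq`). Such a series carries two
indices, κ = h + e + k and the residue s.

Two relations reduce these series to a few. By `appell_change`, series with equal κ and different s
are proportional up to a theta quotient; by `appellPow_inv`, the pair (κ, s) may be replaced by (2ℓ
- κ, ℓ - s). For ℓ = 3 one has Θ = E(3), and inversion alone suffices. For ℓ = 5 and ℓ = 7, Θ is
itself dissected into theta functions, every series is expressed through one anchor for each κ, and
the claim multiplied by Θ ≠ 0 becomes a rational identity in q, E, P and the anchors, with g = ζ +
ζ⁻¹ subject to its minimal polynomial. For ℓ = 7 one further input is needed, a quartic relation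
between the three theta functions (`thetaPow_seven_relation`). It is an instance of the three-term
relation `theta_three_term`, which expresses the consistency of `appell_change` for three
parameters.

For the vanishing statements, RU and RV are holomorphic on the unit disc because their series are
dominated by geometric ones on smaller discs. Each term of the formulas is q^k times a function of
q^ℓ, so averaging over q ↦ ω^j q with ω^ℓ = 1 kills the coefficients in every residue class that
contains no exponent k (`HasQExpansion.coeff_eq_zero`). -/

theorem qPoch_zero (z q : ℂ) : qPoch z q 0 = 1 := by simp [qPoch]

theorem qPoch_succ (z q : ℂ) (n : ℕ) : qPoch z q (n + 1) = qPoch z q n * (1 - z * q ^ n) :=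
  Finset.prod_range_succ _ _

theorem qPoch_succ' (z q : ℂ) (n : ℕ) : qPoch z q (n + 1) = (1 - z) * qPoch (z * q) q n := by
  rw [qPoch, Finset.prod_range_succ', qPoch, mul_comm]
  simp only [pow_zero, mul_one]
  congr 1
  exact Finset.prod_congr rfl fun j _ => by ring

theorem tendsto_qPoch (z : ℂ) {q : ℂ} (hq : ‖q‖ < 1) :
    Tendsto (qPoch z q) atTop (𝓝 (qPochInf z q)) :=
  (multipliable_qPochInf z hq).tendsto_prod_tprod_nat

theorem exists_bound_of_tendsto {f : ℕ → ℂ} {l : ℂ} (h : Tendsto f atTop (𝓝 l)) :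
    ∃ C : ℝ, 0 ≤ C ∧ ∀ n, ‖f n‖ ≤ C := by
  obtain ⟨C, hC⟩ := h.norm.bddAbove_range
  exact ⟨C, (norm_nonneg _).trans (hC ⟨0, rfl⟩), fun n => hC ⟨n, rfl⟩⟩

theorem qPochInf_eq_mul (z : ℂ) {q : ℂ} (hq : ‖q‖ < 1) :
    qPochInf z q = (1 - z) * qPochInf (z * q) q := by
  have h1 := (tendsto_add_atTop_iff_nat 1).2 (tendsto_qPoch z hq)
  have h2 := (tendsto_qPoch (z * q) hq).const_mul (1 - z)
  refine tendsto_nhds_unique h1 (h2.congr fun n => ?_)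
  rw [qPoch_succ']

theorem qPochInf_ne_zero {z q : ℂ} (hq : ‖q‖ < 1) (h : ∀ j : ℕ, 1 - z * q ^ j ≠ 0) :
    qPochInf z q ≠ 0 := by
  have hs : Summable (fun j : ℕ => ‖-(z * q ^ j)‖) := by
    simp only [norm_neg, norm_mul, norm_pow]
    exact (summable_geometric_of_lt_one (norm_nonneg q) hq).mul_left _
  have := tprod_one_add_ne_zero_of_summable (f := fun j : ℕ => -(z * q ^ j))
    (fun j => by simpa [sub_eq_add_neg] using h j) hs
  simpa [qPochInf, sub_eq_add_neg] using this

theorem one_sub_ne_zero_of_norm_lt {x : ℂ} (h : ‖x‖ < 1) : 1 - x ≠ 0 := by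
  intro h0
  rw [← sub_eq_zero.1 h0, norm_one] at h
  exact lt_irrefl _ h

theorem norm_mul_pow_lt_one {z q : ℂ} (hq : ‖q‖ < 1) (hz : ‖z‖ < 1) (j : ℕ) :
    ‖z * q ^ j‖ < 1 := by
  rw [norm_mul, norm_pow]
  calc ‖z‖ * ‖q‖ ^ j ≤ ‖z‖ * 1 := by
        gcongr
        exact pow_le_one₀ (norm_nonneg _) hq.le
    _ < 1 := by simpa using hz

theorem qPochInf_ne_zero_of_norm_lt {z q : ℂ} (hq : ‖q‖ < 1) (hz : ‖z‖ < 1) :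
    qPochInf z q ≠ 0 :=
  qPochInf_ne_zero hq fun j => one_sub_ne_zero_of_norm_lt (norm_mul_pow_lt_one hq hz j)

theorem qPochInf_ne_zero_of_norm_eq_one {z q : ℂ} (hq : ‖q‖ < 1) (hz : ‖z‖ = 1) (h1 : z ≠ 1) :
    qPochInf z q ≠ 0 := by
  rw [qPochInf_eq_mul z hq]
  refine mul_ne_zero (sub_ne_zero.2 h1.symm) (qPochInf_ne_zero_of_norm_lt hq ?_)
  rwa [norm_mul, hz, one_mul]

theorem qPoch_self_ne_zero {q : ℂ} (hq : ‖q‖ < 1) (n : ℕ) : qPoch q q n ≠ 0 :=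
  Finset.prod_ne_zero_iff.2 fun j _ => one_sub_ne_zero_of_norm_lt (norm_mul_pow_lt_one hq hq j)

theorem tendsto_inv_qPoch_self {q : ℂ} (hq : ‖q‖ < 1) :
    Tendsto (fun n => (qPoch q q n)⁻¹) atTop (𝓝 (qPochInf q q)⁻¹) :=
  (tendsto_qPoch q hq).inv₀ (qPochInf_ne_zero_of_norm_lt hq hq)

theorem exists_bound_qPoch (z : ℂ) {q : ℂ} (hq : ‖q‖ < 1) :
    ∃ C : ℝ, 0 ≤ C ∧ ∀ n, ‖qPoch z q n‖ ≤ C :=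
  exists_bound_of_tendsto (tendsto_qPoch z hq)

/-! ### Triangular exponents and reciprocal `q`-factorials over `ℤ` -/

/-- The exponent `n (n - 1) / 2`. -/
def tri (n : ℤ) : ℤ := n * (n - 1) / 2

theorem two_mul_tri (n : ℤ) : 2 * tri n = n * (n - 1) :=
  Int.mul_ediv_cancel' (by
    have := Int.even_mul_succ_self (n - 1)
    rw [mul_comm, sub_add_cancel] at this
    rw [← mul_comm] at this
    exact (even_iff_two_dvd.1 (by rwa [mul_comm])))

theorem tri_eq_of {n m : ℤ} (h : n * (n - 1) = 2 * m) : tri n = m := by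
  have := two_mul_tri n
  omega

theorem tri_succ (n : ℤ) : tri (n + 1) = tri n + n :=
  tri_eq_of (by linarith [two_mul_tri n])

theorem tri_add (m n : ℤ) : tri (m + n) = tri m + tri n + m * n :=
  tri_eq_of (by linarith [two_mul_tri n, two_mul_tri m])

/-- `1 / (q; q)_n`, extended by `0` to negative `n`. -/
def invFact (q : ℂ) (n : ℤ) : ℂ := if n < 0 then 0 else (qPoch q q n.toNat)⁻¹

theorem invFact_of_neg (q : ℂ) {n : ℤ} (hn : n < 0) : invFact q n = 0 := by simp [invFact, hn]

theorem invFact_natCast (q : ℂ) (n : ℕ) : invFact q n = (qPoch q q n)⁻¹ := by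
  simp [invFact]

theorem invFact_sub_one {q : ℂ} (hq : ‖q‖ < 1) (n : ℤ) :
    invFact q (n - 1) = (1 - q ^ n) * invFact q n := by
  rcases lt_trichotomy n 0 with h | h | h
  · rw [invFact_of_neg q h, invFact_of_neg q (by omega), mul_zero]
  · subst h
    simp [invFact]
  · obtain ⟨m, rfl⟩ : ∃ m : ℕ, n = m + 1 := ⟨(n - 1).toNat, by omega⟩
    have h1 : ((m : ℤ) + 1) = ((m + 1 : ℕ) : ℤ) := by push_cast; ring
    rw [add_sub_cancel_right, invFact_natCast, h1, invFact_natCast, qPoch_succ, zpow_natCast,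
      pow_succ']
    have h2 : (1 - q * q ^ m) ≠ 0 := one_sub_ne_zero_of_norm_lt (norm_mul_pow_lt_one hq hq m)
    have := qPoch_self_ne_zero hq m
    field_simp

theorem exists_bound_invFact {q : ℂ} (hq : ‖q‖ < 1) :
    ∃ C : ℝ, 0 ≤ C ∧ ∀ n, ‖invFact q n‖ ≤ C := by
  obtain ⟨C, h0, hC⟩ := exists_bound_of_tendsto (tendsto_inv_qPoch_self hq)
  refine ⟨C, h0, fun n => ?_⟩
  unfold invFact
  split_ifs
  · simpa
  · exact hC _

theorem tendsto_invFact {q : ℂ} (hq : ‖q‖ < 1) {f : ℕ → ℤ} (hf : Tendsto f atTop atTop) :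
    Tendsto (fun N => invFact q (f N)) atTop (𝓝 (qPochInf q q)⁻¹) := by
  have h1 : Tendsto (fun n : ℤ => n.toNat) atTop atTop :=
    tendsto_atTop_mono (fun n => le_rfl)
      (tendsto_atTop_atTop.2 fun b => ⟨b, fun a ha => by omega⟩)
  refine ((tendsto_inv_qPoch_self hq).comp (h1.comp hf)).congr' ?_
  filter_upwards [hf.eventually_ge_atTop 0] with N hN
  simp [invFact, not_lt.2 hN]

/-! ### The Jacobi triple product -/

theorem summable_norm_theta {q z : ℂ} (hq0 : q ≠ 0) (hq : ‖q‖ < 1) (hz : z ≠ 0) :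
    Summable (fun n : ℤ => ‖q ^ tri n * z ^ n‖) := by
  have key : ∀ w : ℂ, w ≠ 0 → ∀ e : ℕ → ℤ, (∀ n, e (n + 1) = e n + n) →
      Summable (fun n : ℕ => ‖q ^ e n * w ^ n‖) := by
    intro w hw e he
    refine summable_of_ratio_test_tendsto_lt_one (l := 0) one_pos
      (Eventually.of_forall fun n => ?_) ?_
    · simp [hq0, hw, zpow_ne_zero]
    · have : Tendsto (fun n : ℕ => ‖q‖ ^ n * ‖w‖) atTop (𝓝 (0 * ‖w‖)) :=
        (tendsto_pow_atTop_nhds_zero_of_lt_one (norm_nonneg _) hq).mul_const _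
      rw [zero_mul] at this
      refine this.congr fun n => ?_
      have h1 : ‖q ^ e n * w ^ n‖ ≠ 0 := by simp [hq0, hw, zpow_ne_zero]
      rw [norm_norm, norm_norm, eq_div_iff h1, he, zpow_add₀ hq0, pow_succ, zpow_natCast]
      simp only [norm_mul, norm_pow]
      ring
  refine Summable.of_nat_of_neg ?_ ?_
  · simpa using key z hz (fun n => tri n) (fun n => by push_cast; exact tri_succ n)
  -- Since tri(-n) = tri(n) + n, the negative half of the series at z is the positive half at q / z.
  · have := key (q / z) (div_ne_zero hq0 hz) (fun n => tri n)
      (fun n => by push_cast; exact tri_succ n)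
    refine this.congr fun n => ?_
    have h2 : tri (-(n : ℤ)) = tri n + n := tri_eq_of (by linarith [two_mul_tri n])
    rw [h2, zpow_add₀ hq0, div_pow, zpow_neg, zpow_natCast, zpow_natCast]
    congr 1
    field_simp

theorem summable_theta_mul {q z : ℂ} (hq0 : q ≠ 0) (hq : ‖q‖ < 1) (hz : z ≠ 0) {b : ℤ → ℂ}
    {C : ℝ} (hb : ∀ n, ‖b n‖ ≤ C) : Summable (fun n : ℤ => ‖q ^ tri n * z ^ n * b n‖) := by
  refine Summable.of_nonneg_of_le (fun _ => norm_nonneg _) (fun n => ?_)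
    ((summable_norm_theta hq0 hq hz).mul_right C)
  rw [norm_mul]
  gcongr
  exact hb n

theorem norm_neg_one_zpow (n : ℤ) : ‖(-1 : ℂ) ^ n‖ = 1 := by simp

/-- The theta series `∑ (-1)^n q^{n(n-1)/2} z^n`. -/
def theta (z q : ℂ) : ℂ := ∑' n : ℤ, (-1) ^ n * q ^ tri n * z ^ n

theorem summable_theta {q z : ℂ} (hq0 : q ≠ 0) (hq : ‖q‖ < 1) (hz : z ≠ 0) :
    Summable (fun n : ℤ => (-1) ^ n * q ^ tri n * z ^ n) := by
  refine Summable.of_norm ((summable_norm_theta hq0 hq hz).congr fun n => ?_)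
  simp

/-- The reciprocal factorials vanish unless -N ≤ r ≤ N, so these bilateral sums are finite sums. -/
theorem summable_mul_invFact (q : ℂ) (N : ℤ) (f : ℤ → ℂ) :
    Summable (fun r : ℤ => f r * (invFact q (N - r) * invFact q (N + r))) := by
  refine summable_of_ne_finset_zero (s := Finset.Icc (-N) N) fun r hr => ?_
  rw [Finset.mem_Icc, not_and_or, not_le, not_le] at hr
  rcases hr with h | h
  · rw [invFact_of_neg q (show N + r < 0 by omega)]; ring
  · rw [invFact_of_neg q (show N - r < 0 by omega)]; ring

/-- Induction on N: the kernel at N + 1 is a combination of the kernel at N and its translates by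
±1, and translating r multiplies the sum by a power of w, which produces the factor (1 - w q^N)(1 -
q^(N+1)/w). In the language of Bailey pairs this supplies β_N for theta coefficients; its limit is
the triple product. -/
theorem finite_triple_product {q w : ℂ} (hq0 : q ≠ 0) (hq : ‖q‖ < 1) (hw : w ≠ 0) (N : ℕ) :
    ∑' r : ℤ, (-1) ^ r * q ^ tri r * w ^ r * (invFact q (N - r) * invFact q (N + r)) =
      qPoch w q N * qPoch (q / w) q N / qPoch q q (2 * N) := by
  set c : ℤ → ℂ := fun r => (-1) ^ r * q ^ tri r * w ^ r with hc
  have hc1 : ∀ r, c (r + 1) = -(c r * q ^ r * w) := fun r => by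
    simp only [hc]
    rw [tri_succ, zpow_add₀ hq0, zpow_add_one₀ hw, zpow_add_one₀ (by norm_num)]
    ring
  induction N with
  | zero =>
    rw [tsum_eq_single 0]
    · simp [qPoch_zero, tri, invFact]
    · intro r hr
      rcases lt_or_gt_of_ne hr with h | h
      · rw [invFact_of_neg q (show ((0 : ℕ) : ℤ) + r < 0 by push_cast; omega)]; ring
      · rw [invFact_of_neg q (show ((0 : ℕ) : ℤ) - r < 0 by push_cast; omega)]; ring
  | succ N ih =>
    set T : ℤ → ℤ → ℂ := fun M r => invFact q (M - r) * invFact q (M + r) with hT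
    have hs : ∀ (f : ℤ → ℂ) (M : ℤ), Summable fun r => f r * T M r := fun f M =>
      summable_mul_invFact q M f
    -- Multiplication by w or w⁻¹ is absorbed by reindexing, through c (r + 1) = -c r q^r w.
    have shift : w * ∑' r, c r * T N r = -∑' r, c r * (q ^ (1 - r) * T N (r - 1)) := by
      rw [← tsum_mul_left, ← tsum_neg,
        ← (Equiv.addRight (1 : ℤ)).tsum_eq (fun r => -(c r * (q ^ (1 - r) * T N (r - 1))))]
      refine tsum_congr fun r => ?_
      simp only [Equiv.coe_addRight, add_sub_cancel_right, hc1]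
      rw [show (1 : ℤ) - (r + 1) = -r by ring, zpow_neg]
      have := zpow_ne_zero r hq0
      field_simp
    have shift' : w⁻¹ * ∑' r, c r * T N r = -∑' r, c r * (q ^ r * T N (r + 1)) := by
      rw [← (Equiv.addRight (1 : ℤ)).tsum_eq, ← tsum_mul_left, ← tsum_neg]
      refine tsum_congr fun r => ?_
      simp only [Equiv.coe_addRight, hc1]
      field_simp
    -- The contiguity relation of the kernel. Everything is expressed through the reciprocal
    -- factorials at N + 1 ± r, after which it is a polynomial identity in q^N, q^r and q.
    have coef : ∀ r, (1 - q ^ (2 * N + 1)) * (1 - q ^ (2 * N + 2)) * (c r * T (N + 1) r) =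
        (1 + q ^ (2 * N + 1)) * (c r * T N r) + q ^ N * (c r * (q ^ (1 - r) * T N (r - 1)))
          + q ^ (N + 1) * (c r * (q ^ r * T N (r + 1))) := by
      intro r
      have e1 : invFact q (N - r) = (1 - q ^ ((N : ℤ) + 1 - r)) * invFact q (N + 1 - r) := by
        rw [← invFact_sub_one hq]; congr 1; ring
      have e2 : invFact q (N + r) = (1 - q ^ ((N : ℤ) + 1 + r)) * invFact q (N + 1 + r) := by
        rw [← invFact_sub_one hq]; congr 1; ring
      have e3 : invFact q (N - (r + 1)) = (1 - q ^ ((N : ℤ) - r)) * invFact q (N - r) := by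
        rw [← invFact_sub_one hq]; congr 1; ring
      have e4 : invFact q (N + (r - 1)) = (1 - q ^ ((N : ℤ) + r)) * invFact q (N + r) := by
        rw [← invFact_sub_one hq]; congr 1; ring
      have e5 : invFact q (N + (r + 1)) = invFact q (N + 1 + r) := by congr 1; ring
      have e6 : invFact q (N - (r - 1)) = invFact q (N + 1 - r) := by congr 1; ring
      simp only [hT, e3, e4, e5, e6]
      rw [e1, e2]
      have hr := zpow_ne_zero r hq0
      have g1 : q ^ ((N : ℤ) + 1 - r) = q ^ N * q / q ^ r := by
        rw [zpow_sub₀ hq0, zpow_add_one₀ hq0, zpow_natCast]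
      have g2 : q ^ ((N : ℤ) + 1 + r) = q ^ N * q * q ^ r := by
        rw [zpow_add₀ hq0, zpow_add_one₀ hq0, zpow_natCast]
      have g3 : q ^ ((N : ℤ) - r) = q ^ N / q ^ r := by
        rw [zpow_sub₀ hq0, zpow_natCast]
      have g4 : q ^ ((N : ℤ) + r) = q ^ N * q ^ r := by
        rw [zpow_add₀ hq0, zpow_natCast]
      have g5 : q ^ (1 - r) = q / q ^ r := by rw [zpow_sub₀ hq0, zpow_one]
      rw [g1, g2, g3, g4, g5]
      have p1 : q ^ (2 * N + 1) = (q ^ N) ^ 2 * q := by ring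
      have p2 : q ^ (2 * N + 2) = (q ^ N) ^ 2 * q ^ 2 := by ring
      have p3 : q ^ (N + 1) = q ^ N * q := pow_succ _ _
      rw [p1, p2, p3]
      generalize q ^ N = X
      generalize q ^ r = Y at hr
      field_simp
      ring
    have hs1 : Summable fun r => c r * (q ^ (1 - r) * T N (r - 1)) := by
      have := (hs (fun r => c (r + 1) * q ^ (-r)) N)
      rw [← (Equiv.addRight (1 : ℤ)).summable_iff]
      refine this.congr fun r => ?_
      simp only [Function.comp, Equiv.coe_addRight, add_sub_cancel_right]
      rw [show (1 : ℤ) - (r + 1) = -r by ring]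
      ring
    have hs2 : Summable fun r => c r * (q ^ r * T N (r + 1)) := by
      have := (hs (fun r => c (r - 1) * q ^ (r - 1)) N)
      rw [← (Equiv.subRight (1 : ℤ)).summable_iff]
      refine this.congr fun r => ?_
      simp only [Function.comp, Equiv.subRight_apply, sub_add_cancel]
      ring
    have total : (1 - q ^ (2 * N + 1)) * (1 - q ^ (2 * N + 2)) * ∑' r, c r * T (N + 1) r =
        (1 - w * q ^ N) * (1 - q / w * q ^ N) * ∑' r, c r * T N r := by
      rw [← tsum_mul_left, tsum_congr coef,
        Summable.tsum_add (((hs c N).mul_left _).add (hs1.mul_left _)) (hs2.mul_left _),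
        Summable.tsum_add ((hs c N).mul_left _) (hs1.mul_left _), tsum_mul_left, tsum_mul_left,
        tsum_mul_left]
      have p1 : q ^ (2 * N + 1) = (q ^ N) ^ 2 * q := by ring
      rw [p1, pow_succ, div_eq_mul_inv]
      linear_combination (q ^ N) * shift + q ^ N * q * shift' - (q ^ N) ^ 2 * q *
        (∑' r, c r * T N r) * (mul_inv_cancel₀ hw)
    have n1 : 1 - q ^ (2 * N + 1) ≠ 0 := one_sub_ne_zero_of_norm_lt (by
      rw [pow_succ']; exact norm_mul_pow_lt_one hq hq _)
    have n2 : 1 - q ^ (2 * N + 2) ≠ 0 := one_sub_ne_zero_of_norm_lt (by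
      rw [pow_succ']; exact norm_mul_pow_lt_one hq hq _)
    rw [ih] at total
    push_cast
    rw [show 2 * (N + 1) = 2 * N + 1 + 1 by ring, qPoch_succ q q (2 * N + 1), qPoch_succ q q (2
        * N),
      qPoch_succ w, qPoch_succ (q / w), ← pow_succ', ← pow_succ', eq_div_iff (mul_ne_zero
        (mul_ne_zero (qPoch_self_ne_zero hq _) n1) n2)]
    have n3 := qPoch_self_ne_zero hq (2 * N)
    have := congrArg (· * qPoch q q (2 * N)) total
    beta_reduce at this
    rw [mul_assoc (_ * _) (_ / _), div_mul_cancel₀ _ n3] at this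
    linear_combination this

/-- Jacobi's triple product identity. -/
theorem theta_eq {q z : ℂ} (hq0 : q ≠ 0) (hq : ‖q‖ < 1) (hz : z ≠ 0) :
    theta z q = qPochInf q q * jacProd z q := by
  obtain ⟨C, hC0, hC⟩ := exists_bound_invFact hq
  have hE := qPochInf_ne_zero_of_norm_lt hq hq
  have h1 : Tendsto (fun N : ℕ => ∑' r : ℤ, (-1) ^ r * q ^ tri r * z ^ r *
      (invFact q (N - r) * invFact q (N + r))) atTop
      (𝓝 (∑' r : ℤ, (-1) ^ r * q ^ tri r * z ^ r * ((qPochInf q q)⁻¹ * (qPochInf q q)⁻¹))) := by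
    refine tendsto_tsum_of_dominated_convergence ((summable_norm_theta hq0 hq hz).mul_right (C * C))
      (fun r => ?_) (Eventually.of_forall fun N r => ?_)
    · refine Tendsto.const_mul _ ((tendsto_invFact hq ?_).mul (tendsto_invFact hq ?_))
      · exact tendsto_atTop_add_const_right _ _ tendsto_natCast_atTop_atTop
      · exact tendsto_atTop_add_const_right _ _ tendsto_natCast_atTop_atTop
    · rw [norm_mul, norm_mul (invFact _ _), mul_assoc, norm_mul, norm_neg_one_zpow, one_mul]
      gcongr <;> apply hC
  have h2 : Tendsto (fun N : ℕ => qPoch z q N * qPoch (q / z) q N / qPoch q q (2 * N)) atTop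
      (𝓝 (qPochInf z q * qPochInf (q / z) q / qPochInf q q)) :=
    ((tendsto_qPoch z hq).mul (tendsto_qPoch (q / z) hq)).div
      ((tendsto_qPoch q hq).comp (tendsto_id.const_mul_atTop' (by norm_num))) hE
  have h3 := tendsto_nhds_unique (h1.congr fun N => finite_triple_product hq0 hq hz N) h2
  rw [tsum_mul_right, ← theta] at h3
  rw [jacProd]
  field_simp at h3
  linear_combination h3

theorem theta_ne_zero {q z : ℂ} (hq0 : q ≠ 0) (hq : ‖q‖ < 1) (hz : z ≠ 0)
    (h : ∀ n : ℤ, 1 - z * q ^ n ≠ 0) : theta z q ≠ 0 := by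
  rw [theta_eq hq0 hq hz, jacProd]
  refine mul_ne_zero (qPochInf_ne_zero_of_norm_lt hq hq) (mul_ne_zero
    (qPochInf_ne_zero hq fun j => by simpa using h j) (qPochInf_ne_zero hq fun j hj => ?_))
  have h1 : 1 = q / z * q ^ j := sub_eq_zero.1 hj
  apply h (-(j + 1 : ℤ))
  rw [zpow_neg, zpow_add_one₀ hq0, zpow_natCast]
  field_simp at h1 ⊢
  rw [← h1]
  ring

theorem theta_q_mul {q z : ℂ} (hq0 : q ≠ 0) (hz : z ≠ 0) :
    theta (q * z) q = -z⁻¹ * theta z q := by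
  rw [theta, theta, ← tsum_mul_left, ← (Equiv.addRight (1 : ℤ)).tsum_eq
    (fun n : ℤ => -z⁻¹ * ((-1) ^ n * q ^ tri n * z ^ n))]
  refine tsum_congr fun n => ?_
  simp only [Equiv.coe_addRight]
  rw [tri_succ, zpow_add₀ hq0, zpow_add_one₀ hz, zpow_add_one₀ (by norm_num), mul_zpow]
  field_simp

theorem theta_inv {q z : ℂ} (hq0 : q ≠ 0) (hz : z ≠ 0) :
    theta z⁻¹ q = -z⁻¹ * theta z q := by
  rw [← theta_q_mul hq0 hz, theta, theta, ← (Equiv.neg ℤ).tsum_eq]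
  refine tsum_congr fun n => ?_
  have : tri (-n) = tri n + n := tri_eq_of (by linarith [two_mul_tri n])
  simp only [Equiv.neg_apply]
  rw [this, zpow_add₀ hq0, mul_zpow, inv_zpow', neg_neg, zpow_neg, ← inv_zpow,
    show (-1 : ℂ)⁻¹ = -1 by norm_num]
  ring

theorem theta_one {q : ℂ} (hq0 : q ≠ 0) : theta 1 q = 0 := by
  have := theta_inv (q := q) hq0 one_ne_zero
  simp only [inv_one] at this
  linear_combination this / 2

/-! ### A Bailey-type transformation -/

/-- With parameters ρ and ρ⁻¹ the kernel of Bailey's lemma telescopes, so that already its partial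
sums have a closed form and only a limit is left to take. -/
theorem sum_range_kernel {q ρ : ℂ} (hq0 : q ≠ 0) (hq : ‖q‖ < 1) (hρ : ρ ≠ 0) (r : ℤ)
    (hr : (1 - ρ * q ^ r) * (1 - ρ⁻¹ * q ^ r) ≠ 0) (M : ℕ) :
    ∑ N ∈ range M, qPoch ρ q N * qPoch ρ⁻¹ q N * q ^ N * (invFact q (N - r) * invFact q (N + r)) =
      qPoch ρ q M * qPoch ρ⁻¹ q M * (invFact q (M - 1 - r) * invFact q (M - 1 + r)) *
        (q ^ r / ((1 - ρ * q ^ r) * (1 - ρ⁻¹ * q ^ r))) := by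
  induction M with
  | zero =>
    -- The indices -1 - r and -1 + r cannot both be nonnegative, so the closed form agrees with the
    -- empty sum.
    have : invFact q (((0 : ℕ) : ℤ) - 1 - r) * invFact q (((0 : ℕ) : ℤ) - 1 + r) = 0 := by
      rcases lt_or_ge r 0 with h | h
      · rw [invFact_of_neg q (show ((0 : ℕ) : ℤ) - 1 + r < 0 by push_cast; omega), mul_zero]
      · rw [invFact_of_neg q (show ((0 : ℕ) : ℤ) - 1 - r < 0 by push_cast; omega), zero_mul]
    rw [this]
    simp
  | succ M ih =>
    rw [Finset.sum_range_succ, ih, qPoch_succ, qPoch_succ]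
    have e1 : invFact q (M - 1 - r) = (1 - q ^ ((M : ℤ) - r)) * invFact q (M - r) := by
      rw [← invFact_sub_one hq]; congr 1; ring
    have e2 : invFact q (M - 1 + r) = (1 - q ^ ((M : ℤ) + r)) * invFact q (M + r) := by
      rw [← invFact_sub_one hq]; congr 1; ring
    have e3 : ((M + 1 : ℕ) : ℤ) - 1 - r = M - r := by push_cast; ring
    have e4 : ((M + 1 : ℕ) : ℤ) - 1 + r = M + r := by push_cast; ring
    rw [e1, e2, e3, e4, zpow_sub₀ hq0, zpow_add₀ hq0, zpow_natCast]
    have hY := zpow_ne_zero r hq0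
    generalize q ^ r = Y at hr hY
    generalize q ^ M = X
    rw [← mul_div_assoc, ← mul_div_assoc, eq_div_iff hr, add_mul, div_mul_cancel₀ _ hr]
    field_simp
    ring

theorem exists_bound_qPoch_pair (ρ : ℂ) {q : ℂ} (hq : ‖q‖ < 1) :
    ∃ C : ℝ, 0 ≤ C ∧ ∀ (N : ℕ) (r : ℤ),
      ‖qPoch ρ q N * qPoch ρ⁻¹ q N * (invFact q (N - r) * invFact q (N + r))‖ ≤ C := by
  obtain ⟨C1, h1, hC1⟩ := exists_bound_qPoch ρ hq
  obtain ⟨C2, h2, hC2⟩ := exists_bound_qPoch ρ⁻¹ hq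
  obtain ⟨C3, h3, hC3⟩ := exists_bound_invFact hq
  refine ⟨C1 * C2 * (C3 * C3), by positivity, fun N r => ?_⟩
  simp only [norm_mul]
  gcongr <;> solve_by_elim

theorem hasSum_kernel {q ρ : ℂ} (hq0 : q ≠ 0) (hq : ‖q‖ < 1) (hρ : ρ ≠ 0) (r : ℤ)
    (hr : (1 - ρ * q ^ r) * (1 - ρ⁻¹ * q ^ r) ≠ 0) :
    HasSum (fun N : ℕ => qPoch ρ q N * qPoch ρ⁻¹ q N * q ^ N *
        (invFact q (N - r) * invFact q (N + r)))
      (qPochInf ρ q * qPochInf ρ⁻¹ q * ((qPochInf q q)⁻¹ * (qPochInf q q)⁻¹) *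
        (q ^ r / ((1 - ρ * q ^ r) * (1 - ρ⁻¹ * q ^ r)))) := by
  obtain ⟨C, h0, hC⟩ := exists_bound_qPoch_pair ρ hq
  have hs : Summable (fun N : ℕ => qPoch ρ q N * qPoch ρ⁻¹ q N * q ^ N *
        (invFact q (N - r) * invFact q (N + r))) := by
    refine Summable.of_norm_bounded
      ((summable_geometric_of_lt_one (norm_nonneg q) hq).mul_left C) fun N => ?_
    rw [mul_right_comm, norm_mul, norm_pow]
    gcongr
    exact hC N r
  have ht := hs.hasSum.tendsto_sum_nat
  have h2 := ((tendsto_qPoch ρ hq).mul (tendsto_qPoch ρ⁻¹ hq)).mul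
    ((tendsto_invFact hq (f := fun M : ℕ => (M : ℤ) - 1 - r) (by
      simp only [sub_eq_add_neg, add_assoc]
      exact tendsto_atTop_add_const_right _ _ tendsto_natCast_atTop_atTop)).mul
    (tendsto_invFact hq (f := fun M : ℕ => (M : ℤ) - 1 + r) (by
      simp only [sub_eq_add_neg, add_assoc]
      exact tendsto_atTop_add_const_right _ _ tendsto_natCast_atTop_atTop)))
  have h3 := h2.mul_const (q ^ r / ((1 - ρ * q ^ r) * (1 - ρ⁻¹ * q ^ r)))
  rw [← tendsto_nhds_unique ht (h3.congr fun M => (sum_range_kernel hq0 hq hρ r hr M).symm)]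
  exact hs.hasSum

theorem summable_bailey {q ρ : ℂ} (hq : ‖q‖ < 1) {a : ℤ → ℂ} (ha : Summable fun r => ‖a r‖) :
    Summable (fun p : ℕ × ℤ => a p.2 * (qPoch ρ q p.1 * qPoch ρ⁻¹ q p.1 * q ^ p.1 *
        (invFact q (p.1 - p.2) * invFact q (p.1 + p.2)))) := by
  obtain ⟨C, h0, hC⟩ := exists_bound_qPoch_pair ρ hq
  refine Summable.of_norm_bounded
    (((summable_geometric_of_lt_one (norm_nonneg q) hq).mul_of_nonneg ha
      (fun _ => by positivity) (fun _ => norm_nonneg _)).mul_left C) fun p => ?_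
  have h1 := hC p.1 p.2
  calc ‖a p.2 * (qPoch ρ q p.1 * qPoch ρ⁻¹ q p.1 * q ^ p.1 *
        (invFact q (p.1 - p.2) * invFact q (p.1 + p.2)))‖
      = ‖a p.2‖ * ‖qPoch ρ q p.1 * qPoch ρ⁻¹ q p.1 *
        (invFact q (p.1 - p.2) * invFact q (p.1 + p.2))‖ * ‖q‖ ^ p.1 := by
        simp only [norm_mul, norm_pow]
        ring
    _ ≤ ‖a p.2‖ * C * ‖q‖ ^ p.1 := by gcongr
    _ = _ := by ring

/-- Bailey's lemma in bilateral form for the parameters ρ, ρ⁻¹: insert the definition of β_N,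
interchange the absolutely convergent sums over N and r, and evaluate the inner sum by
`hasSum_kernel`. -/
theorem hasSum_bailey {q ρ : ℂ} (hq0 : q ≠ 0) (hq : ‖q‖ < 1) (hρ : ρ ≠ 0)
    (hD : ∀ r : ℤ, (1 - ρ * q ^ r) * (1 - ρ⁻¹ * q ^ r) ≠ 0) {a : ℤ → ℂ}
    (ha : Summable fun r => ‖a r‖) {β : ℕ → ℂ}
    (hβ : ∀ N : ℕ, ∑' r : ℤ, a r * (invFact q (N - r) * invFact q (N + r)) = β N) :
    HasSum (fun N : ℕ => qPoch ρ q N * qPoch ρ⁻¹ q N * q ^ N * β N)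
      (qPochInf ρ q * qPochInf ρ⁻¹ q * ((qPochInf q q)⁻¹ * (qPochInf q q)⁻¹) *
        ∑' r : ℤ, a r * (q ^ r / ((1 - ρ * q ^ r) * (1 - ρ⁻¹ * q ^ r)))) := by
  have hs := summable_bailey (ρ := ρ) hq ha
  have h1 : ∀ N : ℕ, ∑' r : ℤ, a r * (qPoch ρ q N * qPoch ρ⁻¹ q N * q ^ N *
        (invFact q (N - r) * invFact q (N + r))) =
      qPoch ρ q N * qPoch ρ⁻¹ q N * q ^ N * β N := by
    intro N
    rw [← hβ, ← tsum_mul_left]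
    exact tsum_congr fun r => by ring
  have h2 : ∀ r : ℤ, ∑' N : ℕ, a r * (qPoch ρ q N * qPoch ρ⁻¹ q N * q ^ N *
        (invFact q (N - r) * invFact q (N + r))) =
      qPochInf ρ q * qPochInf ρ⁻¹ q * ((qPochInf q q)⁻¹ * (qPochInf q q)⁻¹) *
        (a r * (q ^ r / ((1 - ρ * q ^ r) * (1 - ρ⁻¹ * q ^ r)))) := by
    intro r
    rw [tsum_mul_left, (hasSum_kernel hq0 hq hρ r (hD r)).tsum_eq]
    ring
  have h3 := hs.prod.hasSum
  dsimp only at h3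
  rw [← Summable.tsum_comm (f := fun (N : ℕ) (r : ℤ) => a r * (qPoch ρ q N * qPoch ρ⁻¹ q N * q ^ N *
    (invFact q (N - r) * invFact q (N + r)))) hs, tsum_congr h2, tsum_mul_left, funext h1] at h3
  exact h3

/-! ### The bilateral series for `RU` and `RV` -/

theorem summable_norm_theta_coef {q w : ℂ} (hq0 : q ≠ 0) (hq : ‖q‖ < 1) (hw : w ≠ 0) :
    Summable fun r : ℤ => ‖(-1) ^ r * q ^ tri r * w ^ r‖ :=
  (summable_norm_theta hq0 hq hw).congr fun r => by simp

/-- The triple products at w = c/z, cz and c, with weights 1, z and -(1 + z). The third serves to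
make the combination vanish at N = 0, as befits a sum over n ≥ 1. -/
theorem pair_of_jacobi {q z : ℂ} (hq0 : q ≠ 0) (hq : ‖q‖ < 1) (hz : z ≠ 0) {c : ℂ} (hc : c ≠ 0)
    (N : ℕ) :
    ∑' r : ℤ, (-1) ^ r * q ^ tri r * c ^ r * (z ^ (-r) + z * z ^ r - 1 - z) *
        (invFact q (N - r) * invFact q (N + r)) =
      (qPoch (c / z) q N * qPoch (q / (c / z)) q N + z * (qPoch (c * z) q N * qPoch (q / (c *
          z)) q N)
        - (1 + z) * (qPoch c q N * qPoch (q / c) q N)) / qPoch q q (2 * N) := by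
  have h1 := finite_triple_product hq0 hq (div_ne_zero hc hz) N
  have h2 := finite_triple_product hq0 hq (mul_ne_zero hc hz) N
  have h3 := finite_triple_product hq0 hq hc N
  rw [sub_div, add_div, mul_div_assoc z, mul_div_assoc (1 + z), ← h1, ← h2, ← h3, ← tsum_mul_left,
    ← tsum_mul_left, ← Summable.tsum_add (summable_mul_invFact q N _)
      ((summable_mul_invFact q N _).mul_left _),
    ← Summable.tsum_sub ((summable_mul_invFact q N _).add
      ((summable_mul_invFact q N _).mul_left _)) ((summable_mul_invFact q N _).mul_left _)]
  refine tsum_congr fun r => ?_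
  rw [div_zpow, mul_zpow, zpow_neg]
  ring

theorem summable_pair {q z : ℂ} (hq0 : q ≠ 0) (hq : ‖q‖ < 1) (hz : z ≠ 0) {c : ℂ} (hc : c ≠ 0) :
    Summable fun r : ℤ => ‖(-1) ^ r * q ^ tri r * c ^ r * (z ^ (-r) + z * z ^ r - 1 - z)‖ := by
  have h1 := summable_norm_theta_coef hq0 hq (div_ne_zero hc hz)
  have h2 := summable_norm_theta_coef hq0 hq (mul_ne_zero hc hz)
  have h3 := summable_norm_theta_coef hq0 hq hc
  refine Summable.of_nonneg_of_le (fun _ => norm_nonneg _) (fun r => ?_)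
    ((h1.add (h2.mul_left ‖z‖)).add (h3.mul_left ‖1 + z‖))
  have : (-1) ^ r * q ^ tri r * c ^ r * (z ^ (-r) + z * z ^ r - 1 - z) =
      (-1) ^ r * q ^ tri r * (c / z) ^ r + z * ((-1) ^ r * q ^ tri r * (c * z) ^ r)
      - (1 + z) * ((-1) ^ r * q ^ tri r * c ^ r) := by
    rw [div_zpow, mul_zpow, zpow_neg]
    ring
  rw [this, ← norm_mul, ← norm_mul]
  exact (norm_sub_le _ _).trans (by gcongr; exact norm_add_le _ _)

theorem qPoch_one_succ (q : ℂ) (N : ℕ) : qPoch 1 q (N + 1) = 0 := by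
  rw [qPoch_succ', sub_self, zero_mul]

/-- Taking norms in ρ q^r = 1 forces r = 0, and then ρ = 1. -/
theorem denom_ne_zero {q ρ : ℂ} (hq : ‖q‖ < 1) (hρ : ‖ρ‖ = 1) (h1 : ρ ≠ 1) (r : ℤ) :
    1 - ρ * q ^ r ≠ 0 := by
  intro h
  have h2 : ρ * q ^ r = 1 := (sub_eq_zero.1 h).symm
  have h3 := congrArg norm h2
  rw [norm_mul, hρ, one_mul, norm_zpow, norm_one] at h3
  have hr : r = 0 := by
    by_contra hr
    exact hq.ne ((zpow_eq_one_iff_right₀ (norm_nonneg _) hq.ne).1 h3 |> fun h => absurd h hr)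
  subst hr
  simp at h2
  exact h1 h2

/-- Bailey's lemma applied to the pair from `pair_of_jacobi`, with c = 1 for F and c = q for G.
Because z - z⁻¹ = (1 + z)(1 - z⁻¹) and (1 - z⁻¹)(q/z)_∞ = (z⁻¹)_∞, the prefactor on the left clears
the products in z from `rankFactor` and supplies the factor 1 + z of β_N. -/
theorem rank_series {q z ρ : ℂ} (hq0 : q ≠ 0) (hq : ‖q‖ < 1) (hz : ‖z‖ = 1) (hz1 : z ≠ 1)
    (hρ : ‖ρ‖ = 1) (hρ1 : ρ ≠ 1) {e : ℕ} {c : ℂ} (hc : c = q ^ (e - 1)) (he : e = 1 ∨ e = 2) :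
    (z - z⁻¹) * theta z q * (rankFactor ρ ρ⁻¹ z q * ∑' n : ℕ, rankTerm e ρ ρ⁻¹ z q (n + 1)) =
      ∑' r : ℤ, (-1) ^ r * q ^ tri r * (c * q) ^ r * (z ^ (-r) + z * z ^ r - 1 - z) /
        ((1 - ρ * q ^ r) * (1 - ρ⁻¹ * q ^ r)) := by
  have hz0 : z ≠ 0 := by rintro rfl; simp at hz
  have hρ0 : ρ ≠ 0 := by rintro rfl; simp at hρ
  have hc0 : c ≠ 0 := by rw [hc]; exact pow_ne_zero _ hq0
  have hρi : ‖ρ⁻¹‖ = 1 := by rw [norm_inv, hρ, inv_one]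
  have hzi : ‖z⁻¹‖ = 1 := by rw [norm_inv, hz, inv_one]
  have hρi1 : ρ⁻¹ ≠ 1 := by simpa using hρ1
  have hzi1 : z⁻¹ ≠ 1 := by simpa using hz1
  have hD : ∀ r : ℤ, (1 - ρ * q ^ r) * (1 - ρ⁻¹ * q ^ r) ≠ 0 := fun r =>
    mul_ne_zero (denom_ne_zero hq hρ hρ1 r) (denom_ne_zero hq hρi hρi1 r)
  -- For N ≥ 1 the third triple product contains (1)_N = 0, and the first two, after removal of
  -- (zq)_(N-1) (q/z)_(N-1), add up to c^N (1 + z)(1 - z)(1 - z⁻¹).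
  have hβ : ∀ N : ℕ, ∑' r : ℤ, (-1) ^ r * q ^ tri r * c ^ r * (z ^ (-r) + z * z ^ r - 1 - z) *
        (invFact q (N - r) * invFact q (N + r)) =
      if N = 0 then 0 else
        (1 + z) * (qPoch z q N * qPoch z⁻¹ q N * c ^ N / qPoch q q (2 * N)) := by
    intro N
    rw [pair_of_jacobi hq0 hq hz0 hc0]
    rcases N with _ | N
    · simp [qPoch_zero]
    · simp only [Nat.add_eq_zero_iff, one_ne_zero, and_false, if_false]
      rw [← mul_div_assoc]
      congr 1
      have a1 := qPoch_succ' z q N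
      have a2 := qPoch_succ' z⁻¹ q N
      have a3 : qPoch (q * z) q (N + 1) = qPoch (z * q) q N * (1 - z * q * q ^ N) := by
        rw [mul_comm q z, qPoch_succ]
      have a4 : qPoch (q / z) q (N + 1) = qPoch (z⁻¹ * q) q N * (1 - z⁻¹ * q * q ^ N) := by
        rw [div_eq_inv_mul, qPoch_succ]
      rcases he with rfl | rfl
      · simp only [tsub_self, pow_zero] at hc
        subst hc
        rw [qPoch_one_succ, one_mul, one_div, div_inv_eq_mul, a1, a2, a3, a4]
        field_simp
        ring
      · simp only [show 2 - 1 = 1 from rfl, pow_one] at hc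
        subst hc
        rw [div_self hq0, qPoch_one_succ, div_div_cancel₀ hq0, div_mul_cancel_left₀ hq0, a1, a2, a3,
          a4, pow_succ]
        field_simp
        ring
  have hsum := (hasSum_bailey hq0 hq hρ0 hD (summable_pair hq0 hq hz0 hc0) hβ)
  have n1 := qPochInf_ne_zero_of_norm_eq_one hq hz hz1
  have n2 := qPochInf_ne_zero_of_norm_eq_one hq hzi hzi1
  have n3 := qPochInf_ne_zero_of_norm_eq_one hq hρ hρ1
  have n4 := qPochInf_ne_zero_of_norm_eq_one hq hρi hρi1
  have n5 := qPochInf_ne_zero_of_norm_lt hq hq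
  have h1 := (hasSum_nat_add_iff' 1).2 hsum
  simp only [Finset.range_one, Finset.sum_singleton, if_true, mul_zero, sub_zero,
    Nat.add_eq_zero_iff, one_ne_zero, and_false, if_false] at h1
  have h2 : ∀ n : ℕ, qPoch ρ q (n + 1) * qPoch ρ⁻¹ q (n + 1) * q ^ (n + 1) *
      ((1 + z) * (qPoch z q (n + 1) * qPoch z⁻¹ q (n + 1) * c ^ (n + 1) /
        qPoch q q (2 * (n + 1)))) = (1 + z) * rankTerm e ρ ρ⁻¹ z q (n + 1) := by
    intro n
    have : q ^ e = c * q := by rcases he with rfl | rfl <;> simp [hc, pow_two]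
    rw [rankTerm, mul_inv_cancel₀ hρ0, div_one, this, mul_pow]
    ring
  rw [funext h2] at h1
  have h3 := h1.tsum_eq
  rw [tsum_mul_left] at h3
  have h4 : ∑' r : ℤ, (-1) ^ r * q ^ tri r * c ^ r * (z ^ (-r) + z * z ^ r - 1 - z) *
        (q ^ r / ((1 - ρ * q ^ r) * (1 - ρ⁻¹ * q ^ r))) =
      ∑' r : ℤ, (-1) ^ r * q ^ tri r * (c * q) ^ r * (z ^ (-r) + z * z ^ r - 1 - z) /
        ((1 - ρ * q ^ r) * (1 - ρ⁻¹ * q ^ r)) :=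
    tsum_congr fun r => by rw [mul_zpow]; ring
  rw [h4] at h3
  have h5 : qPochInf z⁻¹ q = (1 - z⁻¹) * qPochInf (q / z) q := by
    rw [qPochInf_eq_mul z⁻¹ hq, div_eq_inv_mul]
  rw [theta_eq hq0 hq hz0, jacProd, rankFactor, h5]
  rw [h5] at n2
  have n6 := right_ne_zero_of_mul n2
  have n7 : (1 - z⁻¹) ≠ 0 := left_ne_zero_of_mul n2
  have h6 : z - z⁻¹ = (1 + z) * (1 - z⁻¹) := by field_simp; ring
  rw [h6]
  generalize ∑' r : ℤ, (-1) ^ r * q ^ tri r * (c * q) ^ r * (z ^ (-r) + z * z ^ r - 1 - z) /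
        ((1 - ρ * q ^ r) * (1 - ρ⁻¹ * q ^ r)) = S at h3 ⊢
  generalize ∑' n : ℕ, rankTerm e ρ ρ⁻¹ z q (n + 1) = R at h3 ⊢
  generalize 1 - z⁻¹ = v at n7 ⊢
  generalize qPochInf ρ⁻¹ q = x at n4 h3 ⊢
  field_simp at h3 ⊢
  linear_combination h3

/-- The partial fraction expansion of the reciprocal of a theta function. -/
theorem sum_inv_theta {q ρ : ℂ} (hq0 : q ≠ 0) (hq : ‖q‖ < 1) (hρ : ρ ≠ 0)
    (h1 : ∀ r : ℤ, 1 - ρ * q ^ r ≠ 0) (h2 : ∀ r : ℤ, 1 - ρ⁻¹ * q ^ r ≠ 0) :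
    qPochInf q q * qPochInf q q = qPochInf ρ q * qPochInf ρ⁻¹ q *
      ∑' r : ℤ, (-1) ^ r * q ^ tri r * q ^ r / ((1 - ρ * q ^ r) * (1 - ρ⁻¹ * q ^ r)) := by
  have ha := summable_norm_theta_coef hq0 hq one_ne_zero
  have h3 := hasSum_bailey hq0 hq hρ (fun r => mul_ne_zero (h1 r) (h2 r)) ha
    (fun N => finite_triple_product hq0 hq one_ne_zero N)
  -- For the pair with w = 1 all β_N with N ≥ 1 contain (1)_N = 0, so the left side of Bailey's
  -- lemma collapses to its term N = 0.
  have h4 := hasSum_single (f := fun N : ℕ => qPoch ρ q N * qPoch ρ⁻¹ q N * q ^ N *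
    (qPoch 1 q N * qPoch (q / 1) q N / qPoch q q (2 * N))) 0 (fun N hN => by
      obtain ⟨m, rfl⟩ := Nat.exists_eq_succ_of_ne_zero hN
      rw [Nat.succ_eq_add_one, qPoch_one_succ]
      simp)
  have h5 := h4.unique h3
  simp only [qPoch_zero, pow_zero, mul_one, div_one, mul_zero, one_zpow] at h5
  have n5 := qPochInf_ne_zero_of_norm_lt hq hq
  have h6 : ∑' r : ℤ, (-1) ^ r * q ^ tri r * (q ^ r / ((1 - ρ * q ^ r) * (1 - ρ⁻¹ * q ^ r))) =
      ∑' r : ℤ, (-1) ^ r * q ^ tri r * q ^ r / ((1 - ρ * q ^ r) * (1 - ρ⁻¹ * q ^ r)) :=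
    tsum_congr fun r => by ring
  rw [h6] at h5
  generalize ∑' r : ℤ, (-1) ^ r * q ^ tri r * q ^ r / ((1 - ρ * q ^ r) * (1 - ρ⁻¹ * q ^ r)) = S
    at h5 ⊢
  generalize qPochInf ρ⁻¹ q = x at h5 ⊢
  field_simp at h5
  linear_combination h5

/-! ### The Appell-Lerch series of level one -/

/-- The series `∑ (-1)^n q^{n(n-1)/2} z^n / (1 - a q^n)`. -/
def appell (z a q : ℂ) : ℂ := ∑' n : ℤ, (-1) ^ n * q ^ tri n * z ^ n / (1 - a * q ^ n)

/-- The reciprocals tend to 1 as n → ∞ and to 0 as n → -∞. A vanishing denominator is harmless,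
since its inverse is 0 by convention; this matters for the residue s = 0, where a = 1. -/
theorem exists_bound_inv_one_sub {q a : ℂ} (hq0 : q ≠ 0) (hq : ‖q‖ < 1) (ha : a ≠ 0) :
    ∃ C : ℝ, ∀ n : ℤ, ‖(1 - a * q ^ n)⁻¹‖ ≤ C := by
  have h0 : Tendsto (fun n : ℕ => q ^ n) atTop (𝓝 0) :=
      tendsto_pow_atTop_nhds_zero_of_norm_lt_one hq
  have h1 : Tendsto (fun n : ℕ => (1 - a * q ^ n)⁻¹) atTop (𝓝 (1 - a * 0)⁻¹) :=
    ((h0.const_mul a).const_sub 1).inv₀ (by simp)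
  have h2 : Tendsto (fun n : ℕ => q ^ n * (q ^ n - a)⁻¹) atTop (𝓝 (0 * (0 - a)⁻¹)) :=
    h0.mul ((h0.sub_const a).inv₀ (by simpa using ha))
  obtain ⟨C1, h10, hC1⟩ := exists_bound_of_tendsto h1
  obtain ⟨C2, h20, hC2⟩ := exists_bound_of_tendsto h2
  refine ⟨max C1 C2, fun n => ?_⟩
  obtain ⟨m, rfl | rfl⟩ := n.eq_nat_or_neg
  · exact (by simpa using hC1 m : _ ≤ C1).trans (le_max_left _ _)
  · refine le_trans (le_of_eq ?_) ((hC2 m).trans (le_max_right _ _))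
    congr 1
    have h3 := pow_ne_zero m hq0
    have : (1 - a * q ^ (-(m : ℤ))) = (q ^ m - a) / q ^ m := by
      rw [zpow_neg, zpow_natCast]
      field_simp
    rw [this, inv_div, div_eq_mul_inv]

theorem summable_norm_appell {q z a : ℂ} (hq0 : q ≠ 0) (hq : ‖q‖ < 1) (hz : z ≠ 0) (ha : a ≠ 0) :
    Summable fun n : ℤ => ‖(-1) ^ n * q ^ tri n * z ^ n / (1 - a * q ^ n)‖ := by
  obtain ⟨C, hC⟩ := exists_bound_inv_one_sub hq0 hq ha
  refine (summable_theta_mul hq0 hq hz hC).congr fun n => ?_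
  rw [div_eq_mul_inv]
  simp

theorem summable_appell {q z a : ℂ} (hq0 : q ≠ 0) (hq : ‖q‖ < 1) (hz : z ≠ 0) (ha : a ≠ 0) :
    Summable fun n : ℤ => (-1) ^ n * q ^ tri n * z ^ n / (1 - a * q ^ n) :=
  (summable_norm_appell hq0 hq hz ha).of_norm

theorem neg_one_zpow_neg (n : ℤ) : (-1 : ℂ) ^ (-n) = (-1) ^ n := by
  rw [zpow_neg, ← inv_zpow, show (-1 : ℂ)⁻¹ = -1 by norm_num]

theorem appell_sub {q z a : ℂ} (hq0 : q ≠ 0) (hq : ‖q‖ < 1) (hz : z ≠ 0) (ha0 : a ≠ 0)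
    (ha : ∀ n : ℤ, 1 - a * q ^ n ≠ 0) :
    appell z a q - a * appell (q * z) a q = theta z q := by
  rw [appell, appell, theta, ← tsum_mul_left, ← Summable.tsum_sub (summable_appell hq0 hq hz ha0)
    ((summable_appell hq0 hq (mul_ne_zero hq0 hz) ha0).mul_left a)]
  refine tsum_congr fun n => ?_
  have := ha n
  rw [mul_zpow]
  field_simp

theorem appell_shift {q z a : ℂ} (hq0 : q ≠ 0) (hz : z ≠ 0) :
    appell (q * z) (q * a) q = -z⁻¹ * appell z a q := by
  rw [appell, appell, ← tsum_mul_left, ← (Equiv.addRight (1 : ℤ)).tsum_eq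
    (fun n : ℤ => -z⁻¹ * ((-1) ^ n * q ^ tri n * z ^ n / (1 - a * q ^ n)))]
  refine tsum_congr fun n => ?_
  simp only [Equiv.coe_addRight]
  rw [tri_succ, zpow_add₀ hq0, zpow_add_one₀ hz, zpow_add_one₀ (by norm_num), mul_zpow,
    zpow_add_one₀ hq0, mul_comm q a, mul_comm (q ^ n) q, mul_assoc a]
  field_simp

theorem appell_inv {q z a : ℂ} (hq0 : q ≠ 0) (hz : z ≠ 0) (ha0 : a ≠ 0) :
    appell z a q = -a⁻¹ * appell (q * q / z) a⁻¹ q := by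
  rw [appell, appell, ← tsum_mul_left, ← (Equiv.neg ℤ).tsum_eq]
  refine tsum_congr fun n => ?_
  have h1 : tri (-n) = tri n + n := tri_eq_of (by linarith [two_mul_tri n])
  have hY := zpow_ne_zero n hq0
  have hZ := zpow_ne_zero n hz
  simp only [Equiv.neg_apply]
  rw [h1, zpow_add₀ hq0, neg_one_zpow_neg, zpow_neg, zpow_neg, div_zpow, mul_zpow]
  have h2 : 1 - a * (q ^ n)⁻¹ = -(a * (q ^ n)⁻¹ * (1 - a⁻¹ * q ^ n)) := by
    field_simp
    ring
  rw [h2]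
  generalize 1 - a⁻¹ * q ^ n = D
  generalize q ^ n = Y at hY
  -- At a pole both terms are 0 by the convention for division, so the inversion holds termwise
  -- without a nonvanishing condition.
  rcases eq_or_ne D 0 with rfl | hD
  · simp
  field_simp

/-- Partial fractions, possible as a² ≠ 1, split the series in `sum_inv_theta` into Appell–Lerch
series at a and a⁻¹. Inversion identifies these two up to a factor, and `appell_sub` with θ(1) = 0
replaces the argument q by 1. The result fixes the constant in `appell_change`. -/
theorem theta_mul_appell_one {q a : ℂ} (hq0 : q ≠ 0) (hq : ‖q‖ < 1) (ha0 : a ≠ 0) (ha1 : a ^ 2 ≠ 1)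
    (ha : ∀ n : ℤ, 1 - a * q ^ n ≠ 0) (ha' : ∀ n : ℤ, 1 - a⁻¹ * q ^ n ≠ 0) :
    theta a q * appell 1 a q = a * qPochInf q q ^ 3 := by
  have h1 := appell_sub hq0 hq one_ne_zero ha0 ha
  rw [theta_one hq0, mul_one] at h1
  have h2 := sum_inv_theta hq0 hq ha0 ha ha'
  have h3 := appell_inv hq0 hq0 ha0
  rw [mul_div_assoc, div_self hq0, mul_one] at h3
  have h4 : ∑' r : ℤ, (-1) ^ r * q ^ tri r * q ^ r / ((1 - a * q ^ r) * (1 - a⁻¹ * q ^ r)) =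
      a ^ 2 / (a ^ 2 - 1) * appell q a q - 1 / (a ^ 2 - 1) * appell q a⁻¹ q := by
    rw [appell, appell, ← tsum_mul_left, ← tsum_mul_left, ← Summable.tsum_sub
      ((summable_appell hq0 hq hq0 ha0).mul_left _)
      ((summable_appell hq0 hq hq0 (inv_ne_zero ha0)).mul_left _)]
    refine tsum_congr fun n => ?_
    have n1 := ha n
    have n2 := ha' n
    have n3 := sub_ne_zero.2 ha1
    have n4 : a - q ^ n ≠ 0 := by
      intro h; apply n2; rw [← sub_eq_zero.1 h, inv_mul_cancel₀ ha0, sub_self]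
    generalize q ^ n = Y at n1 n2 n4 ⊢
    have n5 : 1 - Y * a ≠ 0 := by rwa [mul_comm]
    field_simp
    ring
  have h5 : appell q a⁻¹ q = -a * appell q a q := by
    rw [h3]
    field_simp
  rw [h4, h5] at h2
  have h6 : qPochInf a⁻¹ q = (1 - a⁻¹) * qPochInf (q / a) q := by
    rw [qPochInf_eq_mul a⁻¹ hq, div_eq_inv_mul]
  have n3 := sub_ne_zero.2 ha1
  have h7 : a ^ 2 / (a ^ 2 - 1) * appell q a q - 1 / (a ^ 2 - 1) * (-a * appell q a q) =
      a / (a - 1) * appell q a q := by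
    have n5 : a - 1 ≠ 0 := fun h => n3 (by linear_combination (a + 1) * h)
    field_simp
    ring
  have n5 : a - 1 ≠ 0 := fun h => n3 (by linear_combination (a + 1) * h)
  rw [h7, h6] at h2
  rw [theta_eq hq0 hq ha0, jacProd, sub_eq_zero.1 h1]
  have h8 : (1 - a⁻¹) * (a / (a - 1)) = 1 := by field_simp
  linear_combination (-a * qPochInf q q) * h2 - a * qPochInf q q * qPochInf a q * qPochInf (q /
      a) q *
    appell q a q * h8

/-- The equivalence `(N, m) ↦ (m, N - m)` of `ℤ × ℤ`. -/
def convEquiv : ℤ × ℤ ≃ ℤ × ℤ where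
  toFun p := (p.2, p.1 - p.2)
  invFun p := (p.1 + p.2, p.1)
  left_inv p := by ext <;> simp
  right_inv p := by ext <;> simp

theorem summable_conv {f g : ℤ → ℂ} (hf : Summable fun n => ‖f n‖) (hg : Summable fun n => ‖g n‖) :
    Summable fun p : ℤ × ℤ => f p.2 * g (p.1 - p.2) :=
  convEquiv.summable_iff.2 (summable_mul_of_summable_norm hf hg)

theorem tsum_mul_tsum_conv {f g : ℤ → ℂ} (hf : Summable fun n => ‖f n‖)
    (hg : Summable fun n => ‖g n‖) :
    (∑' n, f n) * ∑' n, g n = ∑' N : ℤ, ∑' m : ℤ, f m * g (N - m) := by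
  rw [tsum_mul_tsum_of_summable_norm hf hg, ← convEquiv.tsum_eq]
  exact (summable_conv hf hg).tsum_prod

theorem eq_zpow_of_recurrence {q b : ℂ} (hq0 : q ≠ 0) (hb : b ≠ 0) {f : ℤ → ℂ}
    (h : ∀ N, f (N + 1) = -(q ^ N * b * f N)) (N : ℤ) :
    f N = (-1) ^ N * q ^ tri N * b ^ N * f 0 := by
  induction N using Int.induction_on with
  | zero => simp [tri]
  | succ n ih =>
    rw [h, ih, tri_succ, zpow_add₀ hq0, zpow_add_one₀ hb, zpow_add_one₀ (by norm_num)]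
    ring
  | pred n ih =>
    have h1 := h (-(n : ℤ) - 1)
    rw [sub_add_cancel, ih] at h1
    have h2 : tri (-(n : ℤ)) = tri (-(n : ℤ) - 1) + (-(n : ℤ) - 1) := by
      rw [← tri_succ, sub_add_cancel]
    have h3 : (-1 : ℂ) ^ (-(n : ℤ)) = -(-1) ^ (-(n : ℤ) - 1) := by
      rw [zpow_sub_one₀ (by norm_num)]; ring
    have h4 : b ^ (-(n : ℤ)) = b ^ (-(n : ℤ) - 1) * b := by
      rw [← zpow_add_one₀ hb, sub_add_cancel]
    rw [h2, h3, h4, zpow_add₀ hq0] at h1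
    have n1 := zpow_ne_zero (-(n : ℤ) - 1) hq0
    generalize q ^ (-(n : ℤ) - 1) = X at h1 n1
    refine mul_left_cancel₀ (mul_ne_zero n1 hb) ?_
    linear_combination h1

/-- The coefficient of `c^N` in the Laurent expansion of
`theta (c a₀) * appell (c a₁) a₁ - theta (c a₁) * appell (c a₀) a₀`. -/
def appellCoef (q a₀ a₁ : ℂ) (N : ℤ) : ℂ :=
  ∑' m : ℤ, ((-1) ^ m * q ^ tri m * a₀ ^ m) *
    ((-1) ^ (N - m) * q ^ tri (N - m) * a₁ ^ (N - m) / (1 - a₁ * q ^ (N - m))) -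
  ∑' m : ℤ, ((-1) ^ m * q ^ tri m * a₀ ^ m / (1 - a₀ * q ^ m)) *
    ((-1) ^ (N - m) * q ^ tri (N - m) * a₁ ^ (N - m))

/-- Let φ be a theta coefficient and ψ the same with its denominator; then a q^m ψ = ψ - φ. Under N
↦ N + 1 each of the two convolutions satisfies the stated recurrence up to the convolution of φ with
φ, and this defect cancels in the difference. -/
theorem appellCoef_succ {q a₀ a₁ : ℂ} (hq0 : q ≠ 0) (hq : ‖q‖ < 1) (h00 : a₀ ≠ 0) (h10 : a₁ ≠ 0)
    (h0 : ∀ n : ℤ, 1 - a₀ * q ^ n ≠ 0) (h1 : ∀ n : ℤ, 1 - a₁ * q ^ n ≠ 0) (N : ℤ) :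
    appellCoef q a₀ a₁ (N + 1) = -(q ^ N * (a₀ * a₁) * appellCoef q a₀ a₁ N) := by
  set φ : ℂ → ℤ → ℂ := fun a m => (-1) ^ m * q ^ tri m * a ^ m with hφ
  set ψ : ℂ → ℤ → ℂ := fun a m => (-1) ^ m * q ^ tri m * a ^ m / (1 - a * q ^ m) with hψ
  have hc : ∀ N, appellCoef q a₀ a₁ N =
    ∑' m, φ a₀ m * ψ a₁ (N - m) - ∑' m, ψ a₀ m * φ a₁ (N - m) := fun N => rfl
  have s1 : ∀ a, a ≠ 0 → Summable fun n => ‖φ a n‖ := fun a ha => summable_norm_theta_coef hq0 hq ha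
  have s2 : ∀ a, a ≠ 0 → Summable fun n => ‖ψ a n‖ := fun a ha => summable_norm_appell hq0 hq ha ha
  have r1 : ∀ a, a ≠ 0 → ∀ m, φ a (m + 1) = -(a * q ^ m * φ a m) := fun a ha m => by
    simp only [hφ]
    rw [tri_succ, zpow_add₀ hq0, zpow_add_one₀ ha, zpow_add_one₀ (by norm_num)]
    ring
  have r2 : ∀ a, (∀ n : ℤ, 1 - a * q ^ n ≠ 0) → ∀ m, a * q ^ m * ψ a m = ψ a m - φ a m :=
    fun a ha m => by
    have := ha m
    simp only [hφ, hψ]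
    field_simp
    ring
  have S1 := fun N => (summable_conv (s1 _ h00) (s2 _ h10)).prod_factor N
  have S2 := fun N => (summable_conv (s2 _ h00) (s1 _ h10)).prod_factor N
  have S3 := fun N => (summable_conv (s1 _ h00) (s1 _ h10)).prod_factor N
  have sh : ∀ f : ℤ → ℂ, ∑' m, f (m + 1) = ∑' m, f m := fun f =>
    (Equiv.addRight (1 : ℤ)).tsum_eq f
  have k1 : q ^ N * (a₀ * a₁) * ∑' m, φ a₀ m * ψ a₁ (N - m) =
      -∑' m, φ a₀ m * ψ a₁ (N + 1 - m) + ∑' m, φ a₀ m * φ a₁ (N + 1 - m) := by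
    rw [← sh (fun m => φ a₀ m * ψ a₁ (N + 1 - m)), ← sh (fun m => φ a₀ m * φ a₁ (N + 1 - m))]
    simp only [add_sub_add_right_eq_sub]
    have S1' := ((Equiv.addRight (1 : ℤ)).summable_iff.2 (S1 (N + 1)))
    have S3' := ((Equiv.addRight (1 : ℤ)).summable_iff.2 (S3 (N + 1)))
    simp only [Function.comp_def, Equiv.coe_addRight, add_sub_add_right_eq_sub] at S1' S3'
    rw [← tsum_neg, ← Summable.tsum_add S1'.neg S3', ← tsum_mul_left]
    refine tsum_congr fun m => ?_
    have e1 := r2 a₁ h1 (N - m)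
    have e2 : q ^ N = q ^ m * q ^ (N - m) := by rw [← zpow_add₀ hq0, add_sub_cancel]
    rw [r1 a₀ h00, e2]
    linear_combination (a₀ * q ^ m * φ a₀ m) * e1
  have k2 : q ^ N * (a₀ * a₁) * ∑' m, ψ a₀ m * φ a₁ (N - m) =
      -∑' m, ψ a₀ m * φ a₁ (N + 1 - m) + ∑' m, φ a₀ m * φ a₁ (N + 1 - m) := by
    rw [← tsum_neg, ← Summable.tsum_add (S2 (N + 1)).neg (S3 (N + 1)), ← tsum_mul_left]
    refine tsum_congr fun m => ?_
    have e1 := r2 a₀ h0 m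
    have e2 : q ^ N = q ^ m * q ^ (N - m) := by rw [← zpow_add₀ hq0, add_sub_cancel]
    have e3 := r1 a₁ h10 (N - m)
    rw [sub_add_eq_add_sub] at e3
    rw [e3, e2]
    linear_combination (a₁ * q ^ (N - m) * φ a₁ (N - m)) * e1
  rw [hc, hc, mul_sub, k1, k2]
  ring

/-- As a Laurent series in c the left side has coefficients obeying the recurrence of θ(c a₀ a₁),
hence is a multiple of it by a factor free of c. The poles in the denominators do not involve c, so
no analytic argument is needed. -/
theorem theta_mul_appell_sub {q a₀ a₁ c : ℂ} (hq0 : q ≠ 0) (hq : ‖q‖ < 1) (h00 : a₀ ≠ 0)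
    (h10 : a₁ ≠ 0) (hc : c ≠ 0) (h0 : ∀ n : ℤ, 1 - a₀ * q ^ n ≠ 0)
    (h1 : ∀ n : ℤ, 1 - a₁ * q ^ n ≠ 0) :
    theta (c * a₀) q * appell (c * a₁) a₁ q - theta (c * a₁) q * appell (c * a₀) a₀ q =
      appellCoef q a₀ a₁ 0 * theta (c * (a₀ * a₁)) q := by
  have s1 : ∀ a, a ≠ 0 → Summable fun n : ℤ => ‖(-1) ^ n * q ^ tri n * a ^ n‖ :=
    fun a ha => summable_norm_theta_coef hq0 hq ha
  have s2 : ∀ a, a ≠ 0 → Summable fun n : ℤ => ‖(-1) ^ n * q ^ tri n * (c * a) ^ n /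
      (1 - a * q ^ n)‖ := fun a ha => summable_norm_appell hq0 hq (mul_ne_zero hc ha) ha
  have S1 := summable_conv (s1 _ (mul_ne_zero hc h00)) (s2 _ h10)
  have S2 := summable_conv (s2 _ h00) (s1 _ (mul_ne_zero hc h10))
  rw [mul_comm (theta (c * a₁) q), theta, theta, theta, appell, appell,
    tsum_mul_tsum_conv (s1 _ (mul_ne_zero hc h00)) (s2 _ h10),
    tsum_mul_tsum_conv (s2 _ h00) (s1 _ (mul_ne_zero hc h10)),
    ← Summable.tsum_sub S1.prod S2.prod, ← tsum_mul_left]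
  refine tsum_congr fun N => ?_
  have h2 := eq_zpow_of_recurrence hq0 (mul_ne_zero h00 h10)
    (appellCoef_succ hq0 hq h00 h10 h0 h1) N
  have h3 : appellCoef q a₀ a₁ 0 * ((-1) ^ N * q ^ tri N * (c * (a₀ * a₁)) ^ N) =
      c ^ N * appellCoef q a₀ a₁ N := by
    rw [h2, mul_zpow c]
    ring
  rw [h3, appellCoef, mul_sub, ← tsum_mul_left, ← tsum_mul_left]
  congr 1 <;>
  · refine tsum_congr fun m => ?_
    have : c ^ N = c ^ m * c ^ (N - m) := by rw [← zpow_add₀ hc, add_sub_cancel]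
    rw [this, mul_zpow, mul_zpow]
    ring

/-- The change of parameter formula for the Appell-Lerch series. -/
theorem appell_change {q a₀ a₁ c : ℂ} (hq0 : q ≠ 0) (hq : ‖q‖ < 1) (h00 : a₀ ≠ 0)
    (h10 : a₁ ≠ 0) (hc : c ≠ 0) (h0 : ∀ n : ℤ, 1 - a₀ * q ^ n ≠ 0)
    (h0' : ∀ n : ℤ, 1 - a₀⁻¹ * q ^ n ≠ 0) (h02 : a₀ ^ 2 ≠ 1) (h1 : ∀ n : ℤ, 1 - a₁ * q ^ n ≠ 0) :
    theta a₀ q * theta a₁ q *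
      (theta (c * a₀) q * appell (c * a₁) a₁ q - theta (c * a₁) q * appell (c * a₀) a₀ q) =
      -(a₀ * qPochInf q q ^ 3 * theta (a₁ / a₀) q * theta (c * (a₀ * a₁)) q) := by
  -- The choice c = a₀⁻¹ makes θ(c a₀) = θ(1) = 0, leaving a series with argument 1, which
  -- `theta_mul_appell_one` evaluates.
  have e1 := theta_mul_appell_sub hq0 hq h00 h10 (inv_ne_zero h00) h0 h1
  rw [inv_mul_cancel₀ h00, theta_one hq0, zero_mul, inv_mul_cancel_left₀ h00, zero_sub,
    ← div_eq_inv_mul] at e1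
  have e2 := theta_mul_appell_one hq0 hq h00 h02 h0 h0'
  rw [theta_mul_appell_sub hq0 hq h00 h10 hc h0 h1]
  linear_combination (-theta a₀ q * theta (c * (a₀ * a₁)) q) * e1 -
    theta (a₁ / a₀) q * theta (c * (a₀ * a₁)) q * e2

/-- The three-term relation for theta functions. -/
theorem theta_three_term {q a₀ a₁ a₂ c : ℂ} (hq0 : q ≠ 0) (hq : ‖q‖ < 1) (h00 : a₀ ≠ 0)
    (h10 : a₁ ≠ 0) (h20 : a₂ ≠ 0) (hc : c ≠ 0) (h0 : ∀ n : ℤ, 1 - a₀ * q ^ n ≠ 0)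
    (h0' : ∀ n : ℤ, 1 - a₀⁻¹ * q ^ n ≠ 0) (h02 : a₀ ^ 2 ≠ 1) (h1 : ∀ n : ℤ, 1 - a₁ * q ^ n ≠ 0)
    (h1' : ∀ n : ℤ, 1 - a₁⁻¹ * q ^ n ≠ 0) (h12 : a₁ ^ 2 ≠ 1) (h2 : ∀ n : ℤ, 1 - a₂ * q ^ n ≠ 0)
    (h2' : ∀ n : ℤ, 1 - a₂⁻¹ * q ^ n ≠ 0) (h22 : a₂ ^ 2 ≠ 1) :
    a₀ * theta (a₁ / a₀) q * theta (c * (a₀ * a₁)) q * theta (c * a₂) q * theta a₂ q +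
      a₁ * theta (a₂ / a₁) q * theta (c * (a₁ * a₂)) q * theta (c * a₀) q * theta a₀ q +
      a₂ * theta (a₀ / a₂) q * theta (c * (a₂ * a₀)) q * theta (c * a₁) q * theta a₁ q = 0 := by
  have e1 := appell_change hq0 hq h00 h10 hc h0 h0' h02 h1
  have e2 := appell_change hq0 hq h10 h20 hc h1 h1' h12 h2
  have e3 := appell_change hq0 hq h20 h00 hc h2 h2' h22 h0
  have hJ := pow_ne_zero 3 (qPochInf_ne_zero_of_norm_lt hq hq)
  refine mul_left_cancel₀ hJ ?_
  -- With these weights the Appell–Lerch series cancel cyclically, and the common factor (q; q)_∞³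
  -- of the right sides has been split off.
  linear_combination (theta (c * a₂) q * theta a₂ q) * e1 + theta (c * a₀) q * theta a₀ q * e2 +
    theta (c * a₁) q * theta a₁ q * e3

/-! ### Dissection modulo an odd number -/

theorem tsum_eq_sum_residues {f : ℤ → ℂ} (hf : Summable f) (ℓ : ℕ) [NeZero ℓ] :
    ∑' n, f n = ∑ s ∈ range ℓ, ∑' m : ℤ, f (m * ℓ + s) := by
  have hs := (Int.divModEquiv ℓ).symm.summable_iff.2 hf
  rw [← (Int.divModEquiv ℓ).symm.tsum_eq]
  have hs' : Summable (Function.uncurry fun (m : ℤ) (s : Fin ℓ) => f (m * ℓ + (s : ℕ))) := hs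
  have h1 := hs'.tsum_prod
  have h2 := Summable.tsum_comm hs'
  simp only [Function.uncurry_apply_pair] at h1
  rw [← h2] at h1
  rw [Finset.sum_range, ← tsum_fintype (L := .unconditional _)]
  exact h1

theorem tri_natCast (s : ℕ) : tri s = (s.choose 2 : ℕ) := by
  refine tri_eq_of ?_
  have := Nat.choose_two_right s
  have h2 : 2 * s.choose 2 = s * (s - 1) := by
    rw [this, Nat.mul_div_cancel' (Nat.even_mul_pred_self s).two_dvd]
  rcases s with _ | s
  · simp
  · have h3 : ((2 * (s + 1).choose 2 : ℕ) : ℤ) = ((s + 1) * (s + 1 - 1) : ℕ) := by rw [h2]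
    push_cast at h3 ⊢
    linarith

/-- Oddness of ℓ makes (ℓ - 1)/2 = h an integer, so the cross term stays a multiple of ℓ and each
residue class is again a theta series, in base q^(ℓ²). -/
theorem tri_residue {ℓ h : ℕ} (hℓ : ℓ = 2 * h + 1) (m : ℤ) (s : ℕ) :
    tri (m * ℓ + s) = ℓ ^ 2 * tri m + ℓ * (h + s) * m + (s.choose 2 : ℕ) := by
  rw [tri_add, tri_natCast]
  have : tri (m * ℓ) = ℓ ^ 2 * tri m + ℓ * h * m := by
    apply tri_eq_of
    have := two_mul_tri m
    subst hℓ
    push_cast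
    linear_combination (-(2 * (h : ℤ) + 1) ^ 2) * this
  rw [this]
  ring

theorem neg_one_zpow_residue {ℓ h : ℕ} (hℓ : ℓ = 2 * h + 1) (m : ℤ) (s : ℕ) :
    (-1 : ℂ) ^ (m * ℓ + s) = (-1) ^ m * (-1) ^ s := by
  subst hℓ
  have : (-1 : ℂ) ^ (m * 2) = 1 := by rw [mul_comm, zpow_mul]; norm_num
  rw [zpow_add₀ (by norm_num), zpow_natCast]
  congr 1
  push_cast
  rw [mul_add, mul_one, ← mul_assoc, zpow_add₀ (by norm_num), zpow_mul, this, one_zpow, one_mul]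

theorem theta_term_residue {q : ℂ} (hq0 : q ≠ 0) {ℓ h : ℕ} (hℓ : ℓ = 2 * h + 1) (e : ℕ) (m : ℤ)
    (s : ℕ) : (-1 : ℂ) ^ (m * ℓ + s) * q ^ tri (m * ℓ + s) * (q ^ e) ^ (m * ℓ + s : ℤ) =
      (-1) ^ s * q ^ (s.choose 2 + e * s) *
        ((-1) ^ m * (q ^ ℓ ^ 2) ^ tri m * (q ^ (ℓ * (h + e + s))) ^ m) := by
  rw [neg_one_zpow_residue hℓ, tri_residue hℓ]
  have : q ^ ((ℓ : ℤ) ^ 2 * tri m + ℓ * (h + s) * m + (s.choose 2 : ℕ)) *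
      (q ^ e) ^ (m * ℓ + s : ℤ) =
      q ^ (s.choose 2 + e * s) * ((q ^ ℓ ^ 2) ^ tri m * (q ^ (ℓ * (h + e + s))) ^ m) := by
    simp only [← zpow_natCast, ← zpow_mul, ← zpow_add₀ hq0]
    congr 1
    push_cast
    ring
  linear_combination ((-1) ^ m * (-1) ^ s) * this

theorem theta_dissection {q ζ : ℂ} (hq0 : q ≠ 0) (hq : ‖q‖ < 1) {ℓ h : ℕ} (hℓ : ℓ = 2 * h + 1)
    (hζ : ζ ^ ℓ = 1) : theta ζ q =
      ∑ s ∈ range ℓ, (-1) ^ s * ζ ^ s * q ^ s.choose 2 *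
        theta (q ^ (ℓ * (h + s))) (q ^ ℓ ^ 2) := by
  have hζ0 : ζ ≠ 0 := by rintro rfl; simp [hℓ] at hζ
  have : NeZero ℓ := ⟨by omega⟩
  rw [theta, tsum_eq_sum_residues (summable_theta hq0 hq hζ0) ℓ]
  refine Finset.sum_congr rfl fun s _ => ?_
  rw [theta, ← tsum_mul_left]
  refine tsum_congr fun m => ?_
  have h1 := theta_term_residue hq0 hℓ 0 m s
  simp only [pow_zero, one_zpow, mul_one, zero_mul, add_zero] at h1
  rw [h1, zpow_add₀ hζ0, mul_comm m, zpow_mul, zpow_natCast, hζ, one_zpow, one_mul, zpow_natCast]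
  ring

/-- Multiplying numerator and denominator by the cofactor ∑ c_k x^k at x = q^r turns the denominator
into 1 - q^(ℓr). On r = mℓ + s the factor in ζ is constant, and the sum over m is an Appell–Lerch
series. -/
theorem lambert_dissection {q ζ ρ : ℂ} (hq0 : q ≠ 0) (hq : ‖q‖ < 1) {ℓ h : ℕ}
    (hℓ : ℓ = 2 * h + 1) (hζ : ζ ^ ℓ = 1) (hρ0 : ρ ≠ 0) (e K : ℕ) {c : ℕ → ℂ}
    (hD : ∀ r : ℤ, (1 - ρ * q ^ r) * (1 - ρ⁻¹ * q ^ r) ≠ 0)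
    (hc : ∀ x : ℂ, (1 - ρ * x) * (1 - ρ⁻¹ * x) * ∑ k ∈ range K, c k * x ^ k = 1 - x ^ ℓ) :
    ∑' r : ℤ, (-1) ^ r * q ^ tri r * (q ^ e) ^ r * (ζ ^ (-r) + ζ * ζ ^ r - 1 - ζ) /
        ((1 - ρ * q ^ r) * (1 - ρ⁻¹ * q ^ r)) =
      ∑ s ∈ range ℓ, ∑ k ∈ range K, (-1) ^ s * (ζ ^ (-(s : ℤ)) + ζ * ζ ^ s - 1 - ζ) * c k *
        q ^ (s.choose 2 + (e + k) * s) *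
          appell (q ^ (ℓ * (h + (e + k) + s))) (q ^ (ℓ * s)) (q ^ ℓ ^ 2) := by
  have hζ0 : ζ ≠ 0 := by rintro rfl; simp [hℓ] at hζ
  have : NeZero ℓ := ⟨by omega⟩
  have hQ0 : q ^ ℓ ^ 2 ≠ 0 := pow_ne_zero _ hq0
  have hQ : ‖q ^ ℓ ^ 2‖ < 1 := by
    rw [norm_pow]; exact pow_lt_one₀ (norm_nonneg _) hq (by simp [hℓ])
  have h1 : ∀ r : ℤ, (-1) ^ r * q ^ tri r * (q ^ e) ^ r * (ζ ^ (-r) + ζ * ζ ^ r - 1 - ζ) /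
        ((1 - ρ * q ^ r) * (1 - ρ⁻¹ * q ^ r)) =
      ∑ k ∈ range K, c k * (ζ ^ (-r) + ζ * ζ ^ r - 1 - ζ) *
        ((-1) ^ r * q ^ tri r * (q ^ (e + k)) ^ r / (1 - (q ^ r) ^ ℓ)) := by
    intro r
    -- At r = 0 the new denominator 1 - q^(ℓr) vanishes, but so does the numerator ζ^(-r) + ζ ζ^r -
    -- 1 - ζ; both sides are 0.
    rcases eq_or_ne r 0 with rfl | hr
    · simp
    · have h2 : 1 - (q ^ r) ^ ℓ ≠ 0 := by
        intro h3
        have h4 := congrArg norm (sub_eq_zero.1 h3)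
        rw [← zpow_natCast, ← zpow_mul, norm_one, norm_zpow] at h4
        rcases (zpow_eq_one_iff_right₀ (norm_nonneg _) hq.ne).1 h4.symm |> mul_eq_zero.1 with h | h
        · exact hr h
        · omega
      have h3 := hc (q ^ r)
      have h4 : ∀ k, (q ^ (e + k)) ^ r = (q ^ e) ^ r * (q ^ r) ^ k := fun k => by
        simp only [← zpow_natCast, ← zpow_mul, ← zpow_add₀ hq0]
        congr 1
        push_cast
        ring
      simp only [h4]
      rw [div_eq_iff (hD r), Finset.sum_mul]
      have h5 : ∀ k ∈ range K, c k * (ζ ^ (-r) + ζ * ζ ^ r - 1 - ζ) *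
          ((-1) ^ r * q ^ tri r * ((q ^ e) ^ r * (q ^ r) ^ k) / (1 - (q ^ r) ^ ℓ)) *
          ((1 - ρ * q ^ r) * (1 - ρ⁻¹ * q ^ r)) = (ζ ^ (-r) + ζ * ζ ^ r - 1 - ζ) *
          ((-1) ^ r * q ^ tri r * (q ^ e) ^ r / (1 - (q ^ r) ^ ℓ)) *
          ((1 - ρ * q ^ r) * (1 - ρ⁻¹ * q ^ r)) * (c k * (q ^ r) ^ k) := fun k _ => by ring
      have h6 : ∀ a b d : ℂ, a * b * d * ∑ k ∈ range K, c k * (q ^ r) ^ k =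
          a * b * (d * ∑ k ∈ range K, c k * (q ^ r) ^ k) := fun a b d => by ring
      rw [Finset.sum_congr rfl h5, ← Finset.mul_sum, h6, h3]
      field_simp
  have hper : ∀ (m : ℤ) (s : ℕ), ζ ^ (-(m * ℓ + s)) + ζ * ζ ^ (m * ℓ + s) - 1 - ζ =
      ζ ^ (-(s : ℤ)) + ζ * ζ ^ s - 1 - ζ := by
    intro m s
    have h2 : ζ ^ (m * ℓ + s) = ζ ^ s := by
      rw [zpow_add₀ hζ0, mul_comm m, zpow_mul, zpow_natCast, hζ, one_zpow, one_mul, zpow_natCast]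
    rw [zpow_neg, h2, zpow_neg, zpow_natCast]
  have hterm : ∀ (k : ℕ) (m : ℤ) (s : ℕ), (-1) ^ (m * ℓ + s) * q ^ tri (m * ℓ + s) *
      (q ^ (e + k)) ^ (m * ℓ + s : ℤ) / (1 - (q ^ (m * ℓ + s : ℤ)) ^ ℓ) =
      (-1) ^ s * q ^ (s.choose 2 + (e + k) * s) *
        ((-1) ^ m * (q ^ ℓ ^ 2) ^ tri m * (q ^ (ℓ * (h + (e + k) + s))) ^ m /
          (1 - q ^ (ℓ * s) * (q ^ ℓ ^ 2) ^ m)) := by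
    intro k m s
    rw [theta_term_residue hq0 hℓ, mul_div_assoc]
    congr 3
    simp only [← zpow_natCast, ← zpow_mul, ← zpow_add₀ hq0]
    congr 1
    push_cast
    ring
  have hsum : ∀ (k s : ℕ), Summable fun m : ℤ => c k * (ζ ^ (-(s : ℤ)) + ζ * ζ ^ s - 1 - ζ) *
      ((-1) ^ s * q ^ (s.choose 2 + (e + k) * s) *
        ((-1) ^ m * (q ^ ℓ ^ 2) ^ tri m * (q ^ (ℓ * (h + (e + k) + s))) ^ m /
          (1 - q ^ (ℓ * s) * (q ^ ℓ ^ 2) ^ m))) := fun k s =>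
    ((summable_appell hQ0 hQ (pow_ne_zero _ hq0) (pow_ne_zero _ hq0)).mul_left _).mul_left _
  have hS : Summable fun r : ℤ => (-1) ^ r * q ^ tri r * (q ^ e) ^ r *
      (ζ ^ (-r) + ζ * ζ ^ r - 1 - ζ) / ((1 - ρ * q ^ r) * (1 - ρ⁻¹ * q ^ r)) := by
    obtain ⟨C1, hC1⟩ := exists_bound_inv_one_sub hq0 hq hρ0
    obtain ⟨C2, hC2⟩ := exists_bound_inv_one_sub hq0 hq (inv_ne_zero hρ0)
    refine Summable.of_norm_bounded
      ((summable_pair hq0 hq hζ0 (pow_ne_zero e hq0)).mul_right (C1 * C2)) fun r => ?_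
    rw [div_eq_mul_inv, norm_mul, mul_inv, norm_mul (_⁻¹)]
    have := (norm_nonneg _).trans (hC1 0)
    gcongr
    · exact hC1 r
    · exact hC2 r
  rw [tsum_eq_sum_residues hS ℓ]
  refine Finset.sum_congr rfl fun s _ => ?_
  rw [tsum_congr fun m : ℤ => h1 (m * ℓ + s)]
  simp only [hper, hterm]
  rw [Summable.tsum_finsetSum fun k _ => hsum k s]
  refine Finset.sum_congr rfl fun k _ => ?_
  rw [tsum_mul_left, tsum_mul_left, ← appell]
  ring

/-- The theta series at the powers `y^j` in base `y^ℓ`. -/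
def thetaPow (y : ℂ) (ℓ j : ℕ) : ℂ := theta (y ^ j) (y ^ ℓ)

/-- The Appell-Lerch series at powers of `y` in base `y^ℓ`. -/
def appellPow (y : ℂ) (ℓ κ s : ℕ) : ℂ := appell (y ^ (κ + s)) (y ^ s) (y ^ ℓ)

/-- The numerator factors as ζ^(-s) (1 - ζ^s)(1 - ζ^(s+1)), hence vanishes for s = 0 and s = ℓ - 1.
After removal of the factor (1 - ζ)(1 - ζ⁻¹)(1 + ζ), which equals (ζ - ζ⁻¹)(1 - ζ) and so cancels on
both sides, the numbers t s can be written in ζ + ζ⁻¹. -/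
theorem rank_eq {q ζ : ℂ} (hq0 : q ≠ 0) (hq : ‖q‖ < 1) {ℓ h : ℕ} (hℓ : ℓ = 2 * h + 1)
    (hh : h ≠ 0) (hζ : IsPrimitiveRoot ζ ℓ) {e : ℕ} (he : e = 1 ∨ e = 2) (K : ℕ) {c t : ℕ → ℂ}
    {Θ : ℂ} (hc : ∀ x : ℂ, (1 - ζ ^ 2 * x) * (1 - (ζ ^ 2)⁻¹ * x) * ∑ k ∈ range K, c k * x ^ k =
      1 - x ^ ℓ)
    (ht : ∀ s ∈ range ℓ, ζ ^ (-(s : ℤ)) + ζ * ζ ^ s - 1 - ζ =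
      -((1 - ζ) * (1 - ζ⁻¹) * (1 + ζ)) * t s) (hΘ : theta ζ q = (1 - ζ) * Θ) :
    Θ * (rankFactor (ζ ^ 2) (ζ ^ (-2 : ℤ)) ζ q *
        ∑' n : ℕ, rankTerm e (ζ ^ 2) (ζ ^ (-2 : ℤ)) ζ q (n + 1)) =
      ∑ s ∈ range ℓ, ∑ k ∈ range K, (-1) ^ (s + 1) * t s * c k *
        q ^ (s.choose 2 + (e + k) * s) *
          appellPow (q ^ ℓ) ℓ (h + (e + k)) s := by
  have hn : ‖ζ‖ = 1 := hζ.norm'_eq_one (by omega)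
  have hζ0 : ζ ≠ 0 := hζ.ne_zero (by omega)
  have h1 : ζ ≠ 1 := hζ.ne_one (by omega)
  have h2 : ζ ^ 2 ≠ 1 := hζ.pow_ne_one_of_pos_of_lt (by norm_num) (by omega)
  have hn2 : ‖ζ ^ 2‖ = 1 := by rw [norm_pow, hn, one_pow]
  have hn3 : ‖(ζ ^ 2)⁻¹‖ = 1 := by rw [norm_inv, hn2, inv_one]
  have hinv : ζ ^ (-2 : ℤ) = (ζ ^ 2)⁻¹ := by rw [zpow_neg]; rfl
  have hD : ∀ r : ℤ, (1 - ζ ^ 2 * q ^ r) * (1 - (ζ ^ 2)⁻¹ * q ^ r) ≠ 0 := fun r =>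
    mul_ne_zero (denom_ne_zero hq hn2 h2 r) (denom_ne_zero hq hn3 (by simpa using h2) r)
  have key := rank_series hq0 hq hn h1 hn2 h2 (c := q ^ (e - 1)) rfl he
  have hqe : q ^ (e - 1) * q = q ^ e := by rcases he with rfl | rfl <;> simp [pow_two]
  rw [hqe, lambert_dissection hq0 hq hℓ hζ.pow_eq_one (pow_ne_zero 2 hζ0) e K hD hc, hΘ] at key
  have n1 : (1 - ζ) * (1 - ζ⁻¹) * (1 + ζ) ≠ 0 := by
    refine mul_ne_zero (mul_ne_zero (sub_ne_zero.2 h1.symm) ?_) ?_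
    · rw [sub_ne_zero]
      exact fun h3 => h1 (by simpa using h3.symm)
    · intro h3
      exact h2 (by linear_combination (ζ - 1) * h3)
  rw [hinv]
  refine mul_left_cancel₀ n1 ?_
  have e1 : (ζ - ζ⁻¹) * (1 - ζ) = (1 - ζ) * (1 - ζ⁻¹) * (1 + ζ) := by
    field_simp
    ring
  rw [← e1]
  refine Eq.trans (by ring) (key.trans ?_)
  rw [e1, Finset.mul_sum]
  refine Finset.sum_congr rfl fun s hs => ?_
  rw [Finset.mul_sum]
  refine Finset.sum_congr rfl fun k _ => ?_
  rw [ht s hs]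
  simp only [appellPow, ← pow_mul, pow_two ℓ]
  ring

theorem lambert_eq_appell {A B C : ℤ} {i j a : ℕ} (hA : A = a) (hi : A + B = 2 * i) (hC : C = j)
    {q : ℂ} (hq0 : q ≠ 0) : lambert A B C q = appell (q ^ i) (q ^ j) (q ^ a) := by
  refine tsum_congr fun n => ?_
  have h1 : (A * n ^ 2 + B * n) / 2 = a * tri n + i * n := by
    have h2 := two_mul_tri n
    have : A * n ^ 2 + B * n = 2 * (a * tri n + i * n) := by
      subst hA
      linear_combination (-(a : ℤ)) * h2 + n * hi
    rw [this, Int.mul_ediv_cancel_left _ (by norm_num)]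
  rw [lambertTerm, h1, hC, hA]
  have e1 : q ^ ((a : ℤ) * n + j) = q ^ j * (q ^ a) ^ n := by
    simp only [← zpow_natCast, ← zpow_mul, ← zpow_add₀ hq0]
    rw [add_comm]
  have e2 : q ^ ((a : ℤ) * tri n + i * n) = (q ^ a) ^ tri n * (q ^ i) ^ n := by
    simp only [← zpow_natCast, ← zpow_mul, ← zpow_add₀ hq0]
  rw [e1, e2]
  ring

theorem lambert_eq_appellPow {A B C : ℤ} {ℓ κ s : ℕ} (hA : A = ℓ * ℓ)
    (hi : A + B = 2 * (ℓ * (κ + s))) (hC : C = ℓ * s) {q : ℂ} (hq0 : q ≠ 0) :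
    lambert A B C q = appellPow (q ^ ℓ) ℓ κ s := by
  rw [appellPow, ← pow_mul, ← pow_mul, ← pow_mul]
  exact lambert_eq_appell (by rw [hA]; push_cast; rfl) (by rw [hi]; push_cast; rfl)
    (by rw [hC]; push_cast; rfl) hq0

/-! ### Theta and Appell–Lerch series at powers of `y` in base `y ^ ℓ`. -/

section PowerBase

variable {y : ℂ} {ℓ : ℕ}

theorem thetaPow_zero (hy0 : y ≠ 0) : thetaPow y ℓ 0 = 0 := by
  rw [thetaPow, pow_zero, theta_one (pow_ne_zero _ hy0)]

theorem thetaPow_add (hy0 : y ≠ 0) (j : ℕ) :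
    thetaPow y ℓ (ℓ + j) = -(y ^ j)⁻¹ * thetaPow y ℓ j := by
  rw [thetaPow, thetaPow, pow_add, theta_q_mul (pow_ne_zero _ hy0) (pow_ne_zero _ hy0)]

/-- Together with `thetaPow_add` this reduces every index to the range 0, …, (ℓ - 1)/2. -/
theorem thetaPow_refl (hy0 : y ≠ 0) {i j : ℕ} (h : i + j = ℓ) :
    thetaPow y ℓ i = thetaPow y ℓ j := by
  have h1 : y ^ i = y ^ ℓ * (y ^ j)⁻¹ := by
    rw [← h, pow_add, mul_inv_cancel_right₀ (pow_ne_zero _ hy0)]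
  have hj := pow_ne_zero j hy0
  rw [thetaPow, thetaPow, h1, theta_q_mul (pow_ne_zero _ hy0) (inv_ne_zero hj), theta_inv
      (pow_ne_zero _ hy0) hj, inv_inv,
    neg_mul, neg_mul, mul_neg, neg_neg, mul_inv_cancel_left₀ hj]

theorem one_sub_pow_mul_zpow_ne_zero (hy0 : y ≠ 0) (hy : ‖y‖ < 1) {s : ℤ} (hs : ¬ (ℓ : ℤ) ∣ s)
    (n : ℤ) : 1 - y ^ s * (y ^ ℓ) ^ n ≠ 0 := by
  intro h
  have h1 := congrArg norm (sub_eq_zero.1 h)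
  rw [← zpow_natCast y ℓ, ← zpow_mul, ← zpow_add₀ hy0, norm_one, norm_zpow] at h1
  have h2 := (zpow_eq_one_iff_right₀ (norm_nonneg _) hy.ne).1 h1.symm
  exact hs ⟨-n, by linarith⟩

theorem thetaPow_ne_zero (hy0 : y ≠ 0) (hy : ‖y‖ < 1) (hℓ : ℓ ≠ 0) {s : ℕ} (hs : ¬ ℓ ∣ s) :
    thetaPow y ℓ s ≠ 0 := by
  refine theta_ne_zero (pow_ne_zero _ hy0) ?_ (pow_ne_zero _ hy0) fun n => ?_
  · rw [norm_pow]; exact pow_lt_one₀ (norm_nonneg _) hy hℓ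
  · simpa using one_sub_pow_mul_zpow_ne_zero hy0 hy (s := s) (by exact_mod_cast hs) n

/-- The case a₀ = y^s, a₁ = y^(s+d), c = y^κ of `appell_change`: the index κ is kept while s moves.
-/
theorem appellPow_change (hy0 : y ≠ 0) (hy : ‖y‖ < 1) (hℓ : ℓ ≠ 0) {κ s d : ℕ} (hs : ¬ ℓ ∣ s)
    (hd : ¬ ℓ ∣ s + d) :
    thetaPow y ℓ s * thetaPow y ℓ (s + d) *
      (thetaPow y ℓ (κ + s) * appellPow y ℓ κ (s + d) -
        thetaPow y ℓ (κ + (s + d)) * appellPow y ℓ κ s) =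
      -(y ^ s * qPochInf (y ^ ℓ) (y ^ ℓ) ^ 3 * thetaPow y ℓ d *
        thetaPow y ℓ (κ + (s + (s + d)))) := by
  have h0 := pow_ne_zero s hy0
  have hQ : ‖y ^ ℓ‖ < 1 := by rw [norm_pow]; exact pow_lt_one₀ (norm_nonneg _) hy hℓ
  have hs' : ¬ (ℓ : ℤ) ∣ s := by exact_mod_cast hs
  have hd' : ¬ (ℓ : ℤ) ∣ (s + d : ℕ) := by exact_mod_cast hd
  have h1 := appell_change (c := y ^ κ) (pow_ne_zero ℓ hy0) hQ h0 (pow_ne_zero (s + d) hy0)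
    (pow_ne_zero κ hy0)
    (fun n => by simpa using one_sub_pow_mul_zpow_ne_zero hy0 hy hs' n)
    (fun n => by
      have := one_sub_pow_mul_zpow_ne_zero hy0 hy (s := -s) (by rwa [dvd_neg]) n
      rwa [zpow_neg, zpow_natCast] at this)
    (fun h => by
      have h2 := congrArg norm h
      rw [norm_pow, norm_pow, norm_one, ← pow_mul] at h2
      have h3 := (pow_eq_one_iff_of_nonneg (norm_nonneg y) (n := s * 2)
        (fun h => hs (by simp at h; simp [h]))).1 h2
      exact hy.ne h3)
    (fun n => by
      have := one_sub_pow_mul_zpow_ne_zero hy0 hy hd' n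
      rwa [zpow_natCast] at this)
  have h2 : y ^ (s + d) / y ^ s = y ^ d := by rw [pow_add, mul_div_cancel_left₀ _ h0]
  rw [h2] at h1
  simpa only [thetaPow, appellPow, ← pow_add] using h1

/-- `appellPow_change` solved for the smaller residue; `appellPow_add_eq` solves for the larger one.
If κ plus the residue solved for is divisible by ℓ, the coefficient of the other series is zero and
a pure theta quotient remains. -/
theorem appellPow_eq_of_add (hy0 : y ≠ 0) (hy : ‖y‖ < 1) (hℓ : ℓ ≠ 0) {κ s d : ℕ} (hs : ¬ ℓ ∣ s)
    (hd : ¬ ℓ ∣ s + d) (hκ : ¬ ℓ ∣ κ + (s + d)) :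
    appellPow y ℓ κ s = (thetaPow y ℓ (κ + s) * appellPow y ℓ κ (s + d) +
      y ^ s * qPochInf (y ^ ℓ) (y ^ ℓ) ^ 3 * thetaPow y ℓ d * thetaPow y ℓ (κ + (s + (s + d))) /
        (thetaPow y ℓ s * thetaPow y ℓ (s + d))) / thetaPow y ℓ (κ + (s + d)) := by
  have h1 := appellPow_change hy0 hy hℓ (κ := κ) hs hd
  have n1 := thetaPow_ne_zero hy0 hy hℓ hs
  have n2 := thetaPow_ne_zero hy0 hy hℓ hd
  have n3 := thetaPow_ne_zero hy0 hy hℓ hκ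
  field_simp
  linear_combination -h1

theorem appellPow_add_eq (hy0 : y ≠ 0) (hy : ‖y‖ < 1) (hℓ : ℓ ≠ 0) {κ s d : ℕ} (hs : ¬ ℓ ∣ s)
    (hd : ¬ ℓ ∣ s + d) (hκ : ¬ ℓ ∣ κ + s) :
    appellPow y ℓ κ (s + d) = (thetaPow y ℓ (κ + (s + d)) * appellPow y ℓ κ s -
      y ^ s * qPochInf (y ^ ℓ) (y ^ ℓ) ^ 3 * thetaPow y ℓ d * thetaPow y ℓ (κ + (s + (s + d))) /
        (thetaPow y ℓ s * thetaPow y ℓ (s + d))) / thetaPow y ℓ (κ + s) := by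
  have h1 := appellPow_change hy0 hy hℓ (κ := κ) hs hd
  have n1 := thetaPow_ne_zero hy0 hy hℓ hs
  have n2 := thetaPow_ne_zero hy0 hy hℓ hd
  have n3 := thetaPow_ne_zero hy0 hy hℓ hκ
  field_simp
  linear_combination h1

/-- The reflection n ↦ -n followed by the shift n ↦ n + 1. Powers of y stand on both sides to avoid
negative exponents. -/
theorem appellPow_inv (hy0 : y ≠ 0) {κ κ' s s' : ℕ} (hκ : κ + κ' = 2 * ℓ) (hs : s + s' = ℓ) :
    y ^ (κ + 2 * s) * appellPow y ℓ κ s = y ^ (2 * ℓ) * appellPow y ℓ κ' s' := by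
  rw [appellPow, appellPow]
  have hQ := pow_ne_zero ℓ hy0
  have h0 := pow_ne_zero s hy0
  have hz := pow_ne_zero (κ + s) hy0
  have e1 := appell_inv hQ hz h0
  have e2 := appell_shift (z := y ^ ℓ * y ^ ℓ / y ^ (κ + s)) (a := (y ^ s)⁻¹) hQ
    (div_ne_zero (mul_ne_zero hQ hQ) hz)
  have e3 : y ^ ℓ * (y ^ ℓ * y ^ ℓ / y ^ (κ + s)) = y ^ (κ' + s') := by
    rw [mul_div_assoc', div_eq_iff hz]
    simp only [← pow_add]
    congr 1
    omega
  have e4 : y ^ ℓ * (y ^ s)⁻¹ = y ^ s' := by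
    rw [← hs, pow_add, mul_comm (y ^ s), mul_inv_cancel_right₀ h0]
  rw [e3, e4] at e2
  rw [e1, e2]
  rw [show κ + 2 * s = s + (κ + s) by ring, show 2 * ℓ = ℓ + ℓ by ring]
  simp only [pow_add y s (κ + s), pow_add y ℓ ℓ]
  field_simp

end PowerBase

theorem thetaPow_eq_E_mul_P {q : ℂ} (hq0 : q ≠ 0) (hq : ‖q‖ < 1) {ℓ : ℕ} (hℓ : ℓ ≠ 0) (a : ℕ) :
    thetaPow (q ^ ℓ) ℓ a = E (ℓ ^ 2) q * P ℓ a q := by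
  have hQ : ‖(q ^ ℓ) ^ ℓ‖ < 1 := by
    rw [← pow_mul, norm_pow]
    exact pow_lt_one₀ (norm_nonneg _) hq (mul_ne_zero hℓ hℓ)
  rw [thetaPow, theta_eq (pow_ne_zero _ (pow_ne_zero _ hq0)) hQ (pow_ne_zero _ (pow_ne_zero _
      hq0)), E, P,
    ← pow_mul, ← pow_mul, pow_two]

theorem E_ne_zero {q : ℂ} (hq : ‖q‖ < 1) {a : ℕ} (ha : a ≠ 0) : E a q ≠ 0 := by
  have : ‖q ^ a‖ < 1 := by rw [norm_pow]; exact pow_lt_one₀ (norm_nonneg _) hq ha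
  exact qPochInf_ne_zero_of_norm_lt this this

theorem norm_pow_lt_one' {q : ℂ} (hq : ‖q‖ < 1) {a : ℕ} (ha : a ≠ 0) : ‖q ^ a‖ < 1 := by
  rw [norm_pow]; exact pow_lt_one₀ (norm_nonneg _) hq ha

theorem P_ne_zero {q : ℂ} (hq0 : q ≠ 0) (hq : ‖q‖ < 1) {ℓ a : ℕ} (hℓ : ℓ ≠ 0) (ha : ¬ ℓ ∣ a) :
    P ℓ a q ≠ 0 := by
  have h1 := thetaPow_ne_zero (pow_ne_zero ℓ hq0) (norm_pow_lt_one' hq hℓ) hℓ ha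
  rw [thetaPow_eq_E_mul_P hq0 hq hℓ] at h1
  exact right_ne_zero_of_mul h1

theorem theta_eq_one_sub_mul {q z : ℂ} (hq0 : q ≠ 0) (hq : ‖q‖ < 1) (hz : z ≠ 0) :
    theta z q = (1 - z) * (qPochInf q q * qPochInf (z * q) q * qPochInf (z⁻¹ * q) q) := by
  rw [theta_eq hq0 hq hz, jacProd, qPochInf_eq_mul z hq, div_eq_inv_mul]
  ring

/-! ### Cube roots of unity -/

/-- Factor by factor this is (1 - x)(1 - ζx)(1 - ζ⁻¹x) = 1 - x³. -/
theorem qPochInf_mul_cube_roots {q ζ : ℂ} (hq : ‖q‖ < 1) (hζ : IsPrimitiveRoot ζ 3) :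
    qPochInf q q * qPochInf (ζ * q) q * qPochInf (ζ⁻¹ * q) q = E 3 q := by
  have h3 : 1 + ζ + ζ ^ 2 = 0 := by
    have := hζ.geom_sum_eq_zero (by norm_num)
    simpa [Finset.sum_range_succ] using this
  have hinv : ζ⁻¹ = ζ ^ 2 := by
    have hζ0 := hζ.ne_zero (by norm_num)
    field_simp
    rw [← hζ.pow_eq_one]
  have h1 := ((tendsto_qPoch q hq).mul (tendsto_qPoch (ζ * q) hq)).mul (tendsto_qPoch (ζ⁻¹ * q) hq)
  have h2 := tendsto_qPoch (q ^ 3) (norm_pow_lt_one' hq (a := 3) (by norm_num))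
  refine tendsto_nhds_unique h1 (h2.congr fun n => ?_)
  rw [qPoch, qPoch, qPoch, qPoch, ← Finset.prod_mul_distrib, ← Finset.prod_mul_distrib]
  refine Finset.prod_congr rfl fun j _ => ?_
  rw [hinv, ← pow_mul, mul_comm 3 j, pow_mul]
  have h4 : ζ ^ 3 = 1 := hζ.pow_eq_one
  generalize q ^ j = x
  linear_combination q ^ 3 * x ^ 3 * h4 + (q * x - ζ * q ^ 2 * x ^ 2) * h3

/-- Only the residue s = 1 survives and the cofactor is 1 - x, so each function is a difference of
two series; inversion moves these from s = 1 to s = 2. -/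
theorem rank_three {q ζ : ℂ} (hq0 : q ≠ 0) (hq : ‖q‖ < 1) (hζ : IsPrimitiveRoot ζ 3) :
    RU ζ q = q ^ 7 / E 3 q * lambert 9 27 6 q - q ^ 5 / E 3 q * lambert 9 21 6 q ∧
      RV ζ q = -(q ^ 3 / E 3 q) * lambert 9 15 6 q + q ^ 5 / E 3 q * lambert 9 21 6 q := by
  have hζ0 := hζ.ne_zero (by norm_num)
  have h3 : 1 + ζ + ζ ^ 2 = 0 := by
    have := hζ.geom_sum_eq_zero (by norm_num)
    simpa [Finset.sum_range_succ] using this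
  have hE := E_ne_zero hq (a := 3) (by norm_num)
  have hy0 : q ^ 3 ≠ 0 := pow_ne_zero 3 hq0
  have key := fun e he => rank_eq hq0 hq (ℓ := 3) (h := 1) rfl one_ne_zero hζ (e := e) he 2
    (c := fun k => if k = 0 then 1 else -1) (t := fun s => if s = 1 then 1 else 0)
    (Θ := E 3 q) (fun x => by
      simp only [Finset.sum_range_succ, Finset.sum_range_zero]
      norm_num
      field_simp
      linear_combination (x - 1) * x * (1 - ζ + ζ ^ 2) * h3)
    (fun s hs => by
      have hs' : s < 3 := Finset.mem_range.1 hs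
      interval_cases s
      · simp
      · simp
        field_simp
        ring
      · simp
        field_simp
        linear_combination (ζ ^ 3 - ζ ^ 2 - ζ + 1) * h3)
    (by rw [theta_eq_one_sub_mul hq0 hq hζ0, qPochInf_mul_cube_roots hq hζ])
  have l1 : lambert 9 27 6 q = appellPow (q ^ 3) 3 4 2 :=
    lambert_eq_appellPow (by norm_num) (by norm_num) (by norm_num) hq0
  have l2 : lambert 9 21 6 q = appellPow (q ^ 3) 3 3 2 :=
    lambert_eq_appellPow (by norm_num) (by norm_num) (by norm_num) hq0
  have l3 : lambert 9 15 6 q = appellPow (q ^ 3) 3 2 2 :=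
    lambert_eq_appellPow (by norm_num) (by norm_num) (by norm_num) hq0
  have i1 := appellPow_inv hy0 (ℓ := 3) (κ := 2) (κ' := 4) (s := 1) (s' := 2) rfl rfl
  have i2 := appellPow_inv hy0 (ℓ := 3) (κ := 3) (κ' := 3) (s := 1) (s' := 2) rfl rfl
  have i3 := appellPow_inv hy0 (ℓ := 3) (κ := 4) (κ' := 2) (s := 1) (s' := 2) rfl rfl
  have j1 : appellPow (q ^ 3) 3 2 1 = q ^ 6 * appellPow (q ^ 3) 3 4 2 :=
    mul_left_cancel₀ (pow_ne_zero 4 hy0) (by linear_combination i1)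
  have j2 : appellPow (q ^ 3) 3 3 1 = q ^ 3 * appellPow (q ^ 3) 3 3 2 :=
    mul_left_cancel₀ (pow_ne_zero 5 hy0) (by linear_combination i2)
  have j3 : appellPow (q ^ 3) 3 4 1 = appellPow (q ^ 3) 3 2 2 :=
    mul_left_cancel₀ (pow_ne_zero 6 hy0) (by linear_combination i3)
  have k1 := key 1 (Or.inl rfl)
  have k2 := key 2 (Or.inr rfl)
  change E 3 q * RU ζ q = _ at k1
  change E 3 q * RV ζ q = _ at k2
  norm_num [Finset.sum_range_succ] at k1 k2
  rw [j1, j2] at k1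
  rw [j2, j3] at k2
  rw [l1, l2, l3]
  constructor <;>
  · field_simp
    first
    | linear_combination k1
    | linear_combination k2

theorem theta_root_ne_zero {q ζ : ℂ} (hq0 : q ≠ 0) (hq : ‖q‖ < 1) {ℓ : ℕ}
    (hζ : IsPrimitiveRoot ζ ℓ) (hℓ : 1 < ℓ) : theta ζ q ≠ 0 :=
  theta_ne_zero hq0 hq (hζ.ne_zero (by omega)) (denom_ne_zero hq (hζ.norm'_eq_one (by omega))
    (hζ.ne_one hℓ))

/-! ### Fifth roots of unity -/

theorem thetaPow_five {y : ℂ} (hy0 : y ≠ 0) :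
    thetaPow y 5 3 = thetaPow y 5 2 ∧ thetaPow y 5 4 = thetaPow y 5 1 ∧ thetaPow y 5 5 = 0 ∧
      thetaPow y 5 6 = -y⁻¹ * thetaPow y 5 1 ∧ thetaPow y 5 7 = -(y ^ 2)⁻¹ * thetaPow y 5 2 ∧
      thetaPow y 5 8 = -(y ^ 3)⁻¹ * thetaPow y 5 2 ∧ thetaPow y 5 9 = -(y ^ 4)⁻¹ * thetaPow y 5 1 ∧
      thetaPow y 5 10 = 0 := by
  have t3 : thetaPow y 5 3 = thetaPow y 5 2 := thetaPow_refl hy0 rfl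
  have t4 : thetaPow y 5 4 = thetaPow y 5 1 := thetaPow_refl hy0 rfl
  have t5 : thetaPow y 5 5 = 0 := by
    rw [show 5 = 5 + 0 from rfl, thetaPow_add hy0, thetaPow_zero hy0, mul_zero]
  refine ⟨t3, t4, t5, ?_, thetaPow_add hy0 2, ?_, ?_, ?_⟩
  · simpa using thetaPow_add (ℓ := 5) hy0 1
  · rw [← t3]; exact thetaPow_add hy0 3
  · rw [← t4]; exact thetaPow_add hy0 4
  · rw [show 10 = 5 + 5 from rfl, thetaPow_add hy0, t5, mul_zero]

theorem theta_five {q ζ : ℂ} (hq0 : q ≠ 0) (hq : ‖q‖ < 1) (hζ : IsPrimitiveRoot ζ 5) :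
    theta ζ q = (1 - ζ) *
      (thetaPow (q ^ 5) 5 2 - (1 + (ζ + ζ⁻¹)) * q * thetaPow (q ^ 5) 5 1) := by
  have hζ0 := hζ.ne_zero (by norm_num)
  have h5 : 1 + ζ + ζ ^ 2 + ζ ^ 3 + ζ ^ 4 = 0 := by
    have := hζ.geom_sum_eq_zero (by norm_num)
    simpa [Finset.sum_range_succ] using this
  have hy0 : q ^ 5 ≠ 0 := pow_ne_zero 5 hq0
  have h1 := theta_dissection hq0 hq (ℓ := 5) (h := 2) rfl hζ.pow_eq_one
  have h2 : ∀ j, theta (q ^ (5 * j)) (q ^ 5 ^ 2) = thetaPow (q ^ 5) 5 j := fun j => by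
    rw [thetaPow, ← pow_mul, ← pow_mul, pow_two]
  simp only [h2] at h1
  obtain ⟨t3, t4, t5, t6, -⟩ := thetaPow_five hy0
  norm_num [Finset.sum_range_succ, t3, t4, t5, t6, Nat.choose] at h1
  rw [h1]
  field_simp
  linear_combination (-(q * thetaPow (q ^ 5) 5 1)) * (ζ - 1) * h5

theorem rank_eq_five {q ζ : ℂ} (hq0 : q ≠ 0) (hq : ‖q‖ < 1) (hζ : IsPrimitiveRoot ζ 5) {e : ℕ}
    (he : e = 1 ∨ e = 2) {g : ℂ} (hg : g = ζ + ζ⁻¹) :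
    (thetaPow (q ^ 5) 5 2 - (1 + g) * q * thetaPow (q ^ 5) 5 1) *
      (rankFactor (ζ ^ 2) (ζ ^ (-2 : ℤ)) ζ q *
        ∑' n : ℕ, rankTerm e (ζ ^ 2) (ζ ^ (-2 : ℤ)) ζ q (n + 1)) =
      ∑ s ∈ range 5, ∑ k ∈ range 4, (-1) ^ (s + 1) * (if s = 1 then 1 else if s = 2 then 1 + g
        else if s = 3 then 1 else 0) *
        (if k = 0 then 1 else if k = 1 then -(1 + g) else if k = 2 then 1 + g else -1) *
        q ^ (s.choose 2 + (e + k) * s) * appellPow (q ^ 5) 5 (2 + (e + k)) s := by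
  have hζ0 := hζ.ne_zero (by norm_num)
  have h5 : 1 + ζ + ζ ^ 2 + ζ ^ 3 + ζ ^ 4 = 0 := by
    have := hζ.geom_sum_eq_zero (by norm_num)
    simpa [Finset.sum_range_succ] using this
  have hy0 : q ^ 5 ≠ 0 := pow_ne_zero 5 hq0
  refine rank_eq hq0 hq (ℓ := 5) (h := 2) rfl two_ne_zero hζ he 4
    (c := fun k => if k = 0 then 1 else if k = 1 then -(1 + g) else if k = 2 then 1 + g else -1)
    (t := fun s => if s = 1 then 1 else if s = 2 then 1 + g else if s = 3 then 1 else 0)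
    (fun x => ?_) (fun s hs => ?_) ?_
  -- The five fifth roots of unity sum to zero; the cofactor of the resulting quadratic is then
  -- found modulo g² + g - 1.
  · have hρ : ζ ^ 2 + (ζ ^ 2)⁻¹ = -(1 + g) := by
      rw [hg]
      field_simp
      linear_combination h5
    have hg2 : g ^ 2 + g - 1 = 0 := by
      rw [hg]
      field_simp
      linear_combination h5
    have h1 : (1 - ζ ^ 2 * x) * (1 - (ζ ^ 2)⁻¹ * x) = 1 + (1 + g) * x + x ^ 2 := by
      have h2 : ζ ^ 2 * (ζ ^ 2)⁻¹ = 1 := mul_inv_cancel₀ (pow_ne_zero 2 hζ0)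
      linear_combination (-x) * hρ + x ^ 2 * h2
    rw [h1]
    norm_num [Finset.sum_range_succ]
    linear_combination (-(x ^ 2) + x ^ 3) * hg2
  · have hs' : s < 5 := Finset.mem_range.1 hs
    rw [hg]
    interval_cases s
    · simp
    · norm_num
      field_simp
      ring
    · norm_num
      field_simp
      ring
    · norm_num
      field_simp
      linear_combination (ζ - 1) * (ζ ^ 2 - 1) * h5
    · norm_num
      field_simp
      linear_combination (ζ - 1) * (ζ ^ 4 - 1) * h5
  · rw [hg]; exact theta_five hq0 hq hζ

theorem RU_five {q ζ : ℂ} (hq0 : q ≠ 0) (hq : ‖q‖ < 1) (hζ : IsPrimitiveRoot ζ 5) :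
    RU ζ q = q * (E 25 q / P 5 1 q ^ 2) - q ^ 7 / (E 25 q * P 5 2 q) * lambert 25 45 10 q
      - q ^ 4 / (E 25 q * P 5 1 q) * lambert 25 35 10 q := by
  have hζ0 := hζ.ne_zero (by norm_num)
  have h5 : 1 + ζ + ζ ^ 2 + ζ ^ 3 + ζ ^ 4 = 0 := by
    have := hζ.geom_sum_eq_zero (by norm_num)
    simpa [Finset.sum_range_succ] using this
  obtain ⟨g, hg⟩ : ∃ g, g = ζ + ζ⁻¹ := ⟨_, rfl⟩
  have hg2 : g ^ 2 + g - 1 = 0 := by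
    rw [hg]
    field_simp
    linear_combination h5
  have hΘ : thetaPow (q ^ 5) 5 2 - (1 + g) * q * thetaPow (q ^ 5) 5 1 ≠ 0 := by
    have h1 := theta_root_ne_zero hq0 hq hζ (by norm_num)
    rw [theta_five hq0 hq hζ, ← hg] at h1
    exact right_ne_zero_of_mul h1
  have key := rank_eq_five hq0 hq hζ (Or.inl rfl) hg
  change _ * RU ζ q = _ at key
  have l1 : lambert 25 45 10 q = appellPow (q ^ 5) 5 5 2 :=
    lambert_eq_appellPow (by norm_num) (by norm_num) (by norm_num) hq0
  have l2 : lambert 25 35 10 q = appellPow (q ^ 5) 5 4 2 :=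
    lambert_eq_appellPow (by norm_num) (by norm_num) (by norm_num) hq0
  have hE := E_ne_zero hq (a := 25) (by norm_num)
  have hP1 := P_ne_zero hq0 hq (ℓ := 5) (a := 1) (by norm_num) (by norm_num)
  have hP2 := P_ne_zero hq0 hq (ℓ := 5) (a := 2) (by norm_num) (by norm_num)
  have e1 : thetaPow (q ^ 5) 5 1 = E 25 q * P 5 1 q := thetaPow_eq_E_mul_P hq0 hq (by norm_num) 1
  have e2 : thetaPow (q ^ 5) 5 2 = E 25 q * P 5 2 q := thetaPow_eq_E_mul_P hq0 hq (by norm_num) 2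
  have hJ : qPochInf ((q ^ 5) ^ 5) ((q ^ 5) ^ 5) = E 25 q := by rw [E, ← pow_mul]
  obtain ⟨y, hyq⟩ : ∃ y, y = q ^ 5 := ⟨_, rfl⟩
  have hy0 : y ≠ 0 := hyq ▸ pow_ne_zero 5 hq0
  have hy : ‖y‖ < 1 := hyq ▸ norm_pow_lt_one' hq (by norm_num)
  obtain ⟨t3, t4, t5, t6, t7, t8, t9, t10⟩ := thetaPow_five hy0
  rw [l1, l2]
  rw [← hyq] at key e1 e2 hJ hΘ ⊢
  -- In `aκs` the digits are κ and s. The anchors are (3, 1), (4, 2) and (5, 2); the last two are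
  -- the Lambert series of the claim, and the first cancels in the end.
  have a32 := appellPow_add_eq hy0 hy (ℓ := 5) (κ := 3) (s := 1) (d := 1) (by norm_num)
    (by norm_num) (by norm_num) (by norm_num)
  have a33 := appellPow_add_eq hy0 hy (ℓ := 5) (κ := 3) (s := 1) (d := 2) (by norm_num)
    (by norm_num) (by norm_num) (by norm_num)
  have a41 := appellPow_eq_of_add hy0 hy (ℓ := 5) (κ := 4) (s := 1) (d := 1) (by norm_num)
    (by norm_num) (by norm_num) (by norm_num)
  have a43 := appellPow_add_eq hy0 hy (ℓ := 5) (κ := 4) (s := 2) (d := 1) (by norm_num)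
    (by norm_num) (by norm_num) (by norm_num)
  have a44 := appellPow_add_eq hy0 hy (ℓ := 5) (κ := 4) (s := 2) (d := 2) (by norm_num)
    (by norm_num) (by norm_num) (by norm_num)
  have a51 := appellPow_eq_of_add hy0 hy (ℓ := 5) (κ := 5) (s := 1) (d := 1) (by norm_num)
    (by norm_num) (by norm_num) (by norm_num)
  have a53 := appellPow_add_eq hy0 hy (ℓ := 5) (κ := 5) (s := 2) (d := 1) (by norm_num)
    (by norm_num) (by norm_num) (by norm_num)
  -- Inversion exchanges κ = 6 with κ = 4.
  have j61 : appellPow y 5 6 1 = y ^ 2 * appellPow y 5 4 4 :=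
    mul_left_cancel₀ (pow_ne_zero 8 hy0) (by
      linear_combination appellPow_inv hy0 (ℓ := 5) (κ := 6) (κ' := 4) (s := 1) (s' := 4) rfl rfl)
  have j62 : appellPow y 5 6 2 = appellPow y 5 4 3 :=
    mul_left_cancel₀ (pow_ne_zero 10 hy0) (by
      linear_combination appellPow_inv hy0 (ℓ := 5) (κ := 6) (κ' := 4) (s := 2) (s' := 3) rfl rfl)
  have j63 : appellPow y 5 6 3 = (y ^ 2)⁻¹ * appellPow y 5 4 2 := by
    rw [eq_inv_mul_iff_mul_eq₀ (pow_ne_zero 2 hy0)]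
    exact mul_left_cancel₀ (pow_ne_zero 10 hy0) (by
      linear_combination appellPow_inv hy0 (ℓ := 5) (κ := 6) (κ' := 4) (s := 3) (s' := 2) rfl rfl)
  norm_num [t3, t4, t5, t6, t7, t8, t9, t10, hJ, e1, e2] at a32 a33 a41 a43 a44 a51 a53
  norm_num [Finset.sum_range_succ, Nat.choose, e1, e2] at key
  rw [j61, j62, j63, a32, a33, a41, a43, a44, a51, a53] at key
  rw [e1, e2] at hΘ
  refine mul_left_cancel₀ hΘ (key.trans ?_)
  -- The only products quadratic in g come from s = 2. Once they are reduced by g² = 1 - g, both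
  -- sides are linear in g and agree identically in g.
  have g1 : (-g + -1) * (-g + -1) = 2 + g := by linear_combination hg2
  have g2 : (-g + -1) * (1 + g) = -(2 + g) := by linear_combination -hg2
  rw [g1, g2]
  clear key a32 a33 a41 a43 a44 a51 a53 e1 e2
  generalize appellPow y 5 3 1 = A at *
  generalize appellPow y 5 4 2 = B at *
  generalize appellPow y 5 5 2 = C at *
  generalize E 25 q = J at *
  generalize P 5 1 q = T at *
  generalize P 5 2 q = S at *
  subst hyq
  field_simp
  ring

theorem RV_five {q ζ : ℂ} (hq0 : q ≠ 0) (hq : ‖q‖ < 1) (hζ : IsPrimitiveRoot ζ 5) :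
    RV ζ q = -(q ^ 5 / (E 25 q * P 5 1 q)) * lambert 25 35 15 q
      + q ^ 12 / (E 25 q * P 5 2 q) * lambert 25 55 15 q
      + q ^ 2 * (E 25 q / (P 5 1 q * P 5 2 q)) - q ^ 3 * (E 25 q / P 5 2 q ^ 2) := by
  have hζ0 := hζ.ne_zero (by norm_num)
  have h5 : 1 + ζ + ζ ^ 2 + ζ ^ 3 + ζ ^ 4 = 0 := by
    have := hζ.geom_sum_eq_zero (by norm_num)
    simpa [Finset.sum_range_succ] using this
  obtain ⟨g, hg⟩ : ∃ g, g = ζ + ζ⁻¹ := ⟨_, rfl⟩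
  have hg2 : g ^ 2 + g - 1 = 0 := by
    rw [hg]
    field_simp
    linear_combination h5
  have hΘ : thetaPow (q ^ 5) 5 2 - (1 + g) * q * thetaPow (q ^ 5) 5 1 ≠ 0 := by
    have h1 := theta_root_ne_zero hq0 hq hζ (by norm_num)
    rw [theta_five hq0 hq hζ, ← hg] at h1
    exact right_ne_zero_of_mul h1
  have key := rank_eq_five hq0 hq hζ (Or.inr rfl) hg
  change _ * RV ζ q = _ at key
  have l1 : lambert 25 35 15 q = appellPow (q ^ 5) 5 3 3 :=
    lambert_eq_appellPow (by norm_num) (by norm_num) (by norm_num) hq0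
  have l2 : lambert 25 55 15 q = appellPow (q ^ 5) 5 5 3 :=
    lambert_eq_appellPow (by norm_num) (by norm_num) (by norm_num) hq0
  have hE := E_ne_zero hq (a := 25) (by norm_num)
  have hP1 := P_ne_zero hq0 hq (ℓ := 5) (a := 1) (by norm_num) (by norm_num)
  have hP2 := P_ne_zero hq0 hq (ℓ := 5) (a := 2) (by norm_num) (by norm_num)
  have e1 : thetaPow (q ^ 5) 5 1 = E 25 q * P 5 1 q := thetaPow_eq_E_mul_P hq0 hq (by norm_num) 1
  have e2 : thetaPow (q ^ 5) 5 2 = E 25 q * P 5 2 q := thetaPow_eq_E_mul_P hq0 hq (by norm_num) 2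
  have hJ : qPochInf ((q ^ 5) ^ 5) ((q ^ 5) ^ 5) = E 25 q := by rw [E, ← pow_mul]
  obtain ⟨y, hyq⟩ : ∃ y, y = q ^ 5 := ⟨_, rfl⟩
  have hy0 : y ≠ 0 := hyq ▸ pow_ne_zero 5 hq0
  have hy : ‖y‖ < 1 := hyq ▸ norm_pow_lt_one' hq (by norm_num)
  obtain ⟨t3, t4, t5, t6, t7, t8, t9, t10⟩ := thetaPow_five hy0
  rw [l1, l2]
  rw [← hyq] at key e1 e2 hJ hΘ ⊢
  -- Here the anchors are (3, 3), (4, 2) and (5, 3); the one with κ = 4 cancels. Inversion sends κ =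
  -- 6 and κ = 7 to 4 and 3.
  have a32 := appellPow_eq_of_add hy0 hy (ℓ := 5) (κ := 3) (s := 2) (d := 1) (by norm_num)
    (by norm_num) (by norm_num) (by norm_num)
  have a34 := appellPow_add_eq hy0 hy (ℓ := 5) (κ := 3) (s := 3) (d := 1) (by norm_num)
    (by norm_num) (by norm_num) (by norm_num)
  have a41 := appellPow_eq_of_add hy0 hy (ℓ := 5) (κ := 4) (s := 1) (d := 1) (by norm_num)
    (by norm_num) (by norm_num) (by norm_num)
  have a43 := appellPow_add_eq hy0 hy (ℓ := 5) (κ := 4) (s := 2) (d := 1) (by norm_num)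
    (by norm_num) (by norm_num) (by norm_num)
  have a44 := appellPow_add_eq hy0 hy (ℓ := 5) (κ := 4) (s := 2) (d := 2) (by norm_num)
    (by norm_num) (by norm_num) (by norm_num)
  have a51 := appellPow_eq_of_add hy0 hy (ℓ := 5) (κ := 5) (s := 1) (d := 2) (by norm_num)
    (by norm_num) (by norm_num) (by norm_num)
  have a52 := appellPow_eq_of_add hy0 hy (ℓ := 5) (κ := 5) (s := 2) (d := 1) (by norm_num)
    (by norm_num) (by norm_num) (by norm_num)
  have j61 : appellPow y 5 6 1 = y ^ 2 * appellPow y 5 4 4 :=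
    mul_left_cancel₀ (pow_ne_zero 8 hy0) (by
      linear_combination appellPow_inv hy0 (ℓ := 5) (κ := 6) (κ' := 4) (s := 1) (s' := 4) rfl rfl)
  have j62 : appellPow y 5 6 2 = appellPow y 5 4 3 :=
    mul_left_cancel₀ (pow_ne_zero 10 hy0) (by
      linear_combination appellPow_inv hy0 (ℓ := 5) (κ := 6) (κ' := 4) (s := 2) (s' := 3) rfl rfl)
  have j63 : appellPow y 5 6 3 = (y ^ 2)⁻¹ * appellPow y 5 4 2 := by
    rw [eq_inv_mul_iff_mul_eq₀ (pow_ne_zero 2 hy0)]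
    exact mul_left_cancel₀ (pow_ne_zero 10 hy0) (by
      linear_combination appellPow_inv hy0 (ℓ := 5) (κ := 6) (κ' := 4) (s := 3) (s' := 2) rfl rfl)
  have j71 : appellPow y 5 7 1 = y * appellPow y 5 3 4 :=
    mul_left_cancel₀ (pow_ne_zero 9 hy0) (by
      linear_combination appellPow_inv hy0 (ℓ := 5) (κ := 7) (κ' := 3) (s := 1) (s' := 4) rfl rfl)
  have j72 : appellPow y 5 7 2 = y⁻¹ * appellPow y 5 3 3 := by
    rw [eq_inv_mul_iff_mul_eq₀ hy0]
    exact mul_left_cancel₀ (pow_ne_zero 10 hy0) (by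
      linear_combination appellPow_inv hy0 (ℓ := 5) (κ := 7) (κ' := 3) (s := 2) (s' := 3) rfl rfl)
  have j73 : appellPow y 5 7 3 = (y ^ 3)⁻¹ * appellPow y 5 3 2 := by
    rw [eq_inv_mul_iff_mul_eq₀ (pow_ne_zero 3 hy0)]
    exact mul_left_cancel₀ (pow_ne_zero 10 hy0) (by
      linear_combination appellPow_inv hy0 (ℓ := 5) (κ := 7) (κ' := 3) (s := 3) (s' := 2) rfl rfl)
  norm_num [t3, t4, t5, t6, t7, t8, t9, t10, hJ, e1, e2] at a32 a34 a41 a43 a44 a51 a52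
  norm_num [Finset.sum_range_succ, Nat.choose, e1, e2] at key
  rw [j61, j62, j63, j71, j72, j73, a32, a34, a41, a43, a44, a51, a52] at key
  rw [e1, e2] at hΘ
  refine mul_left_cancel₀ hΘ (key.trans ?_)
  have g1 : (-g + -1) * (-g + -1) = 2 + g := by linear_combination hg2
  have g2 : (-g + -1) * (1 + g) = -(2 + g) := by linear_combination -hg2
  rw [g1, g2]
  clear key a32 a34 a41 a43 a44 a51 a52 e1 e2
  generalize appellPow y 5 3 3 = A at *
  generalize appellPow y 5 4 2 = B at *
  generalize appellPow y 5 5 3 = C at *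
  generalize E 25 q = J at *
  generalize P 5 1 q = T at *
  generalize P 5 2 q = S at *
  subst hyq
  field_simp
  ring

/-! ### Seventh roots of unity -/

theorem thetaPow_seven {y : ℂ} (hy0 : y ≠ 0) :
    thetaPow y 7 4 = thetaPow y 7 3 ∧ thetaPow y 7 5 = thetaPow y 7 2 ∧
      thetaPow y 7 6 = thetaPow y 7 1 ∧ thetaPow y 7 7 = 0 ∧
      thetaPow y 7 8 = -y⁻¹ * thetaPow y 7 1 ∧ thetaPow y 7 9 = -(y ^ 2)⁻¹ * thetaPow y 7 2 ∧
      thetaPow y 7 10 = -(y ^ 3)⁻¹ * thetaPow y 7 3 ∧ thetaPow y 7 11 = -(y ^ 4)⁻¹ * thetaPow y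
          7 3 ∧
      thetaPow y 7 12 = -(y ^ 5)⁻¹ * thetaPow y 7 2 ∧ thetaPow y 7 13 = -(y ^ 6)⁻¹ * thetaPow y
          7 1 ∧
      thetaPow y 7 14 = 0 ∧ thetaPow y 7 15 = (y ^ 9)⁻¹ * thetaPow y 7 1 := by
  have t4 : thetaPow y 7 4 = thetaPow y 7 3 := thetaPow_refl hy0 rfl
  have t5 : thetaPow y 7 5 = thetaPow y 7 2 := thetaPow_refl hy0 rfl
  have t6 : thetaPow y 7 6 = thetaPow y 7 1 := thetaPow_refl hy0 rfl
  have t7 : thetaPow y 7 7 = 0 := by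
    rw [show 7 = 7 + 0 from rfl, thetaPow_add hy0, thetaPow_zero hy0, mul_zero]
  have t8 : thetaPow y 7 8 = -y⁻¹ * thetaPow y 7 1 := by
    simpa using thetaPow_add (ℓ := 7) hy0 1
  refine ⟨t4, t5, t6, t7, t8, thetaPow_add hy0 2, thetaPow_add hy0 3, ?_, ?_, ?_, ?_, ?_⟩
  · rw [← t4]; exact thetaPow_add hy0 4
  · rw [← t5]; exact thetaPow_add hy0 5
  · rw [← t6]; exact thetaPow_add hy0 6
  · rw [show 14 = 7 + 7 from rfl, thetaPow_add hy0, t7, mul_zero]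
  · rw [show 15 = 7 + 8 from rfl, thetaPow_add hy0, t8]
    field_simp

theorem inv_eq_pow_six {ζ : ℂ} (hζ : IsPrimitiveRoot ζ 7) : ζ⁻¹ = ζ ^ 6 :=
  inv_eq_of_mul_eq_one_right (by rw [← pow_succ', hζ.pow_eq_one])

theorem cubic_seven {ζ : ℂ} (hζ : IsPrimitiveRoot ζ 7) :
    (ζ + ζ ^ 6) ^ 3 + (ζ + ζ ^ 6) ^ 2 - 2 * (ζ + ζ ^ 6) - 1 = 0 := by
  have h7 : 1 + ζ + ζ ^ 2 + ζ ^ 3 + ζ ^ 4 + ζ ^ 5 + ζ ^ 6 = 0 := by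
    have := hζ.geom_sum_eq_zero (by norm_num)
    simpa [Finset.sum_range_succ] using this
  -- The multiplier is the quotient of the left side, as a polynomial in ζ, by the seventh
  -- cyclotomic polynomial.
  linear_combination ((-1) + (-1) * ζ + (3) * ζ ^ 2 + (-1) * ζ ^ 4 + (-2) * ζ ^ 6 + (3) * ζ ^ 7
      + (-1) * ζ ^ 11 + ζ ^ 12) * h7

theorem theta_seven {q ζ : ℂ} (hq0 : q ≠ 0) (hq : ‖q‖ < 1) (hζ : IsPrimitiveRoot ζ 7) {g : ℂ}
    (hg : g = ζ + ζ ^ 6) :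
    theta ζ q = (1 - ζ) * (thetaPow (q ^ 7) 7 3 - (1 + g) * q * thetaPow (q ^ 7) 7 2 +
      (g ^ 2 + g - 1) * q ^ 3 * thetaPow (q ^ 7) 7 1) := by
  have h7 : 1 + ζ + ζ ^ 2 + ζ ^ 3 + ζ ^ 4 + ζ ^ 5 + ζ ^ 6 = 0 := by
    have := hζ.geom_sum_eq_zero (by norm_num)
    simpa [Finset.sum_range_succ] using this
  have h1 := theta_dissection hq0 hq (ℓ := 7) (h := 3) rfl hζ.pow_eq_one
  have h2 : ∀ j, theta (q ^ (7 * j)) (q ^ 7 ^ 2) = thetaPow (q ^ 7) 7 j := fun j => by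
    rw [thetaPow, ← pow_mul, ← pow_mul, pow_two]
  simp only [h2] at h1
  obtain ⟨t4, t5, t6, t7, t8, t9, -⟩ := thetaPow_seven (pow_ne_zero 7 hq0)
  norm_num [Finset.sum_range_succ, t4, t5, t6, t7, t8, t9, Nat.choose] at h1
  have e1 : q ^ 10 * (q ^ 7)⁻¹ = q ^ 3 := by field_simp
  have e2 : q ^ 15 * ((q ^ 7) ^ 2)⁻¹ = q := by field_simp
  rw [h1, hg]
  linear_combination q * thetaPow (q ^ 7) 7 2 * (1 + (-1) * ζ) * h7 +
    q ^ 3 * thetaPow (q ^ 7) 7 1 * (1 + (-3) * ζ + (2) * ζ ^ 2 + ζ ^ 5 + (-2) * ζ ^ 6 + ζ ^ 7) *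
        h7 +
    ζ ^ 5 * thetaPow (q ^ 7) 7 1 * e1 - ζ ^ 6 * thetaPow (q ^ 7) 7 2 * e2

/-- The coefficients of the partial fraction expansion for `ℓ = 7`. -/
def numSeven (g : ℂ) (s : ℕ) : ℂ :=
  if s = 1 then 1 else if s = 2 then 1 + g else if s = 3 then g + g ^ 2
    else if s = 4 then 1 + g else if s = 5 then 1 else 0

/-- The coefficients of the cofactor of a quadratic factor of `1 - x ^ 7`. -/
def cofSeven (g : ℂ) (k : ℕ) : ℂ :=
  if k = 0 then 1 else if k = 1 then g ^ 2 - 2 else if k = 2 then 2 - g - g ^ 2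
    else if k = 3 then -(2 - g - g ^ 2) else if k = 4 then -(g ^ 2 - 2) else -1

theorem rank_eq_seven {q ζ : ℂ} (hq0 : q ≠ 0) (hq : ‖q‖ < 1) (hζ : IsPrimitiveRoot ζ 7) {e : ℕ}
    (he : e = 1 ∨ e = 2) {g : ℂ} (hg : g = ζ + ζ ^ 6) :
    (thetaPow (q ^ 7) 7 3 - (1 + g) * q * thetaPow (q ^ 7) 7 2 +
      (g ^ 2 + g - 1) * q ^ 3 * thetaPow (q ^ 7) 7 1) *
      (rankFactor (ζ ^ 2) (ζ ^ (-2 : ℤ)) ζ q *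
        ∑' n : ℕ, rankTerm e (ζ ^ 2) (ζ ^ (-2 : ℤ)) ζ q (n + 1)) =
      ∑ s ∈ range 7, ∑ k ∈ range 6, (-1) ^ (s + 1) * numSeven g s * cofSeven g k *
        q ^ (s.choose 2 + (e + k) * s) * appellPow (q ^ 7) 7 (3 + (e + k)) s := by
  have hζ0 := hζ.ne_zero (by norm_num)
  have h7 : 1 + ζ + ζ ^ 2 + ζ ^ 3 + ζ ^ 4 + ζ ^ 5 + ζ ^ 6 = 0 := by
    have := hζ.geom_sum_eq_zero (by norm_num)
    simpa [Finset.sum_range_succ] using this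
  have hg3 : g ^ 3 + g ^ 2 - 2 * g - 1 = 0 := by rw [hg]; exact cubic_seven hζ
  refine rank_eq hq0 hq (ℓ := 7) (h := 3) rfl three_ne_zero hζ he 6 (c := cofSeven g)
    (t := numSeven g) (fun x => ?_) (fun s hs => ?_) (theta_seven hq0 hq hζ hg)
  -- The square of g = ζ + ζ⁻¹ determines the quadratic factor; `cofSeven` is its cofactor in 1 - x⁷
  -- modulo the cubic for g.
  · have hρ : ζ ^ 2 + (ζ ^ 2)⁻¹ = g ^ 2 - 2 := by
      rw [← inv_pow, inv_eq_pow_six hζ, hg]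
      linear_combination ((2) + (-2) * ζ) * h7
    have h1 : (1 - ζ ^ 2 * x) * (1 - (ζ ^ 2)⁻¹ * x) = 1 - (g ^ 2 - 2) * x + x ^ 2 := by
      have h2 : ζ ^ 2 * (ζ ^ 2)⁻¹ = 1 := mul_inv_cancel₀ (pow_ne_zero 2 hζ0)
      linear_combination (-x) * hρ + x ^ 2 * h2
    rw [h1]
    norm_num [Finset.sum_range_succ, cofSeven]
    linear_combination ((1 + (-1) * g) * x ^ 2 + (g) * x ^ 3 + ((-1) * g) * x ^ 4 + ((-1) + g) *
        x ^ 5) * hg3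
  · have hs' : s < 7 := Finset.mem_range.1 hs
    rw [zpow_neg, zpow_natCast, ← inv_pow, inv_eq_pow_six hζ]
    interval_cases s
    · change (ζ ^ 6) ^ 0 + ζ * ζ ^ 0 - 1 - ζ = -((1 - ζ) * (1 - ζ ^ 6) * (1 + ζ)) * (0)
      linear_combination 0 * h7
    · change (ζ ^ 6) ^ 1 + ζ * ζ ^ 1 - 1 - ζ = -((1 - ζ) * (1 - ζ ^ 6) * (1 + ζ)) * (1)
      linear_combination ((-1) * ζ + ζ ^ 2) * h7
    · change (ζ ^ 6) ^ 2 + ζ * ζ ^ 2 - 1 - ζ = -((1 - ζ) * (1 - ζ ^ 6) * (1 + ζ)) * (1 + g)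
      rw [hg]
      linear_combination ((-1) * ζ ^ 2 + ζ ^ 3 + (-1) * ζ ^ 7 + ζ ^ 8) * h7
    · change (ζ ^ 6) ^ 3 + ζ * ζ ^ 3 - 1 - ζ = -((1 - ζ) * (1 - ζ ^ 6) * (1 + ζ)) * (g + g ^ 2)
      rw [hg]
      linear_combination ((-1) + ζ + ζ ^ 2 + (-2) * ζ ^ 3 + ζ ^ 4 + ζ ^ 6 + (-1) * ζ ^ 7 + (-2)
          * ζ ^ 8 + (2) * ζ ^ 9 + (-1) * ζ ^ 13 + ζ ^ 14) * h7
    · change (ζ ^ 6) ^ 4 + ζ * ζ ^ 4 - 1 - ζ = -((1 - ζ) * (1 - ζ ^ 6) * (1 + ζ)) * (1 + g)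
      rw [hg]
      linear_combination ((-1) * ζ ^ 2 + ζ ^ 4 + ζ ^ 5 + (-1) * ζ ^ 6 + (-1) * ζ ^ 7 + ζ ^ 8 +
          (-1) * ζ ^ 10 + ζ ^ 11 + (-1) * ζ ^ 17 + ζ ^ 18) * h7
    · change (ζ ^ 6) ^ 5 + ζ * ζ ^ 5 - 1 - ζ = -((1 - ζ) * (1 - ζ ^ 6) * (1 + ζ)) * (1)
      linear_combination ((-1) * ζ + ζ ^ 3 + (-1) * ζ ^ 9 + ζ ^ 10 + (-1) * ζ ^ 16 + ζ ^ 17 +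
          (-1) * ζ ^ 23 + ζ ^ 24) * h7
    · change (ζ ^ 6) ^ 6 + ζ * ζ ^ 6 - 1 - ζ = -((1 - ζ) * (1 - ζ ^ 6) * (1 + ζ)) * (0)
      linear_combination ((-1) + ζ ^ 2 + (-1) * ζ ^ 8 + ζ ^ 9 + (-1) * ζ ^ 15 + ζ ^ 16 + (-1) *
          ζ ^ 22 + ζ ^ 23 + (-1) * ζ ^ 29 + ζ ^ 30) * h7

/-- The three-term relation at y, y², y³ with c = 1; once indices are reduced to 1, 2, 3, each of
its terms is a monomial of degree four. This is a form of Klein's quartic. -/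
theorem thetaPow_seven_relation {y : ℂ} (hy0 : y ≠ 0) (hy : ‖y‖ < 1) :
    thetaPow y 7 1 * thetaPow y 7 3 ^ 3 + y * thetaPow y 7 1 ^ 3 * thetaPow y 7 2 =
      thetaPow y 7 2 ^ 3 * thetaPow y 7 3 := by
  have h7 : y ^ 7 ≠ 0 := pow_ne_zero 7 hy0
  have hp : ∀ k ≠ 0, y ^ k ≠ 1 := fun k hk h => by
    have := norm_pow_lt_one' hy hk
    rw [h, norm_one] at this
    exact lt_irrefl _ this
  have hn : ∀ s : ℤ, ¬ (7 : ℤ) ∣ s → ∀ n : ℤ, 1 - y ^ s * (y ^ 7) ^ n ≠ 0 := fun s hs =>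
    one_sub_pow_mul_zpow_ne_zero (ℓ := 7) hy0 hy (by exact_mod_cast hs)
  have key := theta_three_term (q := y ^ 7) (a₀ := y) (a₁ := y ^ 2) (a₂ := y ^ 3) (c := 1) h7
    (norm_pow_lt_one' hy (by norm_num)) hy0 (pow_ne_zero 2 hy0) (pow_ne_zero 3 hy0) one_ne_zero
    (fun n => by simpa using hn 1 (by norm_num) n) (fun n => by simpa using hn (-1) (by norm_num) n)
    (hp 2 (by norm_num)) (fun n => by simpa using hn 2 (by norm_num) n)
    (fun n => by simpa [zpow_neg] using hn (-2) (by norm_num) n)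
    (by rw [← pow_mul]; exact hp _ (by norm_num)) (fun n => by simpa using hn 3 (by norm_num) n)
    (fun n => by simpa [zpow_neg] using hn (-3) (by norm_num) n)
    (by rw [← pow_mul]; exact hp _ (by norm_num))
  obtain ⟨t4, t5, -⟩ := thetaPow_seven hy0
  have e1 : y ^ 2 / y = y ^ 1 := by field_simp
  have e2 : y ^ 3 / y ^ 2 = y ^ 1 := by field_simp
  have e3 : y / y ^ 3 = (y ^ 2)⁻¹ := by field_simp
  have e4 : y * y ^ 2 = y ^ 3 := by ring
  have e5 : y ^ 2 * y ^ 3 = y ^ 5 := by ring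
  have e6 : y ^ 3 * y = y ^ 4 := by ring
  have e7 : theta y (y ^ 7) = thetaPow y 7 1 := by rw [thetaPow, pow_one]
  have e8 : ∀ j, theta (y ^ j) (y ^ 7) = thetaPow y 7 j := fun _ => rfl
  rw [e1, e2, e3, e4, e5, e6, theta_inv h7 (pow_ne_zero 2 hy0)] at key
  simp only [one_mul, e7, e8, t4, t5] at key
  have e9 : y ^ 3 * (y ^ 2)⁻¹ = y := by field_simp
  refine mul_left_cancel₀ hy0 ?_
  linear_combination key + thetaPow y 7 2 * thetaPow y 7 3 * thetaPow y 7 2 ^ 2 * e9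

/-- For κ = 4 the anchor is s = 1, which will cancel. In the lemmas for κ = 5, 6, 7 the anchor is s
= 3, which gives the three Lambert series of the final formula. -/
theorem appellPow_seven_four {y : ℂ} (hy0 : y ≠ 0) (hy : ‖y‖ < 1) :
    appellPow y 7 4 2 = thetaPow y 7 1 * appellPow y 7 4 1 / (thetaPow y 7 2) ∧
    appellPow y 7 4 3 = qPochInf (y ^ 7) (y ^ 7) ^ 3 / (thetaPow y 7 3) ∧
    appellPow y 7 4 4 = -(thetaPow y 7 1 * appellPow y 7 4 1 / (y * thetaPow y 7 2)) + qPochInf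
        (y ^ 7) (y ^ 7) ^ 3 / (y * thetaPow y 7 1) ∧
    appellPow y 7 4 5 = -(appellPow y 7 4 1 / (y ^ 2)) + thetaPow y 7 3 ^ 2 * qPochInf (y ^ 7)
        (y ^ 7) ^ 3 / (y ^ 2 * thetaPow y 7 1 * thetaPow y 7 2 ^ 2) := by
  have n1 : thetaPow y 7 1 ≠ 0 := thetaPow_ne_zero hy0 hy (by norm_num) (by norm_num)
  have n2 : thetaPow y 7 2 ≠ 0 := thetaPow_ne_zero hy0 hy (by norm_num) (by norm_num)
  have n3 : thetaPow y 7 3 ≠ 0 := thetaPow_ne_zero hy0 hy (by norm_num) (by norm_num)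
  obtain ⟨t4, t5, t6, t7, t8, t9, t10, t11, t12, t13, t14, t15⟩ := thetaPow_seven hy0
  refine ⟨?_, ?_, ?_, ?_⟩
  · refine (appellPow_add_eq hy0 hy (ℓ := 7) (κ := 4) (s := 1) (d := 1)
      (by norm_num) (by norm_num) (by norm_num) (by norm_num)).trans ?_
    norm_num only [t4, t5, t6, t7, t8, t9, t10, t11, t12, t13, t14, t15]
    field_simp
    ring
  · refine (appellPow_add_eq hy0 hy (ℓ := 7) (κ := 4) (s := 1) (d := 2)
      (by norm_num) (by norm_num) (by norm_num) (by norm_num)).trans ?_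
    norm_num only [t4, t5, t6, t7, t8, t9, t10, t11, t12, t13, t14, t15]
    field_simp
    ring
  · refine (appellPow_add_eq hy0 hy (ℓ := 7) (κ := 4) (s := 1) (d := 3)
      (by norm_num) (by norm_num) (by norm_num) (by norm_num)).trans ?_
    norm_num only [t4, t5, t6, t7, t8, t9, t10, t11, t12, t13, t14, t15]
    field_simp
    ring
  · refine (appellPow_add_eq hy0 hy (ℓ := 7) (κ := 4) (s := 1) (d := 4)
      (by norm_num) (by norm_num) (by norm_num) (by norm_num)).trans ?_
    norm_num only [t4, t5, t6, t7, t8, t9, t10, t11, t12, t13, t14, t15]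
    field_simp
    ring

theorem appellPow_seven_five {y : ℂ} (hy0 : y ≠ 0) (hy : ‖y‖ < 1) :
    appellPow y 7 5 1 = -(y * appellPow y 7 5 3) + thetaPow y 7 2 ^ 2 * qPochInf (y ^ 7) (y ^ 7)
        ^ 3 / (thetaPow y 7 1 ^ 2 * thetaPow y 7 3) ∧
    appellPow y 7 5 2 = qPochInf (y ^ 7) (y ^ 7) ^ 3 / (thetaPow y 7 2) ∧
    appellPow y 7 5 4 = thetaPow y 7 2 * appellPow y 7 5 3 / (y * thetaPow y 7 1) - thetaPow y 7
        2 * qPochInf (y ^ 7) (y ^ 7) ^ 3 / (y * thetaPow y 7 3 ^ 2) ∧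
    appellPow y 7 5 5 = thetaPow y 7 3 * appellPow y 7 5 3 / (y ^ 2 * thetaPow y 7 1) - qPochInf
        (y ^ 7) (y ^ 7) ^ 3 / (y ^ 2 * thetaPow y 7 3) ∧
    appellPow y 7 5 6 = thetaPow y 7 3 * appellPow y 7 5 3 / (y ^ 3 * thetaPow y 7 1) := by
  have n1 : thetaPow y 7 1 ≠ 0 := thetaPow_ne_zero hy0 hy (by norm_num) (by norm_num)
  have n2 : thetaPow y 7 2 ≠ 0 := thetaPow_ne_zero hy0 hy (by norm_num) (by norm_num)
  have n3 : thetaPow y 7 3 ≠ 0 := thetaPow_ne_zero hy0 hy (by norm_num) (by norm_num)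
  obtain ⟨t4, t5, t6, t7, t8, t9, t10, t11, t12, t13, t14, t15⟩ := thetaPow_seven hy0
  refine ⟨?_, ?_, ?_, ?_, ?_⟩
  · refine (appellPow_eq_of_add hy0 hy (ℓ := 7) (κ := 5) (s := 1) (d := 2)
      (by norm_num) (by norm_num) (by norm_num) (by norm_num)).trans ?_
    norm_num only [t4, t5, t6, t7, t8, t9, t10, t11, t12, t13, t14, t15]
    field_simp
    ring
  · refine (appellPow_eq_of_add hy0 hy (ℓ := 7) (κ := 5) (s := 2) (d := 1)
      (by norm_num) (by norm_num) (by norm_num) (by norm_num)).trans ?_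
    norm_num only [t4, t5, t6, t7, t8, t9, t10, t11, t12, t13, t14, t15]
    field_simp
    ring
  · refine (appellPow_add_eq hy0 hy (ℓ := 7) (κ := 5) (s := 3) (d := 1)
      (by norm_num) (by norm_num) (by norm_num) (by norm_num)).trans ?_
    norm_num only [t4, t5, t6, t7, t8, t9, t10, t11, t12, t13, t14, t15]
    field_simp
    ring
  · refine (appellPow_add_eq hy0 hy (ℓ := 7) (κ := 5) (s := 3) (d := 2)
      (by norm_num) (by norm_num) (by norm_num) (by norm_num)).trans ?_
    norm_num only [t4, t5, t6, t7, t8, t9, t10, t11, t12, t13, t14, t15]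
    field_simp
    ring
  · refine (appellPow_add_eq hy0 hy (ℓ := 7) (κ := 5) (s := 3) (d := 3)
      (by norm_num) (by norm_num) (by norm_num) (by norm_num)).trans ?_
    norm_num only [t4, t5, t6, t7, t8, t9, t10, t11, t12, t13, t14, t15]
    field_simp
    ring

theorem appellPow_seven_six {y : ℂ} (hy0 : y ≠ 0) (hy : ‖y‖ < 1) :
    appellPow y 7 6 1 = qPochInf (y ^ 7) (y ^ 7) ^ 3 / (thetaPow y 7 1) ∧
    appellPow y 7 6 2 = y * thetaPow y 7 1 * appellPow y 7 6 3 / (thetaPow y 7 2) + thetaPow y 7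
        1 * qPochInf (y ^ 7) (y ^ 7) ^ 3 / (thetaPow y 7 2 ^ 2) ∧
    appellPow y 7 6 4 = thetaPow y 7 3 * appellPow y 7 6 3 / (y * thetaPow y 7 2) - thetaPow y 7
        1 ^ 2 * qPochInf (y ^ 7) (y ^ 7) ^ 3 / (y * thetaPow y 7 2 * thetaPow y 7 3 ^ 2) ∧
    appellPow y 7 6 5 = thetaPow y 7 3 * appellPow y 7 6 3 / (y ^ 2 * thetaPow y 7 2) ∧
    appellPow y 7 6 6 = appellPow y 7 6 3 / (y ^ 3) + qPochInf (y ^ 7) (y ^ 7) ^ 3 / (y ^ 4 *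
        thetaPow y 7 2) := by
  have n1 : thetaPow y 7 1 ≠ 0 := thetaPow_ne_zero hy0 hy (by norm_num) (by norm_num)
  have n2 : thetaPow y 7 2 ≠ 0 := thetaPow_ne_zero hy0 hy (by norm_num) (by norm_num)
  have n3 : thetaPow y 7 3 ≠ 0 := thetaPow_ne_zero hy0 hy (by norm_num) (by norm_num)
  obtain ⟨t4, t5, t6, t7, t8, t9, t10, t11, t12, t13, t14, t15⟩ := thetaPow_seven hy0
  refine ⟨?_, ?_, ?_, ?_, ?_⟩
  · refine (appellPow_eq_of_add hy0 hy (ℓ := 7) (κ := 6) (s := 1) (d := 2)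
      (by norm_num) (by norm_num) (by norm_num) (by norm_num)).trans ?_
    norm_num only [t4, t5, t6, t7, t8, t9, t10, t11, t12, t13, t14, t15]
    field_simp
    ring
  · refine (appellPow_eq_of_add hy0 hy (ℓ := 7) (κ := 6) (s := 2) (d := 1)
      (by norm_num) (by norm_num) (by norm_num) (by norm_num)).trans ?_
    norm_num only [t4, t5, t6, t7, t8, t9, t10, t11, t12, t13, t14, t15]
    field_simp
    ring
  · refine (appellPow_add_eq hy0 hy (ℓ := 7) (κ := 6) (s := 3) (d := 1)
      (by norm_num) (by norm_num) (by norm_num) (by norm_num)).trans ?_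
    norm_num only [t4, t5, t6, t7, t8, t9, t10, t11, t12, t13, t14, t15]
    field_simp
    ring
  · refine (appellPow_add_eq hy0 hy (ℓ := 7) (κ := 6) (s := 3) (d := 2)
      (by norm_num) (by norm_num) (by norm_num) (by norm_num)).trans ?_
    norm_num only [t4, t5, t6, t7, t8, t9, t10, t11, t12, t13, t14, t15]
    field_simp
    ring
  · refine (appellPow_add_eq hy0 hy (ℓ := 7) (κ := 6) (s := 3) (d := 3)
      (by norm_num) (by norm_num) (by norm_num) (by norm_num)).trans ?_
    norm_num only [t4, t5, t6, t7, t8, t9, t10, t11, t12, t13, t14, t15]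
    field_simp
    ring

theorem appellPow_seven_seven {y : ℂ} (hy0 : y ≠ 0) (hy : ‖y‖ < 1) :
    appellPow y 7 7 1 = y ^ 2 * thetaPow y 7 1 * appellPow y 7 7 3 / (thetaPow y 7 3) + thetaPow
        y 7 2 * qPochInf (y ^ 7) (y ^ 7) ^ 3 / (thetaPow y 7 1 * thetaPow y 7 3) ∧
    appellPow y 7 7 2 = y * thetaPow y 7 2 * appellPow y 7 7 3 / (thetaPow y 7 3) + thetaPow y 7
        1 * qPochInf (y ^ 7) (y ^ 7) ^ 3 / (thetaPow y 7 3 ^ 2) ∧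
    appellPow y 7 7 4 = appellPow y 7 7 3 / y ∧
    appellPow y 7 7 5 = thetaPow y 7 2 * appellPow y 7 7 3 / (y ^ 2 * thetaPow y 7 3) + thetaPow
        y 7 1 * qPochInf (y ^ 7) (y ^ 7) ^ 3 / (y ^ 3 * thetaPow y 7 3 ^ 2) := by
  have n1 : thetaPow y 7 1 ≠ 0 := thetaPow_ne_zero hy0 hy (by norm_num) (by norm_num)
  have n2 : thetaPow y 7 2 ≠ 0 := thetaPow_ne_zero hy0 hy (by norm_num) (by norm_num)
  have n3 : thetaPow y 7 3 ≠ 0 := thetaPow_ne_zero hy0 hy (by norm_num) (by norm_num)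
  obtain ⟨t4, t5, t6, t7, t8, t9, t10, t11, t12, t13, t14, t15⟩ := thetaPow_seven hy0
  refine ⟨?_, ?_, ?_, ?_⟩
  · refine (appellPow_eq_of_add hy0 hy (ℓ := 7) (κ := 7) (s := 1) (d := 2)
      (by norm_num) (by norm_num) (by norm_num) (by norm_num)).trans ?_
    norm_num only [t4, t5, t6, t7, t8, t9, t10, t11, t12, t13, t14, t15]
    field_simp
    ring
  · refine (appellPow_eq_of_add hy0 hy (ℓ := 7) (κ := 7) (s := 2) (d := 1)
      (by norm_num) (by norm_num) (by norm_num) (by norm_num)).trans ?_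
    norm_num only [t4, t5, t6, t7, t8, t9, t10, t11, t12, t13, t14, t15]
    field_simp
    ring
  · refine (appellPow_add_eq hy0 hy (ℓ := 7) (κ := 7) (s := 3) (d := 1)
      (by norm_num) (by norm_num) (by norm_num) (by norm_num)).trans ?_
    norm_num only [t4, t5, t6, t7, t8, t9, t10, t11, t12, t13, t14, t15]
    field_simp
    ring
  · refine (appellPow_add_eq hy0 hy (ℓ := 7) (κ := 7) (s := 3) (d := 2)
      (by norm_num) (by norm_num) (by norm_num) (by norm_num)).trans ?_
    norm_num only [t4, t5, t6, t7, t8, t9, t10, t11, t12, t13, t14, t15]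
    field_simp
    ring

/-- The constant term in the comparison of `RU_seven_expand` with the closed formula;
the last terms vanish by the three-term relation. -/
theorem rank_seven_coeff_zero {q J P₁ P₂ P₃ : ℂ} (A B C D : ℂ) (hq0 : q ≠ 0) (hJ : J ≠ 0)
    (h1 : P₁ ≠ 0) (h2 : P₂ ≠ 0) (h3 : P₃ ≠ 0) :
      (q ^ 1 * (A)) + (-2) * (q ^ 2 * (-((q ^ 7) * B) + (J * P₂) ^ 2 * J ^ 3 / ((J * P₁) ^
      2 * (J * P₃)))) + (2) * (q ^ 3 * (J ^ 3 / ((J * P₁)))) + (-2) * (q ^ 4 * ((q ^ 7) ^ 2 * (J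
      * P₁) * D / ((J * P₃)) + (J * P₂) * J ^ 3 / ((J * P₁) * (J * P₃)))) + (2) * (q ^ 5 * ((q ^
      7) * C + J ^ 3 / ((J * P₂)))) + (-1) * (q ^ 6 * ((J * P₃) * B / ((J * P₁)))) + (-1) * (q ^
      3 * ((J * P₁) * A / ((J * P₂)))) + (q ^ 5 * (J ^ 3 / ((J * P₂)))) + (-1) * (q ^ 7 *
      ((q ^ 7) * (J * P₁) * C / ((J * P₂)) + (J * P₁) * J ^ 3 / ((J * P₂) ^ 2))) + (q ^ 9
      * ((q ^ 7) * (J * P₂) * D / ((J * P₃)) + (J * P₁) * J ^ 3 / ((J * P₃) ^ 2))) + (-1) * (q ^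
      11 * ((J * P₃) * C / ((J * P₂)))) + (q ^ 13 * ((J * P₃) * B / ((q ^ 7) * (J * P₁)) -
      J ^ 3 / ((q ^ 7) * (J * P₃)))) + (-1) * (q ^ 12 * (C)) + (q ^ 15 * (D)) + (-1) * (q
      ^ 10 * (-((J * P₁) * A / ((q ^ 7) * (J * P₂))) + J ^ 3 / ((q ^ 7) * (J * P₁)))) + (q
      ^ 14 * ((J * P₂) * B / ((q ^ 7) * (J * P₁)) - (J * P₂) * J ^ 3 / ((q ^ 7) * (J * P₃) ^
      2))) + (-1) * (q ^ 18 * ((J * P₃) * C / ((q ^ 7) * (J * P₂)) - (J * P₁) ^ 2 * J ^ 3 / ((q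
      ^ 7) * (J * P₂) * (J * P₃) ^ 2))) + (q ^ 22 * (D / ((q ^ 7)))) + (-1) * (q ^ 26 * (C
      / ((q ^ 7) ^ 2))) + (q ^ 30 * (B / ((q ^ 7) ^ 3))) + (q ^ 15 * (-(A / ((q ^ 7)
      ^ 2)) + (J * P₃) ^ 2 * J ^ 3 / ((q ^ 7) ^ 2 * (J * P₁) * (J * P₂) ^ 2))) + (-2) * (q ^ 20
      * ((J * P₃) * B / ((q ^ 7) ^ 2 * (J * P₁)) - J ^ 3 / ((q ^ 7) ^ 2 * (J * P₃)))) + (2) * (q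
      ^ 25 * ((J * P₃) * C / ((q ^ 7) ^ 2 * (J * P₂)))) + (-2) * (q ^ 30 * ((J * P₂) * D / ((q ^
      7) ^ 2 * (J * P₃)) + (J * P₁) * J ^ 3 / ((q ^ 7) ^ 3 * (J * P₃) ^ 2))) + (2) * (q ^ 35 *
      ((J * P₁) * C / ((q ^ 7) ^ 3 * (J * P₂)) + (J * P₁) * J ^ 3 / ((q ^ 7) ^ 4 * (J * P₂) ^
      2))) + (-1) * (q ^ 40 * (J ^ 3 / ((q ^ 7) ^ 5 * (J * P₂)))) =
      (J * P₃ - q * (J * P₂) - q ^ 3 * (J * P₁)) * (q * (J * P₃ / (P₁ * P₂ ^ 2)) + 2 * (q ^ 15 /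
      (J * P₃)) * D - q ^ 2 * (J / (P₁ * P₂)) + q ^ 3 * (J / (P₁ * P₃)) + 2 * q ^ 6 * (J / P₃ ^
      2) - 2 * (q ^ 6 / (J * P₁)) * B) + ((-q * (J * P₂) + q ^ 3 * (J * P₁)) * (-(q ^ 15 / (J *
      P₃)) * D + q ^ 2 * (J / (P₁ * P₂)) - q ^ 6 * (J / P₃ ^ 2) + q ^ 6 / (J * P₁) * B) + (q ^ 3
      * (J * P₁)) * (q ^ 2 * (J / (P₁ * P₂)) + q ^ 4 * (J / P₂ ^ 2) + q ^ 11 / (J * P₂) * C - q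
      ^ 6 * (J / P₃ ^ 2) + q ^ 6 / (J * P₁) * B)) - (q ^ 3 * (J * P₁)) * (-(q ^ 15 / (J * P₃)) *
      D + q ^ 2 * (J / (P₁ * P₂)) - q ^ 6 * (J / P₃ ^ 2) + q ^ 6 / (J * P₁) * B) - 2 * (J ^ 2 *
      q ^ 2 * (P₂ ^ 3 * P₃ - P₁ * P₃ ^ 3 - q ^ 7 * P₁ ^ 3 * P₂) / (P₁ ^ 2 * P₂ * P₃ ^ 2)) - (J ^
      2 * q ^ 4 * (P₂ ^ 3 * P₃ - P₁ * P₃ ^ 3 - q ^ 7 * P₁ ^ 3 * P₂) / (P₁ * P₂ ^ 2 * P₃ ^ 2)) := by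
  field_simp
  ring

/-- The coefficient of `g` in the comparison of `RU_seven_expand` with the closed formula;
the last terms vanish by the three-term relation. -/
theorem rank_seven_coeff_one {q J P₁ P₂ P₃ : ℂ} (A B C D : ℂ) (hq0 : q ≠ 0) (hJ : J ≠ 0)
    (h1 : P₁ ≠ 0) (h2 : P₂ ≠ 0) (h3 : P₃ ≠ 0) :
      (-1) * (q ^ 3 * (J ^ 3 / ((J * P₁)))) + (q ^ 4 * ((q ^ 7) ^ 2 * (J * P₁) * D / ((J *
      P₃)) + (J * P₂) * J ^ 3 / ((J * P₁) * (J * P₃)))) + (-1) * (q ^ 3 * ((J * P₁) * A / ((J *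
      P₂)))) + (q ^ 7 * ((q ^ 7) * (J * P₁) * C / ((J * P₂)) + (J * P₁) * J ^ 3 / ((J *
      P₂) ^ 2))) + (-1) * (q ^ 9 * ((q ^ 7) * (J * P₂) * D / ((J * P₃)) + (J * P₁) * J ^ 3 / ((J
      * P₃) ^ 2))) + (q ^ 13 * ((J * P₃) * B / ((q ^ 7) * (J * P₁)) - J ^ 3 / ((q ^ 7) *
      (J * P₃)))) + (q ^ 6 * (J ^ 3 / ((J * P₃)))) + (-1) * (q ^ 9 * (B)) + (-1) * (q ^ 12
      * (C)) + (q ^ 15 * (D)) + (q ^ 18 * ((J * P₃) * C / ((q ^ 7) * (J * P₂)) - (J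
      * P₁) ^ 2 * J ^ 3 / ((q ^ 7) * (J * P₂) * (J * P₃) ^ 2))) + (-1) * (q ^ 21 * ((J * P₂) * B
      / ((q ^ 7) ^ 2 * (J * P₁)) - (J * P₂) * J ^ 3 / ((q ^ 7) ^ 2 * (J * P₃) ^ 2))) + (-1) * (q
      ^ 10 * (-((J * P₁) * A / ((q ^ 7) * (J * P₂))) + J ^ 3 / ((q ^ 7) * (J * P₁)))) + (q
      ^ 18 * ((J * P₃) * C / ((q ^ 7) * (J * P₂)) - (J * P₁) ^ 2 * J ^ 3 / ((q ^ 7) * (J * P₂) *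
      (J * P₃) ^ 2))) + (-1) * (q ^ 22 * (D / ((q ^ 7)))) + (q ^ 30 * (B / ((q ^ 7) ^ 3)))
      + (-1) * (q ^ 25 * ((J * P₃) * C / ((q ^ 7) ^ 2 * (J * P₂)))) + (q ^ 30 * ((J * P₂)
      * D / ((q ^ 7) ^ 2 * (J * P₃)) + (J * P₁) * J ^ 3 / ((q ^ 7) ^ 3 * (J * P₃) ^ 2))) =
      (J * P₃ - q * (J * P₂) - q ^ 3 * (J * P₁)) * (q ^ 2 * (J / (P₁ * P₂)) + q ^ 4 * (J / P₂ ^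
      2) + q ^ 11 / (J * P₂) * C - q ^ 6 * (J / P₃ ^ 2) + q ^ 6 / (J * P₁) * B) + (-q * (J * P₂)
      + q ^ 3 * (J * P₁)) * (q * (J * P₃ / (P₁ * P₂ ^ 2)) + 2 * (q ^ 15 / (J * P₃)) * D - q ^ 2
      * (J / (P₁ * P₂)) + q ^ 3 * (J / (P₁ * P₃)) + 2 * q ^ 6 * (J / P₃ ^ 2) - 2 * (q ^ 6 / (J *
      P₁)) * B) + 2 * ((-q * (J * P₂) + q ^ 3 * (J * P₁)) * (-(q ^ 15 / (J * P₃)) * D + q ^ 2 *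
      (J / (P₁ * P₂)) - q ^ 6 * (J / P₃ ^ 2) + q ^ 6 / (J * P₁) * B) + (q ^ 3 * (J * P₁)) * (q ^
      2 * (J / (P₁ * P₂)) + q ^ 4 * (J / P₂ ^ 2) + q ^ 11 / (J * P₂) * C - q ^ 6 * (J / P₃ ^ 2)
      + q ^ 6 / (J * P₁) * B)) - (q ^ 3 * (J * P₁)) * (-(q ^ 15 / (J * P₃)) * D + q ^ 2 * (J /
      (P₁ * P₂)) - q ^ 6 * (J / P₃ ^ 2) + q ^ 6 / (J * P₁) * B) + 2 * (J ^ 2 * q ^ 4 * (P₂ ^ 3 *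
      P₃ - P₁ * P₃ ^ 3 - q ^ 7 * P₁ ^ 3 * P₂) / (P₁ * P₂ ^ 2 * P₃ ^ 2)) := by
  field_simp
  ring

/-- The coefficient of `g ^ 2` in the comparison of `RU_seven_expand` with the closed formula;
the last terms vanish by the three-term relation. -/
theorem rank_seven_coeff_two {q J P₁ P₂ P₃ : ℂ} (B C D : ℂ) (hq0 : q ≠ 0) (hJ : J ≠ 0)
    (h1 : P₁ ≠ 0) (h2 : P₂ ≠ 0) (h3 : P₃ ≠ 0) :
      (q ^ 2 * (-((q ^ 7) * B) + (J * P₂) ^ 2 * J ^ 3 / ((J * P₁) ^ 2 * (J * P₃)))) + (-1)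
      * (q ^ 3 * (J ^ 3 / ((J * P₁)))) + (q ^ 4 * ((q ^ 7) ^ 2 * (J * P₁) * D / ((J * P₃))
      + (J * P₂) * J ^ 3 / ((J * P₁) * (J * P₃)))) + (-1) * (q ^ 5 * ((q ^ 7) * C + J ^ 3 / ((J
      * P₂)))) + (q ^ 7 * ((q ^ 7) * (J * P₁) * C / ((J * P₂)) + (J * P₁) * J ^ 3 / ((J *
      P₂) ^ 2))) + (-1) * (q ^ 9 * ((q ^ 7) * (J * P₂) * D / ((J * P₃)) + (J * P₁) * J ^ 3 / ((J
      * P₃) ^ 2))) + (q ^ 6 * (J ^ 3 / ((J * P₃)))) + (-1) * (q ^ 21 * ((J * P₂) * B / ((q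
      ^ 7) ^ 2 * (J * P₁)) - (J * P₂) * J ^ 3 / ((q ^ 7) ^ 2 * (J * P₃) ^ 2))) + (q ^ 18 *
      ((J * P₃) * C / ((q ^ 7) * (J * P₂)) - (J * P₁) ^ 2 * J ^ 3 / ((q ^ 7) * (J * P₂) * (J *
      P₃) ^ 2))) + (-1) * (q ^ 22 * (D / ((q ^ 7)))) + (q ^ 20 * ((J * P₃) * B / ((q ^ 7)
      ^ 2 * (J * P₁)) - J ^ 3 / ((q ^ 7) ^ 2 * (J * P₃)))) + (-1) * (q ^ 25 * ((J * P₃) * C /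
      ((q ^ 7) ^ 2 * (J * P₂)))) + (q ^ 30 * ((J * P₂) * D / ((q ^ 7) ^ 2 * (J * P₃)) + (J
      * P₁) * J ^ 3 / ((q ^ 7) ^ 3 * (J * P₃) ^ 2))) + (-1) * (q ^ 35 * ((J * P₁) * C / ((q ^ 7)
      ^ 3 * (J * P₂)) + (J * P₁) * J ^ 3 / ((q ^ 7) ^ 4 * (J * P₂) ^ 2))) =
      (J * P₃ - q * (J * P₂) - q ^ 3 * (J * P₁)) * (-(q ^ 15 / (J * P₃)) * D + q ^ 2 * (J / (P₁
      * P₂)) - q ^ 6 * (J / P₃ ^ 2) + q ^ 6 / (J * P₁) * B) + (-q * (J * P₂) + q ^ 3 * (J * P₁))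
      * (q ^ 2 * (J / (P₁ * P₂)) + q ^ 4 * (J / P₂ ^ 2) + q ^ 11 / (J * P₂) * C - q ^ 6 * (J /
      P₃ ^ 2) + q ^ 6 / (J * P₁) * B) + (q ^ 3 * (J * P₁)) * (q * (J * P₃ / (P₁ * P₂ ^ 2)) + 2 *
      (q ^ 15 / (J * P₃)) * D - q ^ 2 * (J / (P₁ * P₂)) + q ^ 3 * (J / (P₁ * P₃)) + 2 * q ^ 6 *
      (J / P₃ ^ 2) - 2 * (q ^ 6 / (J * P₁)) * B) - ((-q * (J * P₂) + q ^ 3 * (J * P₁)) * (-(q ^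
      15 / (J * P₃)) * D + q ^ 2 * (J / (P₁ * P₂)) - q ^ 6 * (J / P₃ ^ 2) + q ^ 6 / (J * P₁) *
      B) + (q ^ 3 * (J * P₁)) * (q ^ 2 * (J / (P₁ * P₂)) + q ^ 4 * (J / P₂ ^ 2) + q ^ 11 / (J *
      P₂) * C - q ^ 6 * (J / P₃ ^ 2) + q ^ 6 / (J * P₁) * B)) + 3 * (q ^ 3 * (J * P₁)) * (-(q ^
      15 / (J * P₃)) * D + q ^ 2 * (J / (P₁ * P₂)) - q ^ 6 * (J / P₃ ^ 2) + q ^ 6 / (J * P₁) *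
      B) + (J ^ 2 * q ^ 2 * (P₂ ^ 3 * P₃ - P₁ * P₃ ^ 3 - q ^ 7 * P₁ ^ 3 * P₂) / (P₁ ^ 2 * P₂ *
      P₃ ^ 2)) + (J ^ 2 * q ^ 4 * (P₂ ^ 3 * P₃ - P₁ * P₃ ^ 3 - q ^ 7 * P₁ ^ 3 * P₂) / (P₁ * P₂ ^
      2 * P₃ ^ 2)) := by
  field_simp
  ring

/-- The products of `numSeven` and `cofSeven` have degree up to four in g. Reducing them by the
cubic and sorting by 1, g, g² allows the final identity to be checked one coefficient at a time. -/
theorem RU_seven_expand {q ζ : ℂ} (hq0 : q ≠ 0) (hq : ‖q‖ < 1) (hζ : IsPrimitiveRoot ζ 7) {g : ℂ}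
    (hg : g = ζ + ζ ^ 6) :
    (thetaPow (q ^ 7) 7 3 - (1 + g) * q * thetaPow (q ^ 7) 7 2 +
      (g ^ 2 + g - 1) * q ^ 3 * thetaPow (q ^ 7) 7 1) * RU ζ q =
      ((q ^ 1 * appellPow (q ^ 7) 7 4 1) + (-2) * (q ^ 2 * appellPow (q ^ 7) 7 5 1) + (2)
      * (q ^ 3 * appellPow (q ^ 7) 7 6 1) + (-2) * (q ^ 4 * appellPow (q ^ 7) 7 7 1) + (2) * (q
      ^ 5 * appellPow (q ^ 7) 7 8 1) + (-1) * (q ^ 6 * appellPow (q ^ 7) 7 9 1) + (-1) * (q ^ 3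
      * appellPow (q ^ 7) 7 4 2) + (q ^ 5 * appellPow (q ^ 7) 7 5 2) + (-1) * (q ^ 7 *
      appellPow (q ^ 7) 7 6 2) + (q ^ 9 * appellPow (q ^ 7) 7 7 2) + (-1) * (q ^ 11 *
      appellPow (q ^ 7) 7 8 2) + (q ^ 13 * appellPow (q ^ 7) 7 9 2) + (-1) * (q ^ 12 *
      appellPow (q ^ 7) 7 6 3) + (q ^ 15 * appellPow (q ^ 7) 7 7 3) + (-1) * (q ^ 10 *
      appellPow (q ^ 7) 7 4 4) + (q ^ 14 * appellPow (q ^ 7) 7 5 4) + (-1) * (q ^ 18 *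
      appellPow (q ^ 7) 7 6 4) + (q ^ 22 * appellPow (q ^ 7) 7 7 4) + (-1) * (q ^ 26 *
      appellPow (q ^ 7) 7 8 4) + (q ^ 30 * appellPow (q ^ 7) 7 9 4) + (q ^ 15 *
      appellPow (q ^ 7) 7 4 5) + (-2) * (q ^ 20 * appellPow (q ^ 7) 7 5 5) + (2) * (q ^ 25 *
      appellPow (q ^ 7) 7 6 5) + (-2) * (q ^ 30 * appellPow (q ^ 7) 7 7 5) + (2) * (q ^ 35 *
      appellPow (q ^ 7) 7 8 5) + (-1) * (q ^ 40 * appellPow (q ^ 7) 7 9 5)) + g * ((-1) * (q ^ 3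
      * appellPow (q ^ 7) 7 6 1) + (q ^ 4 * appellPow (q ^ 7) 7 7 1) + (-1) * (q ^ 3 *
      appellPow (q ^ 7) 7 4 2) + (q ^ 7 * appellPow (q ^ 7) 7 6 2) + (-1) * (q ^ 9 *
      appellPow (q ^ 7) 7 7 2) + (q ^ 13 * appellPow (q ^ 7) 7 9 2) + (q ^ 6 *
      appellPow (q ^ 7) 7 4 3) + (-1) * (q ^ 9 * appellPow (q ^ 7) 7 5 3) + (-1) * (q ^ 12 *
      appellPow (q ^ 7) 7 6 3) + (q ^ 15 * appellPow (q ^ 7) 7 7 3) + (q ^ 18 *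
      appellPow (q ^ 7) 7 8 3) + (-1) * (q ^ 21 * appellPow (q ^ 7) 7 9 3) + (-1) * (q ^ 10 *
      appellPow (q ^ 7) 7 4 4) + (q ^ 18 * appellPow (q ^ 7) 7 6 4) + (-1) * (q ^ 22 *
      appellPow (q ^ 7) 7 7 4) + (q ^ 30 * appellPow (q ^ 7) 7 9 4) + (-1) * (q ^ 25 *
      appellPow (q ^ 7) 7 6 5) + (q ^ 30 * appellPow (q ^ 7) 7 7 5)) + g ^ 2 * ((q ^
      2 * appellPow (q ^ 7) 7 5 1) + (-1) * (q ^ 3 * appellPow (q ^ 7) 7 6 1) + (q ^ 4 *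
      appellPow (q ^ 7) 7 7 1) + (-1) * (q ^ 5 * appellPow (q ^ 7) 7 8 1) + (q ^ 7 *
      appellPow (q ^ 7) 7 6 2) + (-1) * (q ^ 9 * appellPow (q ^ 7) 7 7 2) + (q ^ 6 *
      appellPow (q ^ 7) 7 4 3) + (-1) * (q ^ 21 * appellPow (q ^ 7) 7 9 3) + (q ^ 18 *
      appellPow (q ^ 7) 7 6 4) + (-1) * (q ^ 22 * appellPow (q ^ 7) 7 7 4) + (q ^ 20 *
      appellPow (q ^ 7) 7 5 5) + (-1) * (q ^ 25 * appellPow (q ^ 7) 7 6 5) + (q ^ 30 *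
      appellPow (q ^ 7) 7 7 5) + (-1) * (q ^ 35 * appellPow (q ^ 7) 7 8 5)) := by
  have hg3 : g ^ 3 + g ^ 2 - 2 * g - 1 = 0 := by rw [hg]; exact cubic_seven hζ
  have key := rank_eq_seven hq0 hq hζ (Or.inl rfl) hg
  change _ * RU ζ q = _ at key
  norm_num [Finset.sum_range_succ, Nat.choose, numSeven, cofSeven] at key
  linear_combination key + (((-1) * 1) * (q ^ 5 * appellPow (q ^ 7) 7 5 2) + (1) * (q ^ 7 *
      appellPow (q ^ 7) 7 6 2) + ((-1) * 1) * (q ^ 9 * appellPow (q ^ 7) 7 7 2) + (1) * (q ^ 11 *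
      appellPow (q ^ 7) 7 8 2) + (g) * (q ^ 9 * appellPow (q ^ 7) 7 5 3) + ((-1) * 1 + (-1) * g) *
      (q ^ 12 * appellPow (q ^ 7) 7 6 3) + (1 + g) * (q ^ 15 * appellPow (q ^ 7) 7 7 3) + ((-1) * g)
      * (q ^ 18 * appellPow (q ^ 7) 7 8 3) + ((-1) * 1) * (q ^ 14 * appellPow (q ^ 7) 7 5 4) + (1) *
      (q ^ 18 * appellPow (q ^ 7) 7 6 4) + ((-1) * 1) * (q ^ 22 * appellPow (q ^ 7) 7 7 4) + (1) *
      (q ^ 26 * appellPow (q ^ 7) 7 8 4)) * hg3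

/-- Inversion carries κ = 8 to κ = 6, so no new anchor appears; likewise κ = 9 goes to κ = 5 below.
-/
theorem appellPow_seven_eight {y : ℂ} (hy0 : y ≠ 0) (hy : ‖y‖ < 1) :
    appellPow y 7 8 1 = y * appellPow y 7 6 3 + qPochInf (y ^ 7) (y ^ 7) ^ 3 / (thetaPow y 7 2) ∧
    appellPow y 7 8 2 = thetaPow y 7 3 * appellPow y 7 6 3 / (thetaPow y 7 2) ∧
    appellPow y 7 8 3 = thetaPow y 7 3 * appellPow y 7 6 3 / (y * thetaPow y 7 2) - thetaPow y 7
        1 ^ 2 * qPochInf (y ^ 7) (y ^ 7) ^ 3 / (y * thetaPow y 7 2 * thetaPow y 7 3 ^ 2) ∧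
    appellPow y 7 8 4 = appellPow y 7 6 3 / (y ^ 2) ∧
    appellPow y 7 8 5 = thetaPow y 7 1 * appellPow y 7 6 3 / (y ^ 3 * thetaPow y 7 2) + thetaPow
        y 7 1 * qPochInf (y ^ 7) (y ^ 7) ^ 3 / (y ^ 4 * thetaPow y 7 2 ^ 2) := by
  have n1 : thetaPow y 7 1 ≠ 0 := thetaPow_ne_zero hy0 hy (by norm_num) (by norm_num)
  have n2 : thetaPow y 7 2 ≠ 0 := thetaPow_ne_zero hy0 hy (by norm_num) (by norm_num)
  have n3 : thetaPow y 7 3 ≠ 0 := thetaPow_ne_zero hy0 hy (by norm_num) (by norm_num)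
  obtain ⟨a1, a2, a4, a5, a6⟩ := appellPow_seven_six hy0 hy
  refine ⟨?_, ?_, ?_, ?_, ?_⟩
  · refine mul_left_cancel₀ (pow_ne_zero 10 hy0)
      ((appellPow_inv hy0 (ℓ := 7) (κ := 8) (κ' := 6) (s := 1) (s' := 6) rfl rfl).trans ?_)
    rw [a6]
    field_simp
  · refine mul_left_cancel₀ (pow_ne_zero 12 hy0)
      ((appellPow_inv hy0 (ℓ := 7) (κ := 8) (κ' := 6) (s := 2) (s' := 5) rfl rfl).trans ?_)
    rw [a5]
    field_simp
    ring
  · refine mul_left_cancel₀ (pow_ne_zero 14 hy0)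
      ((appellPow_inv hy0 (ℓ := 7) (κ := 8) (κ' := 6) (s := 3) (s' := 4) rfl rfl).trans ?_)
    rw [a4]
  · refine mul_left_cancel₀ (pow_ne_zero 16 hy0)
      ((appellPow_inv hy0 (ℓ := 7) (κ := 8) (κ' := 6) (s := 4) (s' := 3) rfl rfl).trans ?_)
    field_simp
    ring
  · refine mul_left_cancel₀ (pow_ne_zero 18 hy0)
      ((appellPow_inv hy0 (ℓ := 7) (κ := 8) (κ' := 6) (s := 5) (s' := 2) rfl rfl).trans ?_)
    rw [a2]
    field_simp

theorem appellPow_seven_nine {y : ℂ} (hy0 : y ≠ 0) (hy : ‖y‖ < 1) :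
    appellPow y 7 9 1 = thetaPow y 7 3 * appellPow y 7 5 3 / (thetaPow y 7 1) ∧
    appellPow y 7 9 2 = thetaPow y 7 3 * appellPow y 7 5 3 / (y * thetaPow y 7 1) - qPochInf (y
        ^ 7) (y ^ 7) ^ 3 / (y * thetaPow y 7 3) ∧
    appellPow y 7 9 3 = thetaPow y 7 2 * appellPow y 7 5 3 / (y ^ 2 * thetaPow y 7 1) - thetaPow
        y 7 2 * qPochInf (y ^ 7) (y ^ 7) ^ 3 / (y ^ 2 * thetaPow y 7 3 ^ 2) ∧
    appellPow y 7 9 4 = appellPow y 7 5 3 / (y ^ 3) ∧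
    appellPow y 7 9 5 = qPochInf (y ^ 7) (y ^ 7) ^ 3 / (y ^ 5 * thetaPow y 7 2) := by
  have n1 : thetaPow y 7 1 ≠ 0 := thetaPow_ne_zero hy0 hy (by norm_num) (by norm_num)
  have n2 : thetaPow y 7 2 ≠ 0 := thetaPow_ne_zero hy0 hy (by norm_num) (by norm_num)
  have n3 : thetaPow y 7 3 ≠ 0 := thetaPow_ne_zero hy0 hy (by norm_num) (by norm_num)
  obtain ⟨a1, a2, a4, a5, a6⟩ := appellPow_seven_five hy0 hy
  refine ⟨?_, ?_, ?_, ?_, ?_⟩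
  · refine mul_left_cancel₀ (pow_ne_zero 11 hy0)
      ((appellPow_inv hy0 (ℓ := 7) (κ := 9) (κ' := 5) (s := 1) (s' := 6) rfl rfl).trans ?_)
    rw [a6]
    field_simp
    ring
  · refine mul_left_cancel₀ (pow_ne_zero 13 hy0)
      ((appellPow_inv hy0 (ℓ := 7) (κ := 9) (κ' := 5) (s := 2) (s' := 5) rfl rfl).trans ?_)
    rw [a5]
    field_simp
  · refine mul_left_cancel₀ (pow_ne_zero 15 hy0)
      ((appellPow_inv hy0 (ℓ := 7) (κ := 9) (κ' := 5) (s := 3) (s' := 4) rfl rfl).trans ?_)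
    rw [a4]
    field_simp
  · refine mul_left_cancel₀ (pow_ne_zero 17 hy0)
      ((appellPow_inv hy0 (ℓ := 7) (κ := 9) (κ' := 5) (s := 4) (s' := 3) rfl rfl).trans ?_)
    field_simp
    ring
  · refine mul_left_cancel₀ (pow_ne_zero 19 hy0)
      ((appellPow_inv hy0 (ℓ := 7) (κ := 9) (κ' := 5) (s := 5) (s' := 2) rfl rfl).trans ?_)
    rw [a2]
    field_simp

theorem RU_seven {q ζ : ℂ} (hq0 : q ≠ 0) (hq : ‖q‖ < 1) (hζ : IsPrimitiveRoot ζ 7) :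
    RU ζ q =
      q * (E 49 q * P 7 3 q / (P 7 1 q * P 7 2 q ^ 2))
      - (ζ ^ 2 + ζ ^ 5) * (q ^ 15 / (E 49 q * P 7 3 q)) * lambert 49 91 21 q
      - (ζ ^ 3 + ζ ^ 4) * q ^ 2 * (E 49 q / (P 7 1 q * P 7 2 q))
      + q ^ 3 * (E 49 q / (P 7 1 q * P 7 3 q))
      + (ζ + ζ ^ 6) * q ^ 4 * (E 49 q / P 7 2 q ^ 2)
      + (ζ + ζ ^ 6) * (q ^ 11 / (E 49 q * P 7 2 q)) * lambert 49 77 21 q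
      + (1 + ζ ^ 3 + ζ ^ 4) * q ^ 6 * (E 49 q / P 7 3 q ^ 2)
      - (1 + ζ ^ 3 + ζ ^ 4) * (q ^ 6 / (E 49 q * P 7 1 q)) * lambert 49 63 21 q := by
  have hζ0 := hζ.ne_zero (by norm_num)
  have h7 : 1 + ζ + ζ ^ 2 + ζ ^ 3 + ζ ^ 4 + ζ ^ 5 + ζ ^ 6 = 0 := by
    have := hζ.geom_sum_eq_zero (by norm_num)
    simpa [Finset.sum_range_succ] using this
  obtain ⟨g, hg⟩ : ∃ g, g = ζ + ζ ^ 6 := ⟨_, rfl⟩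
  have hg3 : g ^ 3 + g ^ 2 - 2 * g - 1 = 0 := by rw [hg]; exact cubic_seven hζ
  have z2 : ζ ^ 2 + ζ ^ 5 = g ^ 2 - 2 := by
    rw [hg]
    linear_combination ((2) * 1 + (-2) * ζ + ζ ^ 5 + (-1) * ζ ^ 6) * h7
  have z3 : ζ ^ 3 + ζ ^ 4 = 1 - g - g ^ 2 := by
    linear_combination h7 - z2 + hg
  have hΘ : thetaPow (q ^ 7) 7 3 - (1 + g) * q * thetaPow (q ^ 7) 7 2 +
      (g ^ 2 + g - 1) * q ^ 3 * thetaPow (q ^ 7) 7 1 ≠ 0 := by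
    have h1 := theta_root_ne_zero hq0 hq hζ (by norm_num)
    rw [theta_seven hq0 hq hζ hg] at h1
    exact right_ne_zero_of_mul h1
  have key := RU_seven_expand hq0 hq hζ hg
  have l1 : lambert 49 91 21 q = appellPow (q ^ 7) 7 7 3 :=
    lambert_eq_appellPow (by norm_num) (by norm_num) (by norm_num) hq0
  have l2 : lambert 49 77 21 q = appellPow (q ^ 7) 7 6 3 :=
    lambert_eq_appellPow (by norm_num) (by norm_num) (by norm_num) hq0
  have l3 : lambert 49 63 21 q = appellPow (q ^ 7) 7 5 3 :=
    lambert_eq_appellPow (by norm_num) (by norm_num) (by norm_num) hq0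
  have hE := E_ne_zero hq (a := 49) (by norm_num)
  have hP1 := P_ne_zero hq0 hq (ℓ := 7) (a := 1) (by norm_num) (by norm_num)
  have hP2 := P_ne_zero hq0 hq (ℓ := 7) (a := 2) (by norm_num) (by norm_num)
  have hP3 := P_ne_zero hq0 hq (ℓ := 7) (a := 3) (by norm_num) (by norm_num)
  have e1 : thetaPow (q ^ 7) 7 1 = E 49 q * P 7 1 q := thetaPow_eq_E_mul_P hq0 hq (by norm_num) 1
  have e2 : thetaPow (q ^ 7) 7 2 = E 49 q * P 7 2 q := thetaPow_eq_E_mul_P hq0 hq (by norm_num) 2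
  have e3 : thetaPow (q ^ 7) 7 3 = E 49 q * P 7 3 q := thetaPow_eq_E_mul_P hq0 hq (by norm_num) 3
  have hJ : qPochInf ((q ^ 7) ^ 7) ((q ^ 7) ^ 7) = E 49 q := by rw [E, ← pow_mul]
  have hy0 : q ^ 7 ≠ 0 := pow_ne_zero 7 hq0
  have hy : ‖q ^ 7‖ < 1 := norm_pow_lt_one' hq (by norm_num)
  have rel := thetaPow_seven_relation hy0 hy
  rw [e1, e2, e3] at rel
  -- The quartic relation is homogeneous, so E(49)⁴ can be removed.
  have rel' : P 7 2 q ^ 3 * P 7 3 q - P 7 1 q * P 7 3 q ^ 3 - q ^ 7 * P 7 1 q ^ 3 * P 7 2 q = 0 :=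
    mul_left_cancel₀ (pow_ne_zero 4 hE) (by linear_combination -rel)
  obtain ⟨a42, a43, a44, a45⟩ := appellPow_seven_four hy0 hy
  obtain ⟨a51, a52, a54, a55, -⟩ := appellPow_seven_five hy0 hy
  obtain ⟨a61, a62, a64, a65, -⟩ := appellPow_seven_six hy0 hy
  obtain ⟨a71, a72, a74, a75⟩ := appellPow_seven_seven hy0 hy
  obtain ⟨a81, a82, a83, a84, a85⟩ := appellPow_seven_eight hy0 hy
  obtain ⟨a91, a92, a93, a94, a95⟩ := appellPow_seven_nine hy0 hy
  rw [l1, l2, l3, z2, z3, add_assoc 1, z3, ← hg]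
  refine mul_left_cancel₀ hΘ (key.trans ?_)
  simp only [a42, a43, a44, a45, a51, a52, a54, a55, a61, a62, a64, a65, a71, a72, a74, a75,
      a81, a82, a83, a84, a85, a91, a92, a93, a94, a95, e1, e2, e3, hJ]
  generalize appellPow (q ^ 7) 7 4 1 = A
  generalize appellPow (q ^ 7) 7 5 3 = B
  generalize appellPow (q ^ 7) 7 6 3 = C
  generalize appellPow (q ^ 7) 7 7 3 = D
  have c0 := rank_seven_coeff_zero A B C D hq0 hE hP1 hP2 hP3
  have c1 := rank_seven_coeff_one A B C D hq0 hE hP1 hP2 hP3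
  have c2 := rank_seven_coeff_two B C D hq0 hE hP1 hP2 hP3
  rw [rel'] at c0 c1 c2
  generalize E 49 q = J at *
  generalize P 7 1 q = P₁ at *
  generalize P 7 2 q = P₂ at *
  generalize P 7 3 q = P₃ at *
  -- Θ and the claimed value are both quadratic in g. The multiple of `hg3` reduces the g³ and g⁴
  -- terms of their product, using g⁴ = 3g² - g - 1; the coefficients of 1, g, g² then match `c0`,
  -- `c1`, `c2`.
  linear_combination c0 + g * c1 + g ^ 2 * c2 - (((-q * (J * P₂) + q ^ 3 * (J * P₁)) * (-(q ^ 15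
      / (J * P₃)) * D + q ^ 2 * (J / (P₁ * P₂)) - q ^ 6 * (J / P₃ ^ 2) + q ^ 6 / (J * P₁) * B) + (q
      ^ 3 * (J * P₁)) * (q ^ 2 * (J / (P₁ * P₂)) + q ^ 4 * (J / P₂ ^ 2) + q ^ 11 / (J * P₂) * C - q
      ^ 6 * (J / P₃ ^ 2) + q ^ 6 / (J * P₁) * B)) + (g - 1) * (q ^ 3 * (J * P₁)) * (-(q ^ 15 / (J *
      P₃)) * D + q ^ 2 * (J / (P₁ * P₂)) - q ^ 6 * (J / P₃ ^ 2) + q ^ 6 / (J * P₁) * B)) * hg3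

/-! ### Absolute convergence -/

theorem summable_lambertTerm {A B C : ℤ} (hA : 0 < A) (hAB : Even (A + B)) {q : ℂ}
    (hq0 : q ≠ 0) (hq : ‖q‖ < 1) : Summable (lambertTerm A B C q) := by
  obtain ⟨i, hi⟩ := hAB
  have hQ : ‖q ^ A‖ < 1 := by
    rw [norm_zpow]
    exact zpow_lt_one₀ (norm_pos_iff.2 hq0) hq hA
  refine (summable_appell (zpow_ne_zero A hq0) hQ (zpow_ne_zero i hq0)
    (zpow_ne_zero C hq0)).congr fun n => ?_
  have h1 : (A * n ^ 2 + B * n) / 2 = A * tri n + i * n := by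
    have : A * n ^ 2 + B * n = 2 * (A * tri n + i * n) := by
      linear_combination (-A) * two_mul_tri n + n * hi
    rw [this, Int.mul_ediv_cancel_left _ (by norm_num)]
  rw [lambertTerm, h1, add_comm (A * n), zpow_add₀ hq0, zpow_add₀ hq0, zpow_mul, zpow_mul,
    zpow_mul]
  ring

/-- Each factor is at most 1 + r^j in norm, which gives a majorant independent of q on the closed
disc of radius r. -/
theorem norm_qPoch_le {z q : ℂ} {r : ℝ} (hz : ‖z‖ ≤ 1) (hq : ‖q‖ ≤ r) (n : ℕ) :
    ‖qPoch z q n‖ ≤ ‖qPoch (-1) r n‖ := by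
  have hr : 0 ≤ r := (norm_nonneg _).trans hq
  rw [qPoch, qPoch, norm_prod, norm_prod]
  refine Finset.prod_le_prod (fun _ _ => norm_nonneg _) fun j _ => ?_
  have h1 : (1 : ℂ) - -1 * (r : ℂ) ^ j = ((1 + r ^ j : ℝ) : ℂ) := by push_cast; ring
  rw [h1, Complex.norm_of_nonneg (by positivity)]
  refine (norm_sub_le _ _).trans ?_
  rw [norm_one, norm_mul, norm_pow]
  have : ‖z‖ * ‖q‖ ^ j ≤ 1 * r ^ j := by gcongr
  linarith

theorem norm_inv_qPoch_self_le {q : ℂ} {r : ℝ} (hq : ‖q‖ ≤ r) (hr : r < 1) (n : ℕ) :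
    ‖(qPoch q q n)⁻¹‖ ≤ ‖(qPoch r r n)⁻¹‖ := by
  have hr0 : 0 ≤ r := (norm_nonneg _).trans hq
  have hr' : ‖(r : ℂ)‖ < 1 := by rwa [Complex.norm_of_nonneg hr0]
  rw [norm_inv, norm_inv]
  refine inv_anti₀ (norm_pos_iff.2 (qPoch_self_ne_zero hr' n)) ?_
  rw [qPoch, qPoch, norm_prod, norm_prod]
  refine Finset.prod_le_prod (fun _ _ => norm_nonneg _) fun j _ => ?_
  have h0 : r * r ^ j ≤ 1 := mul_le_one₀ hr.le (by positivity) (pow_le_one₀ hr0 hr.le)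
  have h1 : (1 : ℂ) - r * (r : ℂ) ^ j = ((1 - r * r ^ j : ℝ) : ℂ) := by push_cast; ring
  rw [h1, Complex.norm_of_nonneg (by linarith)]
  have h2 := norm_sub_norm_le (1 : ℂ) (q * q ^ j)
  rw [norm_one, norm_mul, norm_pow] at h2
  have : ‖q‖ * ‖q‖ ^ j ≤ r * r ^ j := by gcongr
  linarith

/-- Since ρ₁ρ₂ = 1 the n-th term carries q^(en), and the remaining factors are bounded uniformly for
|q| ≤ r. The bound yields both absolute convergence and holomorphy of the sum. -/
theorem exists_bound_rankTerm {ζ : ℂ} (hζ : ‖ζ‖ = 1) {e : ℕ} (he : e ≠ 0) {r : ℝ} (hr0 : 0 ≤ r)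
    (hr : r < 1) : ∃ C : ℝ, ∀ q : ℂ, ‖q‖ ≤ r → ∀ n,
      ‖rankTerm e (ζ ^ 2) (ζ ^ (-2 : ℤ)) ζ q n‖ ≤ C * r ^ n := by
  have hr' : ‖(r : ℂ)‖ < 1 := by rwa [Complex.norm_of_nonneg hr0]
  obtain ⟨M, hM0, hM⟩ := exists_bound_qPoch (-1) hr'
  obtain ⟨K, hK0, hK⟩ := exists_bound_of_tendsto (tendsto_inv_qPoch_self hr')
  refine ⟨M * M * M * M * K, fun q hq n => ?_⟩
  have hb : ∀ z : ℂ, ‖z‖ = 1 → ‖qPoch z q n‖ ≤ M := fun z hz =>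
    (norm_qPoch_le hz.le hq n).trans (hM n)
  have h1 := hb ζ hζ
  have h2 := hb ζ⁻¹ (by rw [norm_inv, hζ, inv_one])
  have h3 := hb (ζ ^ 2) (by rw [norm_pow, hζ, one_pow])
  have h4 := hb (ζ ^ (-2 : ℤ)) (by rw [norm_zpow, hζ, one_zpow])
  have h5 := (norm_inv_qPoch_self_le hq hr (2 * n)).trans (hK (2 * n))
  have h6 : ‖(q ^ e / (ζ ^ 2 * ζ ^ (-2 : ℤ))) ^ n‖ ≤ r ^ n := by
    rw [norm_pow, norm_div, norm_mul, norm_pow, norm_pow, norm_zpow, hζ, one_pow, one_zpow,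
      mul_one, div_one]
    gcongr
    exact (pow_le_of_le_one (norm_nonneg _) (hq.trans hr.le) he).trans hq
  rw [rankTerm, div_eq_mul_inv]
  simp only [norm_mul]
  calc _ ≤ M * M * M * M * r ^ n * K := by gcongr
    _ = _ := by ring

theorem summable_rankTerm {ζ : ℂ} (hζ : ‖ζ‖ = 1) {e : ℕ} (he : e ≠ 0) {q : ℂ} (hq : ‖q‖ < 1) :
    Summable (fun n : ℕ => rankTerm e (ζ ^ 2) (ζ ^ (-2 : ℤ)) ζ q (n + 1)) := by
  obtain ⟨C, hC⟩ := exists_bound_rankTerm hζ he (norm_nonneg q) hq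
  refine (summable_nat_add_iff 1).2 (Summable.of_norm_bounded (g := fun n => C * ‖q‖ ^ n)
    ((summable_geometric_of_lt_one (norm_nonneg q) hq).mul_left C) (hC q le_rfl))

/-! ### Analyticity -/

theorem differentiableOn_qPochInf (z : ℂ) :
    DifferentiableOn ℂ (fun q => qPochInf z q) (Metric.ball 0 1) := by
  have h : MultipliableLocallyUniformlyOn (fun (n : ℕ) (q : ℂ) => 1 - z * q ^ n)
      (Metric.ball (0 : ℂ) 1) := by
    refine ⟨fun q => qPochInf z q, ?_⟩
    simp_rw [qPochInf, sub_eq_add_neg]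
    refine hasProdLocallyUniformlyOn_of_forall_compact Metric.isOpen_ball fun K hK hcK => ?_
    rcases K.eq_empty_or_nonempty with hN | hN
    · simpa [hasProdUniformlyOn_iff_tendstoUniformlyOn, hN] using tendstoUniformlyOn_empty
    -- A point of maximal norm in K provides one geometric majorant valid on all of K.
    · obtain ⟨q₀, hq₀, _, HB⟩ := hcK.exists_sSup_image_eq_and_ge hN
        (show ContinuousOn (fun q : ℂ => ‖q‖) K by fun_prop)
      refine ((summable_geometric_of_lt_one (norm_nonneg q₀)
        (by simpa using hK hq₀)).mul_left ‖z‖).hasProdUniformlyOn_nat_one_add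
        hcK (.of_forall fun n x hx => ?_) (fun _ => by fun_prop)
      rw [norm_neg, norm_mul, norm_pow]
      gcongr
      exact HB x hx
  exact h.hasProdLocallyUniformlyOn.differentiableOn (.of_forall fun _ => by
    simpa [Finset.prod_fn] using DifferentiableOn.finsetProd (fun _ _ => by fun_prop))
    Metric.isOpen_ball

theorem differentiableOn_rankFactor {ρ₁ ρ₂ z : ℂ} (h1 : ‖ρ₁‖ = 1) (h1' : ρ₁ ≠ 1) (h2 : ‖ρ₂‖ = 1)
    (h2' : ρ₂ ≠ 1) (h3 : ‖z‖ = 1) (h3' : z ≠ 1) :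
    DifferentiableOn ℂ (fun q => rankFactor ρ₁ ρ₂ z q) (Metric.ball 0 1) := by
  have hb : ∀ q ∈ Metric.ball (0 : ℂ) 1, ‖q‖ < 1 := fun q hq => by simpa using hq
  have hself : DifferentiableOn ℂ (fun q => qPochInf q q) (Metric.ball 0 1) := by
    simpa only [qPochInf, ← pow_succ'] using ModularForm.differentiableOn_tprod_one_sub_pow
  refine hself.div ((((differentiableOn_qPochInf _).mul (differentiableOn_qPochInf _)).mul
    (differentiableOn_qPochInf _)).mul (differentiableOn_qPochInf _)) fun q hq => ?_
  have hq' := hb q hq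
  refine mul_ne_zero (mul_ne_zero (mul_ne_zero ?_ ?_) ?_) ?_
  · exact qPochInf_ne_zero_of_norm_eq_one hq' h3 h3'
  · exact qPochInf_ne_zero_of_norm_eq_one hq' (by rw [norm_inv, h3, inv_one]) (by simpa using h3')
  · exact qPochInf_ne_zero_of_norm_eq_one hq' h1 h1'
  · exact qPochInf_ne_zero_of_norm_eq_one hq' h2 h2'

theorem differentiableOn_tsum_rankTerm {ζ : ℂ} (hζ : ‖ζ‖ = 1) {e : ℕ} (he : e ≠ 0) :
    DifferentiableOn ℂ (fun q => ∑' n : ℕ, rankTerm e (ζ ^ 2) (ζ ^ (-2 : ℤ)) ζ q (n + 1))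
      (Metric.ball 0 1) := by
  intro q hq
  have hq' : ‖q‖ < 1 := by simpa using hq
  obtain ⟨r, hr1, hr2⟩ := exists_between hq'
  have hr0 : 0 ≤ r := (norm_nonneg _).trans hr1.le
  obtain ⟨C, hC⟩ := exists_bound_rankTerm hζ he hr0 hr2
  have hs : Summable fun n : ℕ => C * r ^ (n + 1) :=
    ((summable_nat_add_iff 1).2 (summable_geometric_of_lt_one hr0 hr2)).mul_left C
  have hd : DifferentiableOn ℂ
      (fun q => ∑' n : ℕ, rankTerm e (ζ ^ 2) (ζ ^ (-2 : ℤ)) ζ q (n + 1)) (Metric.ball 0 r) := by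
    refine Complex.differentiableOn_tsum_of_summable_norm hs (fun n => ?_) Metric.isOpen_ball
      fun n w hw => hC w (by simpa using (Metric.mem_ball.1 hw).le) _
    unfold rankTerm qPoch
    refine DifferentiableOn.div (by fun_prop) (by fun_prop) fun w hw => ?_
    exact qPoch_self_ne_zero ((by simpa using hw : ‖w‖ < r).trans hr2) _
  exact (hd.differentiableAt (Metric.isOpen_ball.mem_nhds (by simpa using
      hr1))).differentiableWithinAt

/-! ### Power series expansions and vanishing coefficients -/

theorem HasQExpansion.of_differentiableOn {f : ℂ → ℂ}
    (hf : DifferentiableOn ℂ f (Metric.ball 0 1)) : ∃ a, HasQExpansion f a := by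
  refine ⟨fun n => (n.factorial : ℂ)⁻¹ * iteratedDeriv n f 0, fun q hq => ?_⟩
  refine (Complex.hasSum_taylorSeries_on_ball hf (z := q) (by simpa using hq)).congr_fun ?_
  intro n
  simp only [smul_eq_mul, sub_zero]
  ring

theorem HasQExpansion.eq_zero {a : ℕ → ℂ} (h : HasQExpansion (fun _ => 0) a) (n : ℕ) :
    a n = 0 := by
  have h1 : HasFPowerSeriesAt (fun _ : ℂ => (0 : ℂ)) (FormalMultilinearSeries.ofScalars ℂ a) 0 := by
    rw [hasFPowerSeriesAt_iff]
    filter_upwards [Metric.ball_mem_nhds (0 : ℂ) one_pos] with q hq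
    simpa [FormalMultilinearSeries.coeff_ofScalars, mul_comm] using h q (by simpa using hq)
  have h2 := HasFPowerSeriesAt.eq_zero h1
  rw [← FormalMultilinearSeries.coeff_ofScalars (𝕜 := ℂ) (p := a) (n := n), h2]
  rfl

theorem geom_sum_root_pow {ω : ℂ} {ℓ : ℕ} (hω : IsPrimitiveRoot ω ℓ) (m : ℕ) :
    ∑ j ∈ range ℓ, (ω ^ m) ^ j = if ℓ ∣ m then (ℓ : ℂ) else 0 := by
  split_ifs with h
  · rw [(hω.pow_eq_one_iff_dvd m).2 h]
    simp
  · have h1 : ω ^ m - 1 ≠ 0 := sub_ne_zero.2 fun h1 => h ((hω.pow_eq_one_iff_dvd m).1 h1)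
    refine mul_left_cancel₀ h1 ?_
    rw [mul_geom_sum, ← pow_mul, mul_comm, pow_mul, hω.pow_eq_one]
    simp

/-- If `f` is a sum of terms `q ^ k * g (q ^ ℓ)`, then its coefficients vanish in every residue
class modulo `ℓ` which contains none of the exponents `k`. -/
theorem HasQExpansion.coeff_eq_zero {f : ℂ → ℂ} {a : ℕ → ℂ} (hf : HasQExpansion f a) {ω : ℂ}
    {ℓ : ℕ} (hℓ : ℓ ≠ 0) (hω : IsPrimitiveRoot ω ℓ) (h0 : f 0 = 0) {m : ℕ} (k : Fin m → ℕ)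
    (g : Fin m → ℂ → ℂ)
    (hg : ∀ q : ℂ, q ≠ 0 → ‖q‖ < 1 → f q = ∑ i, q ^ k i * g i (q ^ ℓ)) {n : ℕ}
    (hn : ∀ i, ¬ k i ≡ n [MOD ℓ]) : a n = 0 := by
  have hn1 : ‖ω‖ = 1 := hω.norm'_eq_one hℓ
  -- The exponent (ℓ - 1) n plays the role of -n modulo ℓ, so the weights ω^(-jn) project onto the
  -- residue class of n.
  have hdvd : ℓ ∣ (ℓ - 1) * n + n := by
    obtain ⟨l, rfl⟩ := Nat.exists_eq_succ_of_ne_zero hℓ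
    exact ⟨n, by simp [Nat.succ_mul]⟩
  have key : HasQExpansion (fun _ => 0)
      fun p => (∑ j ∈ range ℓ, (ω ^ ((ℓ - 1) * n + p)) ^ j) * a p := by
    intro q hq
    have hj : ∀ j : ℕ, ‖ω ^ j * q‖ < 1 := fun j => by rwa [norm_mul, norm_pow, hn1, one_pow,
        one_mul]
    have h1 := hasSum_sum (s := range ℓ) fun j _ =>
      (hf _ (hj j)).mul_left ((ω ^ ((ℓ - 1) * n)) ^ j)
    have h2 : ∑ j ∈ range ℓ, (ω ^ ((ℓ - 1) * n)) ^ j * f (ω ^ j * q) = 0 := by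
      -- The decomposition of f is available only for q ≠ 0; at the origin f itself vanishes.
      rcases eq_or_ne q 0 with rfl | hq0
      · simp [h0]
      have h3 : ∀ j, f (ω ^ j * q) = ∑ i, (ω ^ j * q) ^ k i * g i (q ^ ℓ) := fun j => by
        rw [hg _ (mul_ne_zero (pow_ne_zero _ (hω.ne_zero hℓ)) hq0) (hj j)]
        refine Finset.sum_congr rfl fun i _ => ?_
        rw [mul_pow _ _ ℓ, ← pow_mul, mul_comm j, pow_mul, hω.pow_eq_one, one_pow, one_mul]
      simp only [h3, Finset.mul_sum]
      rw [Finset.sum_comm]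
      refine Finset.sum_eq_zero fun i _ => ?_
      have h4 : ∑ j ∈ range ℓ, (ω ^ ((ℓ - 1) * n + k i)) ^ j = 0 := by
        rw [geom_sum_root_pow hω, if_neg]
        exact fun h => hn i (Nat.ModEq.add_left_cancel' ((ℓ - 1) * n)
          ((Nat.modEq_zero_iff_dvd.2 h).trans (Nat.modEq_zero_iff_dvd.2 hdvd).symm))
      rw [← mul_zero (q ^ k i * g i (q ^ ℓ)), ← h4, Finset.mul_sum]
      refine Finset.sum_congr rfl fun j _ => ?_
      rw [pow_add]
      ring
    rw [h2] at h1
    refine h1.congr_fun fun p => ?_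
    simp only [Finset.sum_mul]
    refine Finset.sum_congr rfl fun j _ => ?_
    rw [pow_add]
    ring
  have h1 := key.eq_zero n
  rw [geom_sum_root_pow hω, if_pos hdvd] at h1
  exact (mul_eq_zero.1 h1).resolve_left (Nat.cast_ne_zero.2 hℓ)

theorem differentiableOn_rank {ζ : ℂ} {ℓ : ℕ} (hζ : IsPrimitiveRoot ζ ℓ) (hℓ : 2 < ℓ) {e : ℕ}
    (he : e ≠ 0) : DifferentiableOn ℂ (fun q => rankFactor (ζ ^ 2) (ζ ^ (-2 : ℤ)) ζ q *
      ∑' n : ℕ, rankTerm e (ζ ^ 2) (ζ ^ (-2 : ℤ)) ζ q (n + 1)) (Metric.ball 0 1) := by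
  have hn : ‖ζ‖ = 1 := hζ.norm'_eq_one (by omega)
  have h2 : ζ ^ 2 ≠ 1 := hζ.pow_ne_one_of_pos_of_lt (by norm_num) hℓ
  refine (differentiableOn_rankFactor ?_ h2 ?_ ?_ hn (hζ.ne_one (by omega))).mul
    (differentiableOn_tsum_rankTerm hn he)
  · rw [norm_pow, hn, one_pow]
  · rw [norm_zpow, hn, one_zpow]
  · rw [zpow_neg]
    exact inv_ne_one.2 h2

theorem rankTerm_zero_right {e : ℕ} (he : e ≠ 0) (ρ₁ ρ₂ z : ℂ) (n : ℕ) :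
    rankTerm e ρ₁ ρ₂ z 0 (n + 1) = 0 := by
  simp [rankTerm, he]

/-- The power series comes from holomorphy of `RU ζ`, so the functions `g i` need no regularity. The
value at q = 0 is 0 because the defining sum starts at n = 1. -/
theorem exists_expansion_RU {ζ : ℂ} {ℓ : ℕ} (hζ : IsPrimitiveRoot ζ ℓ) (hℓ : 2 < ℓ) {m : ℕ}
    (k : Fin m → ℕ) (g : Fin m → ℂ → ℂ)
    (hg : ∀ q : ℂ, q ≠ 0 → ‖q‖ < 1 → RU ζ q = ∑ i, q ^ k i * g i (q ^ ℓ)) :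
    ∃ a, HasQExpansion (RU ζ) a ∧ ∀ n, (∀ i, ¬ k i ≡ n [MOD ℓ]) → a n = 0 := by
  obtain ⟨a, ha⟩ := HasQExpansion.of_differentiableOn (differentiableOn_rank hζ hℓ one_ne_zero)
  exact ⟨a, ha, fun n => HasQExpansion.coeff_eq_zero (f := RU ζ) ha (by omega) hζ
    (by simp [RU, F, rankTerm_zero_right]) k g hg⟩

theorem exists_expansion_RV {ζ : ℂ} {ℓ : ℕ} (hζ : IsPrimitiveRoot ζ ℓ) (hℓ : 2 < ℓ) {m : ℕ}
    (k : Fin m → ℕ) (g : Fin m → ℂ → ℂ)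
    (hg : ∀ q : ℂ, q ≠ 0 → ‖q‖ < 1 → RV ζ q = ∑ i, q ^ k i * g i (q ^ ℓ)) :
    ∃ a, HasQExpansion (RV ζ) a ∧ ∀ n, (∀ i, ¬ k i ≡ n [MOD ℓ]) → a n = 0 := by
  obtain ⟨a, ha⟩ := HasQExpansion.of_differentiableOn (differentiableOn_rank hζ hℓ two_ne_zero)
  exact ⟨a, ha, fun n => HasQExpansion.coeff_eq_zero (f := RV ζ) ha (by omega) hζ
    (by simp [RV, G, rankTerm_zero_right]) k g hg⟩

theorem E_eq_pow {ℓ a k : ℕ} (h : a = ℓ * k) (q : ℂ) : E a q = E k (q ^ ℓ) := by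
  rw [E, E, h, pow_mul]

theorem P_eq_pow (ℓ a : ℕ) (q : ℂ) : P ℓ a q = jacProd ((q ^ ℓ) ^ a) ((q ^ ℓ) ^ ℓ) := by
  rw [P, pow_mul, ← pow_mul q ℓ ℓ, pow_two]

theorem expansion_three {ζ : ℂ} (hζ : IsPrimitiveRoot ζ 3) :
    (∃ a : ℕ → ℂ, HasQExpansion (RU ζ) a ∧ ∀ n : ℕ, a (3 * n) = 0) ∧
      (∃ b : ℕ → ℂ, HasQExpansion (RV ζ) b ∧ ∀ n : ℕ, b (3 * n + 1) = 0) := by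
  have hE := E_eq_pow (ℓ := 3) (a := 3) (k := 1) rfl
  have l1 : ∀ q : ℂ, q ≠ 0 → lambert 9 27 6 q = appellPow (q ^ 3) 3 4 2 := fun q hq0 =>
    lambert_eq_appellPow (by norm_num) (by norm_num) (by norm_num) hq0
  have l2 : ∀ q : ℂ, q ≠ 0 → lambert 9 21 6 q = appellPow (q ^ 3) 3 3 2 := fun q hq0 =>
    lambert_eq_appellPow (by norm_num) (by norm_num) (by norm_num) hq0
  have l3 : ∀ q : ℂ, q ≠ 0 → lambert 9 15 6 q = appellPow (q ^ 3) 3 2 2 := fun q hq0 =>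
    lambert_eq_appellPow (by norm_num) (by norm_num) (by norm_num) hq0
  -- The exponents 7, 5 cover the classes 1, 2 modulo 3; for RV, the exponents 3, 5 cover 0, 2.
  obtain ⟨a, ha, ha'⟩ := exists_expansion_RU hζ (by norm_num) ![7, 5]
    ![fun y => appellPow y 3 4 2 / E 1 y, fun y => -(appellPow y 3 3 2 / E 1 y)]
    fun q hq0 hq => by
      rw [(rank_three hq0 hq hζ).1, l1 q hq0, l2 q hq0, hE]
      simp [Fin.sum_univ_succ]
      ring
  obtain ⟨b, hb, hb'⟩ := exists_expansion_RV hζ (by norm_num) ![3, 5]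
    ![fun y => -(appellPow y 3 2 2 / E 1 y), fun y => appellPow y 3 3 2 / E 1 y]
    fun q hq0 hq => by
      rw [(rank_three hq0 hq hζ).2, l3 q hq0, l2 q hq0, hE]
      simp [Fin.sum_univ_succ]
      ring
  refine ⟨⟨a, ha, fun n => ha' _ fun i => ?_⟩, ⟨b, hb, fun n => hb' _ fun i => ?_⟩⟩ <;>
  · unfold Nat.ModEq
    fin_cases i <;> simp

theorem expansion_five {ζ : ℂ} (hζ : IsPrimitiveRoot ζ 5) :
    (∃ a : ℕ → ℂ, HasQExpansion (RU ζ) a ∧ ∀ n : ℕ, a (5 * n) = 0 ∧ a (5 * n + 3) = 0) ∧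
      (∃ b : ℕ → ℂ, HasQExpansion (RV ζ) b ∧
        ∀ n : ℕ, b (5 * n + 1) = 0 ∧ b (5 * n + 4) = 0) := by
  have hE := E_eq_pow (ℓ := 5) (a := 25) (k := 5) rfl
  have l1 : ∀ q : ℂ, q ≠ 0 → lambert 25 45 10 q = appellPow (q ^ 5) 5 5 2 := fun q hq0 =>
    lambert_eq_appellPow (by norm_num) (by norm_num) (by norm_num) hq0
  have l2 : ∀ q : ℂ, q ≠ 0 → lambert 25 35 10 q = appellPow (q ^ 5) 5 4 2 := fun q hq0 =>
    lambert_eq_appellPow (by norm_num) (by norm_num) (by norm_num) hq0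
  have l3 : ∀ q : ℂ, q ≠ 0 → lambert 25 35 15 q = appellPow (q ^ 5) 5 3 3 := fun q hq0 =>
    lambert_eq_appellPow (by norm_num) (by norm_num) (by norm_num) hq0
  have l4 : ∀ q : ℂ, q ≠ 0 → lambert 25 55 15 q = appellPow (q ^ 5) 5 5 3 := fun q hq0 =>
    lambert_eq_appellPow (by norm_num) (by norm_num) (by norm_num) hq0
  -- Modulo 5 the exponents cover 1, 2, 4; for RV, the exponents 5, 12, 2, 3 cover 0, 2, 3.
  obtain ⟨a, ha, ha'⟩ := exists_expansion_RU hζ (by norm_num) ![1, 7, 4]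
    ![fun y => E 5 y / jacProd (y ^ 1) (y ^ 5) ^ 2,
      fun y => -(appellPow y 5 5 2 / (E 5 y * jacProd (y ^ 2) (y ^ 5))),
      fun y => -(appellPow y 5 4 2 / (E 5 y * jacProd (y ^ 1) (y ^ 5)))]
    fun q hq0 hq => by
      rw [RU_five hq0 hq hζ, l1 q hq0, l2 q hq0, hE, P_eq_pow, P_eq_pow]
      simp [Fin.sum_univ_succ]
      ring
  obtain ⟨b, hb, hb'⟩ := exists_expansion_RV hζ (by norm_num) ![5, 12, 2, 3]
    ![fun y => -(appellPow y 5 3 3 / (E 5 y * jacProd (y ^ 1) (y ^ 5))),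
      fun y => appellPow y 5 5 3 / (E 5 y * jacProd (y ^ 2) (y ^ 5)),
      fun y => E 5 y / (jacProd (y ^ 1) (y ^ 5) * jacProd (y ^ 2) (y ^ 5)),
      fun y => -(E 5 y / jacProd (y ^ 2) (y ^ 5) ^ 2)]
    fun q hq0 hq => by
      rw [RV_five hq0 hq hζ, l3 q hq0, l4 q hq0, hE, P_eq_pow, P_eq_pow]
      simp [Fin.sum_univ_succ]
      ring
  refine ⟨⟨a, ha, fun n => ⟨ha' _ fun i => ?_, ha' _ fun i => ?_⟩⟩,
    ⟨b, hb, fun n => ⟨hb' _ fun i => ?_, hb' _ fun i => ?_⟩⟩⟩ <;>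
  · unfold Nat.ModEq
    fin_cases i <;> simp

theorem expansion_seven {ζ : ℂ} (hζ : IsPrimitiveRoot ζ 7) :
    ∃ a : ℕ → ℂ, HasQExpansion (RU ζ) a ∧ ∀ n : ℕ, a (7 * n) = 0 ∧ a (7 * n + 5) = 0 := by
  have hE := E_eq_pow (ℓ := 7) (a := 49) (k := 7) rfl
  have l1 : ∀ q : ℂ, q ≠ 0 → lambert 49 91 21 q = appellPow (q ^ 7) 7 7 3 := fun q hq0 =>
    lambert_eq_appellPow (by norm_num) (by norm_num) (by norm_num) hq0
  have l2 : ∀ q : ℂ, q ≠ 0 → lambert 49 77 21 q = appellPow (q ^ 7) 7 6 3 := fun q hq0 =>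
    lambert_eq_appellPow (by norm_num) (by norm_num) (by norm_num) hq0
  have l3 : ∀ q : ℂ, q ≠ 0 → lambert 49 63 21 q = appellPow (q ^ 7) 7 5 3 := fun q hq0 =>
    lambert_eq_appellPow (by norm_num) (by norm_num) (by norm_num) hq0
  -- The classes covered modulo 7 are 1, 2, 3, 4, 6; the two terms with q⁶ share one entry.
  obtain ⟨a, ha, ha'⟩ := exists_expansion_RU hζ (by norm_num) ![1, 15, 2, 3, 4, 11, 6]
    ![fun y => E 7 y * jacProd (y ^ 3) (y ^ 7) /
        (jacProd (y ^ 1) (y ^ 7) * jacProd (y ^ 2) (y ^ 7) ^ 2),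
      fun y => -(ζ ^ 2 + ζ ^ 5) * (appellPow y 7 7 3 / (E 7 y * jacProd (y ^ 3) (y ^ 7))),
      fun y => -(ζ ^ 3 + ζ ^ 4) * (E 7 y / (jacProd (y ^ 1) (y ^ 7) * jacProd (y ^ 2) (y ^ 7))),
      fun y => E 7 y / (jacProd (y ^ 1) (y ^ 7) * jacProd (y ^ 3) (y ^ 7)),
      fun y => (ζ + ζ ^ 6) * (E 7 y / jacProd (y ^ 2) (y ^ 7) ^ 2),
      fun y => (ζ + ζ ^ 6) * (appellPow y 7 6 3 / (E 7 y * jacProd (y ^ 2) (y ^ 7))),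
      fun y => (1 + ζ ^ 3 + ζ ^ 4) * (E 7 y / jacProd (y ^ 3) (y ^ 7) ^ 2 -
        appellPow y 7 5 3 / (E 7 y * jacProd (y ^ 1) (y ^ 7)))]
    fun q hq0 hq => by
      rw [RU_seven hq0 hq hζ, l1 q hq0, l2 q hq0, l3 q hq0, hE, P_eq_pow, P_eq_pow, P_eq_pow]
      simp [Fin.sum_univ_succ]
      ring
  refine ⟨a, ha, fun n => ⟨ha' _ fun i => ?_, ha' _ fun i => ?_⟩⟩ <;>
  · unfold Nat.ModEq
    fin_cases i <;> simp

end QuadRank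

end

/-! ### The main theorem. -/

theorem theorem1p2 :
    -- absolute convergence of all the series involved
    ((∀ ℓ ∈ ({3, 5, 7} : Set ℕ), ∀ ζ : ℂ, IsPrimitiveRoot ζ ℓ → ∀ q : ℂ, ‖q‖ < 1 →
        ∀ e ∈ ({1, 2} : Set ℕ),
          Summable (fun n : ℕ => QuadRank.rankTerm e (ζ ^ 2) (ζ ^ (-2 : ℤ)) ζ q (n + 1))) ∧
      (∀ A B C : ℤ, 0 < A → Even (A + B) → ¬ A ∣ C → ∀ q : ℂ, 0 < ‖q‖ → ‖q‖ < 1 →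
          Summable (QuadRank.lambertTerm A B C q))) ∧
    -- the two formulas for cube roots of unity
    (∀ ζ : ℂ, IsPrimitiveRoot ζ 3 → ∀ q : ℂ, 0 < ‖q‖ → ‖q‖ < 1 →
      QuadRank.RU ζ q =
          q ^ 7 / QuadRank.E 3 q * QuadRank.lambert 9 27 6 q
          - q ^ 5 / QuadRank.E 3 q * QuadRank.lambert 9 21 6 q ∧
      QuadRank.RV ζ q =
          - (q ^ 3 / QuadRank.E 3 q) * QuadRank.lambert 9 15 6 q
          + q ^ 5 / QuadRank.E 3 q * QuadRank.lambert 9 21 6 q) ∧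
    -- the two formulas for fifth roots of unity
    (∀ ζ : ℂ, IsPrimitiveRoot ζ 5 → ∀ q : ℂ, 0 < ‖q‖ → ‖q‖ < 1 →
      QuadRank.RU ζ q =
          q * (QuadRank.E 25 q / QuadRank.P 5 1 q ^ 2)
          - q ^ 7 / (QuadRank.E 25 q * QuadRank.P 5 2 q) * QuadRank.lambert 25 45 10 q
          - q ^ 4 / (QuadRank.E 25 q * QuadRank.P 5 1 q) * QuadRank.lambert 25 35 10 q ∧
      QuadRank.RV ζ q =
          - (q ^ 5 / (QuadRank.E 25 q * QuadRank.P 5 1 q)) * QuadRank.lambert 25 35 15 q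
          + q ^ 12 / (QuadRank.E 25 q * QuadRank.P 5 2 q) * QuadRank.lambert 25 55 15 q
          + q ^ 2 * (QuadRank.E 25 q / (QuadRank.P 5 1 q * QuadRank.P 5 2 q))
          - q ^ 3 * (QuadRank.E 25 q / QuadRank.P 5 2 q ^ 2)) ∧
    -- the formula for seventh roots of unity
    (∀ ζ : ℂ, IsPrimitiveRoot ζ 7 → ∀ q : ℂ, 0 < ‖q‖ → ‖q‖ < 1 →
      QuadRank.RU ζ q =
          q * (QuadRank.E 49 q * QuadRank.P 7 3 q / (QuadRank.P 7 1 q * QuadRank.P 7 2 q ^ 2))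
          - (ζ ^ 2 + ζ ^ 5) * (q ^ 15 / (QuadRank.E 49 q * QuadRank.P 7 3 q))
              * QuadRank.lambert 49 91 21 q
          - (ζ ^ 3 + ζ ^ 4) * q ^ 2
              * (QuadRank.E 49 q / (QuadRank.P 7 1 q * QuadRank.P 7 2 q))
          + q ^ 3 * (QuadRank.E 49 q / (QuadRank.P 7 1 q * QuadRank.P 7 3 q))
          + (ζ + ζ ^ 6) * q ^ 4 * (QuadRank.E 49 q / QuadRank.P 7 2 q ^ 2)
          + (ζ + ζ ^ 6) * (q ^ 11 / (QuadRank.E 49 q * QuadRank.P 7 2 q))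
              * QuadRank.lambert 49 77 21 q
          + (1 + ζ ^ 3 + ζ ^ 4) * q ^ 6 * (QuadRank.E 49 q / QuadRank.P 7 3 q ^ 2)
          - (1 + ζ ^ 3 + ζ ^ 4) * (q ^ 6 / (QuadRank.E 49 q * QuadRank.P 7 1 q))
              * QuadRank.lambert 49 63 21 q) ∧
    -- the vanishing of coefficients
    (∀ ζ : ℂ, IsPrimitiveRoot ζ 3 →
      (∃ a : ℕ → ℂ, QuadRank.HasQExpansion (QuadRank.RU ζ) a ∧ ∀ n : ℕ, a (3 * n) = 0) ∧
      (∃ b : ℕ → ℂ, QuadRank.HasQExpansion (QuadRank.RV ζ) b ∧ ∀ n : ℕ, b (3 * n + 1) = 0)) ∧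
    (∀ ζ : ℂ, IsPrimitiveRoot ζ 5 →
      (∃ a : ℕ → ℂ, QuadRank.HasQExpansion (QuadRank.RU ζ) a ∧
        ∀ n : ℕ, a (5 * n) = 0 ∧ a (5 * n + 3) = 0) ∧
      (∃ b : ℕ → ℂ, QuadRank.HasQExpansion (QuadRank.RV ζ) b ∧
        ∀ n : ℕ, b (5 * n + 1) = 0 ∧ b (5 * n + 4) = 0)) ∧
    (∀ ζ : ℂ, IsPrimitiveRoot ζ 7 →
      ∃ a : ℕ → ℂ, QuadRank.HasQExpansion (QuadRank.RU ζ) a ∧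
        ∀ n : ℕ, a (7 * n) = 0 ∧ a (7 * n + 5) = 0) := by
  refine ⟨⟨fun ℓ hℓ ζ hζ q hq e he => ?_, fun A B C hA hAB _ q hq0 hq =>
    QuadRank.summable_lambertTerm hA hAB (norm_pos_iff.1 hq0) hq⟩,
    fun ζ hζ q hq0 hq => QuadRank.rank_three (norm_pos_iff.1 hq0) hq hζ,
    fun ζ hζ q hq0 hq => ⟨QuadRank.RU_five (norm_pos_iff.1 hq0) hq hζ,
      QuadRank.RV_five (norm_pos_iff.1 hq0) hq hζ⟩,
    fun ζ hζ q hq0 hq => QuadRank.RU_seven (norm_pos_iff.1 hq0) hq hζ,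
    fun ζ hζ => QuadRank.expansion_three hζ, fun ζ hζ => QuadRank.expansion_five hζ,
    fun ζ hζ => QuadRank.expansion_seven hζ⟩
  refine QuadRank.summable_rankTerm (hζ.norm'_eq_one ?_) ?_ hq
  · rcases hℓ with rfl | rfl | rfl <;> norm_num
  · rcases he with rfl | rfl <;> norm_num
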